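/- **Setting.** Consider the plant $x_{k+1}=Ax_k+Bu_k+w_k$, $k\ge 0$, with $A\in\mathbb R^{n\times n}$, $B\in\mathbb R^{n\times m}$, spectral radius $\rho(A)>1$, and zero-mean Gaussian white noise $w_k$ with positive definite covariance matrix $R$. The initial state $x_0$ and the initial estimate $\hat x_0$ are square integrable. In each slot $k$ a half-duplex controller schedules either the sensor's transmission ($a_k=1$), which fails with probability $p_s\in(0,1)$, or its own transmission to the actuator ($a_k=2$), which fails with probability $p_c\in(0,1)$. The noise, the channel errors of all slots and the pair $(x_0,\hat x_0)$ are mutually independent. Write $\delta_k=1$ if $a_k=1$ and the transmission succeeds, $\gamma_k=1$ if $a_k=2$ and the transmission succeeds, and $0$ otherwise. *Estimation.* $\hat x_{k+1}=Ax_k+Bu_k$ if $\delta_k=1$, and $\hat x_{k+1}=A\hat x_k+Bu_k$ otherwise. *$v$-step predictive control.* Let $v\ge1$ and let the gain $K\in\mathbb R^{m\times n}$ satisfy $(A+BK)^v=0$. The actuator keeps a buffer of $v$ commands, initially zero. If $\gamma_k=1$, the buffer is set to $[K\hat x_k,\,K(A+BK)\hat x_k,\dots,K(A+BK)^{v-1}\hat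 x_k]$; otherwise it is shifted one step forward and filled up with $0$. The input $u_k$ is the first command in the buffer. *Policies.* A scheduling policy chooses $a_k$ from the actions and transmission outcomes of the slots before $k$. The decision state $s_k=(\tau^0_k,\dots,\tau^{v-1}_k,\phi^0_k,\dots,\phi^{v-1}_k)$ starts at any $s_0$ with $\tau^i\ge1$, $\phi^i\ge2$, $\phi^i\ge\tau^i$ and $\phi^i\ne\tau^i+1$ for all $i$, and evolves by: $\tau^0_{k+1}=1$ if $\delta_k=1$, else $\tau^0_k+1$; $\phi^0_{k+1}=\tau^0_k+1$ if $\gamma_k=1$, else $\phi^0_k+1$; and for $1\le i\le v-1$, $(\tau^i_{k+1},\phi^i_{k+1})=(\tau^{i-1}_k,\phi^{i-1}_k)$ if $\gamma_k=1$, else $(\tau^i_k,\phi^i_k)$. A stationary deterministic policy is a map $\pi$ from decision states to $\{1,2\}$, used as $a_k=\pi(s_k)$. *Cost.* For a positive definite $Q$, the average cost is $J=\lim_{N\to\infty}\frac1N\sum_{k=0}^{N-1}\mathbb E[x_k^\top Qx_k]$. A policy stabilizes the plant if $J<\infty$. A stationary deterministic policy is optimal if, from every initial decision state $s_0$, its limit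 $J$ exists and no scheduling policy has a smaller average cost (with $\limsup$ in place of $\lim$ for competitors whose limit does not exist). **Theorem.** There exists a stationary deterministic optimal scheduling policy that stabilizes the plant (from every initial decision state) if and only if $$\max\{p_s,p_c\}<\frac{1}{\rho^2(A)} .$$ -/

import Mathlib

open MeasureTheory ProbabilityTheory Filter Topology
open scoped ENNReal Matrix

namespace HalfDuplex

/-- The spectral radius of a real square matrix, computed over its complex eigenvalues. -/
noncomputable def specRadius {n : ℕ} (A : Matrix (Fin n) (Fin n) ℝ) : ℝ :=
  (spectralRadius ℂ (A.map (fun r : ℝ => (r : ℂ)))).toReal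

/-- The scheduling decision of a slot: the half-duplex controller either receives the sensor's
packet (`sensor`, written `a = 1` on paper) or sends its own packet (`controller`, `a = 2`). -/
inductive Action where
  | sensor
  | controller

/-- A slot as seen by the scheduler: the decision, and whether the transmission succeeded. -/
abbrev Slot : Type := Action × Bool

/-- `δ = 1`: the sensor was scheduled and its packet was received. -/
def Slot.sensorSuccess : Slot → Bool
  | (Action.sensor, ok) => ok
  | (Action.controller, _) => false

/-- `γ = 1`: the controller was scheduled and its packet was received by the actuator. -/
def Slot.controllerSuccess : Slot → Bool
  | (Action.sensor, _) => false
  | (Action.controller, ok) => ok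

/-! ### The state of the decision process -/

/-- The quality indicators `(τ⁰, …, τ^(v-1), φ⁰, …, φ^(v-1))`. -/
structure Indicators (v : ℕ) where
  τ : Fin v → ℕ
  φ : Fin v → ℕ

/-- Membership in the state space of the decision process. -/
def Indicators.Admissible {v : ℕ} (s : Indicators v) : Prop :=
  ∀ i, 1 ≤ s.τ i ∧ 2 ≤ s.φ i ∧ s.τ i ≤ s.φ i ∧ s.φ i ≠ s.τ i + 1

/-- The update of the indicators at the end of a slot. -/
def Indicators.next {v : ℕ} (s : Indicators v) (e : Slot) : Indicators v where
  τ := fun i =>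
    if i.val = 0 then
      if e.sensorSuccess then 1 else s.τ i + 1
    else
      if e.controllerSuccess then s.τ ⟨i.val - 1, by omega⟩ else s.τ i
  φ := fun i =>
    if i.val = 0 then
      if e.controllerSuccess then s.τ i + 1 else s.φ i + 1
    else
      if e.controllerSuccess then s.φ ⟨i.val - 1, by omega⟩ else s.φ i

/-- A scheduling policy chooses the action of the current slot from the decisions and the
transmission outcomes of all earlier slots (most recent slot first). -/
abbrev Policy : Type := List Slot → Action

/-- The indicators after a given history, started from `s₀`. -/
def indicators {v : ℕ} (s₀ : Indicators v) : List Slot → Indicators v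
  | [] => s₀
  | e :: h => (indicators s₀ h).next e

/-- The stationary deterministic policy `a_k = π (s_k)`, started from the state `s₀`. -/
def stationary {v : ℕ} (π : Indicators v → Action) (s₀ : Indicators v) : Policy :=
  fun h => π (indicators s₀ h)

/-! ### The plant, the estimator, the predictive controller and the actuator -/

/-- System matrix, input matrix and controller gain. -/
structure Plant (n m : ℕ) where
  A : Matrix (Fin n) (Fin n) ℝ
  B : Matrix (Fin n) (Fin m) ℝ
  K : Matrix (Fin m) (Fin n) ℝ

/-- The variables of the control loop at the beginning of a slot: plant state, controller's
estimate of it, and the actuator's command buffer as the previous slot left it. -/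
structure Loop (n m v : ℕ) where
  x : Fin n → ℝ
  est : Fin n → ℝ
  buf : Fin v → Fin m → ℝ

/-- The `v` commands computed from an estimate: `K (A + B K)^i est` for `i < v`. -/
def Plant.commands {n m : ℕ} (P : Plant n m) (v : ℕ) (est : Fin n → ℝ) : Fin v → Fin m → ℝ :=
  fun i => (P.K * (P.A + P.B * P.K) ^ i.val) *ᵥ est

/-- The buffer shifts one step forward and is filled up with a zero command. -/
def shift {m v : ℕ} (b : Fin v → Fin m → ℝ) : Fin v → Fin m → ℝ :=
  fun i => if h : i.val + 1 < v then b ⟨i.val + 1, h⟩ else 0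

/-- The buffer during a slot. -/
def Plant.buffer {n m v : ℕ} (P : Plant n m) (L : Loop n m v) (e : Slot) :
    Fin v → Fin m → ℝ :=
  if e.controllerSuccess then P.commands v L.est else shift L.buf

/-- One slot of the closed loop with disturbance `w`; the applied input is the first command in
the buffer. -/
def Plant.step {n m v : ℕ} [NeZero v] (P : Plant n m) (L : Loop n m v) (e : Slot)
    (w : Fin n → ℝ) : Loop n m v where
  x := P.A *ᵥ L.x + P.B *ᵥ (P.buffer L e 0) + w
  est :=
    if e.sensorSuccess then P.A *ᵥ L.x + P.B *ᵥ (P.buffer L e 0)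
    else P.A *ᵥ L.est + P.B *ᵥ (P.buffer L e 0)
  buf := P.buffer L e

/-! ### Randomness -/

/-- The random inputs of the system on a sample space `Ω`: the initial plant state, the initial
estimate, the disturbances, and for every slot whether an uplink (sensor to controller) or
downlink (controller to actuator) packet would get through in it. -/
structure Inputs (Ω : Type*) (n : ℕ) where
  x₀ : Ω → Fin n → ℝ
  est₀ : Ω → Fin n → ℝ
  w : ℕ → Ω → Fin n → ℝ
  up : ℕ → Ω → Bool
  down : ℕ → Ω → Bool

/-- Labels of the independent sources of randomness. -/
inductive Source where
  | init
  | noise (k : ℕ)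
  | uplink (k : ℕ)
  | downlink (k : ℕ)

/-- The information carried by each source. -/
abbrev Inputs.sigma {Ω : Type*} {n : ℕ} (I : Inputs Ω n) : Source → MeasurableSpace Ω
  | Source.init => MeasurableSpace.comap (fun ω => (I.x₀ ω, I.est₀ ω)) inferInstance
  | Source.noise k => MeasurableSpace.comap (I.w k) inferInstance
  | Source.uplink k => MeasurableSpace.comap (I.up k) inferInstance
  | Source.downlink k => MeasurableSpace.comap (I.down k) inferInstance

/-- The probabilistic model: square-integrable initial data, zero-mean Gaussian white noise with
covariance matrix `R`, static channels with packet-error probabilities `ps` and `pc`, all of them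
mutually independent. -/
structure Inputs.IsModel {Ω : Type*} [MeasurableSpace Ω] {n : ℕ} (I : Inputs Ω n)
    (μ : Measure Ω) (R : Matrix (Fin n) (Fin n) ℝ) (ps pc : ℝ) : Prop where
  measurable_x₀ : Measurable I.x₀
  measurable_est₀ : Measurable I.est₀
  measurable_w : ∀ k, Measurable (I.w k)
  measurable_up : ∀ k, Measurable (I.up k)
  measurable_down : ∀ k, Measurable (I.down k)
  memLp_x₀ : MemLp I.x₀ 2 μ
  memLp_est₀ : MemLp I.est₀ 2 μ
  gaussian : ∀ k, HasGaussianLaw (I.w k) μ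
  mean : ∀ k i, ∫ ω, I.w k ω i ∂μ = 0
  covariance : ∀ k i j, ∫ ω, I.w k ω i * I.w k ω j ∂μ = R i j
  uplink_error : ∀ k, μ {ω | I.up k ω = false} = ENNReal.ofReal ps
  downlink_error : ∀ k, μ {ω | I.down k ω = false} = ENNReal.ofReal pc
  indep : iIndep I.sigma μ

/-- What happens in slot `k` if action `a` is taken. -/
def Inputs.slot {Ω : Type*} {n : ℕ} (I : Inputs Ω n) (k : ℕ) (ω : Ω) : Action → Slot
  | Action.sensor => (Action.sensor, I.up k ω)
  | Action.controller => (Action.controller, I.down k ω)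

/-- The slots before slot `k` under policy `σ`, most recent first. -/
def history {Ω : Type*} {n : ℕ} (I : Inputs Ω n) (σ : Policy) (ω : Ω) : ℕ → List Slot
  | 0 => []
  | k + 1 => I.slot k ω (σ (history I σ ω k)) :: history I σ ω k

/-- The closed loop at the beginning of slot `k` under policy `σ`; the buffer is empty at first. -/
def Plant.loop {Ω : Type*} {n m : ℕ} (P : Plant n m) (v : ℕ) [NeZero v] (I : Inputs Ω n)
    (σ : Policy) (ω : Ω) : ℕ → Loop n m v
  | 0 => { x := I.x₀ ω, est := I.est₀ ω, buf := fun _ => 0 }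
  | k + 1 =>
    P.step (P.loop v I σ ω k) (I.slot k ω (σ (history I σ ω k))) (I.w k ω)

/-! ### Cost and optimality -/

/-- The expected cost `E[x_kᵀ Q x_k]`. -/
noncomputable def Plant.expectedCost {Ω : Type*} [MeasurableSpace Ω] {n m : ℕ} (P : Plant n m)
    (v : ℕ) [NeZero v] (Q : Matrix (Fin n) (Fin n) ℝ) (I : Inputs Ω n) (μ : Measure Ω)
    (σ : Policy) (k : ℕ) : ℝ≥0∞ :=
  ∫⁻ ω, ENNReal.ofReal ((P.loop v I σ ω k).x ⬝ᵥ (Q *ᵥ (P.loop v I σ ω k).x)) ∂μ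

/-- The average cost over the first `N` slots. -/
noncomputable def Plant.averageCost {Ω : Type*} [MeasurableSpace Ω] {n m : ℕ} (P : Plant n m)
    (v : ℕ) [NeZero v] (Q : Matrix (Fin n) (Fin n) ℝ) (I : Inputs Ω n) (μ : Measure Ω)
    (σ : Policy) (N : ℕ) : ℝ≥0∞ :=
  (∑ k ∈ Finset.range N, P.expectedCost v Q I μ σ k) / N

/-- `J` is the long-term average cost of the policy `σ`. -/
def Plant.HasLongTermCost {Ω : Type*} [MeasurableSpace Ω] {n m : ℕ} (P : Plant n m)
    (v : ℕ) [NeZero v] (Q : Matrix (Fin n) (Fin n) ℝ) (I : Inputs Ω n) (μ : Measure Ω)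
    (σ : Policy) (J : ℝ≥0∞) : Prop :=
  Tendsto (P.averageCost v Q I μ σ) atTop (𝓝 J)

/-- The stationary deterministic policy `π` is optimal and stabilizes the plant: from every state
of the decision process its long-term average cost exists and is finite, and no scheduling policy
has a smaller one (the upper limit is taken where the competitor's averages do not converge). -/
def Plant.IsOptimalStabilizing {Ω : Type*} [MeasurableSpace Ω] {n m : ℕ} (P : Plant n m)
    (v : ℕ) [NeZero v] (Q : Matrix (Fin n) (Fin n) ℝ) (I : Inputs Ω n) (μ : Measure Ω)
    (π : Indicators v → Action) : Prop :=
  ∀ s₀ : Indicators v, s₀.Admissible →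
    ∃ J : ℝ≥0∞, P.HasLongTermCost v Q I μ (stationary π s₀) J ∧ J < ∞ ∧
      ∀ σ : Policy, J ≤ limsup (P.averageCost v Q I μ σ) atTop

end HalfDuplex

/-!
The plant state splits as `x = y + d + e`. The part `y` is steered to zero within `v` slots by the
commands already in the buffer, `d` is the rest of the estimate, known to the controller but not
yet to the actuator, and `e` is the estimation error. Every disturbance enters `e`, passes to `d`
when a sensor packet is received and to `y` when a controller packet is received, so each
disturbance sits in exactly one part. Disturbances of different slots are uncorrelated; hence,
apart from the effect of the initial data, the second moments of the parts obey a closed recursion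
`Plant.evolve` on triples of positive semidefinite matrices (`Cov`), driven by the actions and the
transmission outcomes alone (`loopAlong_eq_parts`, `hasCov_state`). Since the channels are
independent of everything else, expected costs are expectations of functions of such triples over a
controlled Markov chain (`lintegral_history`). A possible correlation of the initial estimate with
the initial error is absorbed by two-sided bounds (`exists_expectedCost_bounds`).

*Reliable links.* If `max ps pc * ρ² < 1`, Lyapunov matrices for `√ps • A` and `√pc • A` give a
linear function of the triple that bounds the total undisturbed cost of a policy which sends from
the sensor until it succeeds and then from the controller until it succeeds
(`exists_alternating_potential`). The discounted relative values are therefore bounded by the cost,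
uniformly in the discount factor, and an ultrafilter limit of them solves the average-cost
optimality equation (`exists_average_cost_optimality`, `exists_optimality_equation`). No policy
beats its constant `J`: the relative value would have to grow linearly, and the current cost, which
controls it, would grow as fast (`frequently_le_sum_of_relValue`).
The minimizing action depends on the triple only, and after finitely many slots `Plant.decode` of
the decision state obeys the same recursion as the true triple (`decode_next`). By superposition the
two then differ by undisturbed evolutions of the two values at that time, whose total expected cost
under the policy that minimizes at the decoded triple is finite. So this policy attains `J` from
every initial decision state (`exists_stationary_cost_bounds`).

*Unreliable links.* Under any policy, a disturbance stays outside `y` for `l` slots with probability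
at least `pc ^ l`, and stays in the estimation error with probability at least `ps ^ l`. So the
expected cost in slot `k` is at least `∑ l < k, (max ps pc) ^ l * tr (Q A^l R (A^l)ᵀ)`, whose terms
dominate a multiple of `(max ps pc * ρ²) ^ l`. If `max ps pc * ρ² ≥ 1` it grows at least linearly,
and no average cost is finite (`not_hasLongTermCost_of_one_le`).
-/

namespace HalfDuplex

/-! ### Positive semidefinite matrices and the trace pairing -/

section Matrices

variable {n : ℕ}

lemma posSemidef_conj {Y : Matrix (Fin n) (Fin n) ℝ} (hY : Y.PosSemidef)
    (B : Matrix (Fin n) (Fin n) ℝ) : (B * Y * Bᵀ).PosSemidef := by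
  simpa [Matrix.conjTranspose_eq_transpose_of_trivial] using hY.mul_mul_conjTranspose_same B

lemma posSemidef_conj' {Y : Matrix (Fin n) (Fin n) ℝ} (hY : Y.PosSemidef)
    (B : Matrix (Fin n) (Fin n) ℝ) : (Bᵀ * Y * B).PosSemidef := by
  simpa using posSemidef_conj hY Bᵀ

open scoped MatrixOrder in
lemma trace_mul_nonneg {P Y : Matrix (Fin n) (Fin n) ℝ} (hP : P.PosSemidef)
    (hY : Y.PosSemidef) : 0 ≤ (P * Y).trace := by
  obtain ⟨B, rfl⟩ := CStarAlgebra.nonneg_iff_eq_star_mul_self.mp hP.nonneg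
  have h := (hY.mul_mul_conjTranspose_same B).trace_nonneg
  rw [Matrix.trace_mul_cycle, ← Matrix.star_eq_conjTranspose] at h
  exact h

lemma trace_mul_le_of_sub_left {P P' Y : Matrix (Fin n) (Fin n) ℝ} (h : (P' - P).PosSemidef)
    (hY : Y.PosSemidef) : (P * Y).trace ≤ (P' * Y).trace := by
  have := trace_mul_nonneg h hY
  rw [Matrix.sub_mul, Matrix.trace_sub] at this
  linarith

lemma trace_mul_le_of_sub_right {P Y Y' : Matrix (Fin n) (Fin n) ℝ} (hP : P.PosSemidef)
    (h : (Y' - Y).PosSemidef) : (P * Y).trace ≤ (P * Y').trace := by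
  have := trace_mul_nonneg hP h
  rw [Matrix.mul_sub, Matrix.trace_sub] at this
  linarith

lemma trace_mul_conj (P B Y : Matrix (Fin n) (Fin n) ℝ) :
    (P * (B * Y * Bᵀ)).trace = (Bᵀ * P * B * Y).trace := by
  rw [← Matrix.mul_assoc, Matrix.trace_mul_comm]
  simp only [Matrix.mul_assoc]

/-- A positive definite matrix dominates every symmetric matrix up to a constant, by compactness
of the unit sphere. -/
lemma exists_smul_sub_posSemidef {Q P : Matrix (Fin n) (Fin n) ℝ} (hQ : Q.PosDef)
    (hP : P.IsHermitian) : ∃ C : ℝ, 1 ≤ C ∧ (C • Q - P).PosSemidef := by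
  have hcont : ∀ M : Matrix (Fin n) (Fin n) ℝ, Continuous fun x : Fin n → ℝ => x ⬝ᵥ (M *ᵥ x) :=
    fun M => by fun_prop
  have hpos : ∀ x : Fin n → ℝ, x ≠ 0 → 0 < x ⬝ᵥ (Q *ᵥ x) := fun x hx => by
    simpa using hQ.dotProduct_mulVec_pos hx
  have hne : ∀ x ∈ Metric.sphere (0 : Fin n → ℝ) 1, x ≠ 0 := by
    intro x hx h0
    simp [h0] at hx
  obtain ⟨C, hC⟩ := ((isCompact_sphere (0 : Fin n → ℝ) 1).image_of_continuousOn
    (f := fun x => (x ⬝ᵥ (P *ᵥ x)) / (x ⬝ᵥ (Q *ᵥ x)))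
    ((hcont P).continuousOn.div (hcont Q).continuousOn
      fun x hx => (hpos x (hne x hx)).ne')).bddAbove
  refine ⟨max C 1, le_max_right _ _, ?_⟩
  rw [Matrix.posSemidef_iff_dotProduct_mulVec]
  refine ⟨(hQ.1.smul (by simp [IsSelfAdjoint])).sub hP, fun x => ?_⟩
  simp only [star_trivial, Matrix.sub_mulVec, Matrix.smul_mulVec, dotProduct_sub,
    dotProduct_smul, smul_eq_mul, sub_nonneg]
  by_cases hx : x = 0
  · simp [hx]
  have hnx : 0 < ‖x‖ := norm_pos_iff.mpr hx
  have hmem : ‖x‖⁻¹ • x ∈ Metric.sphere (0 : Fin n → ℝ) 1 := by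
    simp [norm_smul, hnx.ne']
  have h1 := hC (Set.mem_image_of_mem _ hmem)
  simp only [Matrix.mulVec_smul, dotProduct_smul, smul_dotProduct, smul_eq_mul] at h1
  have h2 := hpos x hx
  rw [mul_div_mul_left _ _ (by positivity), mul_div_mul_left _ _ (by positivity),
    div_le_iff₀ h2] at h1
  exact h1.trans (mul_le_mul_of_nonneg_right (le_max_left _ _) h2.le)

/-- The trace pairing with a positive definite matrix controls the pairing with any other
symmetric matrix. -/
lemma exists_trace_mul_le {Q P : Matrix (Fin n) (Fin n) ℝ} (hQ : Q.PosDef)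
    (hP : P.IsHermitian) : ∃ C : ℝ, 1 ≤ C ∧ ∀ Y : Matrix (Fin n) (Fin n) ℝ, Y.PosSemidef →
      (P * Y).trace ≤ C * (Q * Y).trace := by
  obtain ⟨C, hC, h⟩ := exists_smul_sub_posSemidef hQ hP
  refine ⟨C, hC, fun Y hY => ?_⟩
  simpa using trace_mul_le_of_sub_left h hY

end Matrices

/-! ### Powers of a matrix and its spectral radius -/

section SpectralRadius

variable {n : ℕ}

attribute [local instance] Matrix.frobeniusNormedRing Matrix.frobeniusNormedAlgebra

/-- The complexification of a real matrix. -/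
noncomputable abbrev complexify (A : Matrix (Fin n) (Fin n) ℝ) : Matrix (Fin n) (Fin n) ℂ :=
  A.map (fun r : ℝ => (r : ℂ))

lemma complexify_pow (A : Matrix (Fin n) (Fin n) ℝ) (l : ℕ) :
    complexify (A ^ l) = complexify A ^ l :=
  Matrix.map_pow A Complex.ofRealHom l

lemma norm_complexify (A : Matrix (Fin n) (Fin n) ℝ) : ‖complexify A‖ = ‖A‖ :=
  Matrix.frobenius_norm_map_eq A _ fun a => by simp

lemma spectralRadius_complexify_ne_top (A : Matrix (Fin n) (Fin n) ℝ) :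
    spectralRadius ℂ (complexify A) ≠ ∞ := by
  refine ne_top_of_le_ne_top ?_ (spectrum.spectralRadius_le_pow_nnnorm_pow_one_div ℂ _ 0)
  simp [ENNReal.mul_eq_top]

lemma specRadius_nonneg (A : Matrix (Fin n) (Fin n) ℝ) : 0 ≤ specRadius A :=
  ENNReal.toReal_nonneg

/-- Powers grow at least like powers of the spectral radius. -/
lemma specRadius_pow_le [NeZero n] (A : Matrix (Fin n) (Fin n) ℝ) (l : ℕ) :
    specRadius A ^ l ≤ ‖A ^ l‖ * ‖(1 : Matrix (Fin n) (Fin n) ℂ)‖ := by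
  obtain ⟨z, hz, hz'⟩ := spectrum.exists_nnnorm_eq_spectralRadius (complexify A)
  have h1 : specRadius A = ‖z‖ := by
    simp [specRadius, ← hz']
  have h2 : z ^ l ∈ spectrum ℂ (complexify A ^ l) := spectrum.pow_mem_pow _ _ hz
  have h3 := spectrum.norm_le_norm_mul_of_mem h2
  rwa [← complexify_pow, norm_complexify, norm_pow, ← h1] at h3

/-- Gelfand's formula makes the mean-square growth of the open loop summable against a geometric
dropout probability. -/
lemma summable_pow_mul_norm_pow_sq (A : Matrix (Fin n) (Fin n) ℝ) {p : ℝ} (hp : 0 ≤ p)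
    (h : p * specRadius A ^ 2 < 1) : Summable fun l : ℕ => p ^ l * ‖A ^ l‖ ^ 2 := by
  obtain ⟨r, hr, hpr⟩ : ∃ r, specRadius A < r ∧ p * r ^ 2 < 1 := by
    have hc : Tendsto (fun r : ℝ => p * r ^ 2) (𝓝[>] (specRadius A))
        (𝓝 (p * specRadius A ^ 2)) :=
      ((by fun_prop : Continuous fun r : ℝ => p * r ^ 2).tendsto _).mono_left
        nhdsWithin_le_nhds
    exact ((eventually_mem_nhdsWithin).and (hc.eventually_lt_const h)).exists
  have hr0 : 0 < r := (specRadius_nonneg A).trans_lt hr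
  have hlt : spectralRadius ℂ (complexify A) < ENNReal.ofReal r := by
    rwa [ENNReal.lt_ofReal_iff_toReal_lt (spectralRadius_complexify_ne_top A)]
  have hev := (spectrum.pow_nnnorm_pow_one_div_tendsto_nhds_spectralRadius
    (complexify A)).eventually_lt_const hlt
  have hbound : ∀ᶠ l : ℕ in atTop, ‖A ^ l‖ ≤ r ^ l := by
    filter_upwards [hev, eventually_gt_atTop 0] with l hl hl0
    have hl' : (0 : ℝ) < l := by exact_mod_cast hl0
    rw [one_div, ENNReal.rpow_inv_lt_iff hl', ENNReal.rpow_natCast, ← ENNReal.ofReal_pow hr0.le,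
      ← complexify_pow, ← enorm_eq_nnnorm, ← ofReal_norm, norm_complexify] at hl
    exact ((ENNReal.ofReal_lt_ofReal_iff (by positivity)).mp hl).le
  refine Summable.of_norm_bounded_eventually_nat
    (summable_geometric_of_lt_one (by positivity) hpr) ?_
  filter_upwards [hbound] with l hl
  rw [Real.norm_of_nonneg (by positivity), mul_pow, ← pow_mul, mul_comm 2 l, pow_mul]
  gcongr

/-- Solvability of the discrete Lyapunov equation of a loop that is open with probability `p`. -/
lemma exists_lyapunov (A : Matrix (Fin n) (Fin n) ℝ) {p : ℝ} (hp : 0 ≤ p)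
    (h : p * specRadius A ^ 2 < 1) {P : Matrix (Fin n) (Fin n) ℝ} (hP : P.PosSemidef) :
    ∃ P' : Matrix (Fin n) (Fin n) ℝ, P'.PosSemidef ∧ P' = P + p • (Aᵀ * P' * A) := by
  set f : ℕ → Matrix (Fin n) (Fin n) ℝ := fun l => p ^ l • ((A ^ l)ᵀ * P * A ^ l) with hf
  have hsum : Summable f := by
    refine Summable.of_norm_bounded
      ((summable_pow_mul_norm_pow_sq A hp h).mul_right ‖P‖) fun l => ?_
    rw [hf, norm_smul, Real.norm_of_nonneg (by positivity), mul_assoc (p ^ l)]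
    refine mul_le_mul_of_nonneg_left ?_ (pow_nonneg hp l)
    calc ‖(A ^ l)ᵀ * P * A ^ l‖ ≤ ‖(A ^ l)ᵀ‖ * ‖P‖ * ‖A ^ l‖ :=
          (norm_mul_le _ _).trans (by gcongr; exact norm_mul_le _ _)
      _ = ‖A ^ l‖ ^ 2 * ‖P‖ := by rw [Matrix.frobenius_norm_transpose]; ring
  have hfp : ∀ l, (f l).PosSemidef := fun l =>
    (posSemidef_conj' hP (A ^ l)).smul (by positivity)
  refine ⟨∑' l, f l, ?_, ?_⟩
  · rw [Matrix.posSemidef_iff_dotProduct_mulVec]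
    constructor
    · rw [Matrix.IsHermitian, Matrix.conjTranspose_tsum]
      exact tsum_congr fun l => (hfp l).1
    · intro x
      let g : Matrix (Fin n) (Fin n) ℝ →+ ℝ :=
        { toFun := fun M => star x ⬝ᵥ (M *ᵥ x)
          map_zero' := by simp
          map_add' := fun M N => by simp [Matrix.add_mulVec] }
      have hg : Continuous g := by
        change Continuous fun M : Matrix (Fin n) (Fin n) ℝ => star x ⬝ᵥ (M *ᵥ x)
        fun_prop
      have := hsum.hasSum.map g hg
      exact this.nonneg fun l => (hfp l).dotProduct_mulVec_nonneg x
  · have hstep : ∀ l, f (l + 1) = p • (Aᵀ * f l * A) := fun l => by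
      simp only [hf, pow_succ, Matrix.transpose_mul, Matrix.mul_smul, Matrix.smul_mul, smul_smul,
        Matrix.mul_assoc, mul_comm p]
    have hshift : ∑' l, f (l + 1) = p • (Aᵀ * (∑' l, f l) * A) := by
      simp_rw [hstep]
      rw [tsum_const_smul'', (hsum.mul_left Aᵀ).tsum_mul_right A, hsum.tsum_mul_left Aᵀ]
    rw [← hshift, hsum.tsum_eq_zero_add]
    simp [hf]

/-- For positive definite weights the open-loop cost of a disturbance grows at least like the
powers of the squared spectral radius. -/
lemma exists_specRadius_pow_le_trace [NeZero n] (A : Matrix (Fin n) (Fin n) ℝ)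
    {Q R : Matrix (Fin n) (Fin n) ℝ} (hQ : Q.PosDef) (hR : R.PosDef) :
    ∃ c : ℝ, 0 < c ∧ ∀ l : ℕ,
      c * (specRadius A ^ 2) ^ l ≤ (Q * (A ^ l * R * (A ^ l)ᵀ)).trace := by
  obtain ⟨C, hC, hCQ⟩ := exists_trace_mul_le hQ (P := 1) Matrix.isHermitian_one
  obtain ⟨C', hC', hCR⟩ := exists_trace_mul_le hR (P := 1) Matrix.isHermitian_one
  set u := ‖(1 : Matrix (Fin n) (Fin n) ℂ)‖
  have hu : 0 < u := norm_pos_iff.mpr one_ne_zero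
  refine ⟨(u ^ 2 * (C * C'))⁻¹, by positivity, fun l => ?_⟩
  rw [inv_mul_le_iff₀ (by positivity)]
  have h1 := specRadius_pow_le A l
  have h2 : ‖A ^ l‖ ^ 2 = ((A ^ l)ᵀ * A ^ l).trace := by
    rw [Matrix.frobenius_norm_def, ← Real.sqrt_eq_rpow, Real.sq_sqrt (by positivity),
      Finset.sum_comm]
    simp [Matrix.trace, Matrix.mul_apply, sq, -Matrix.transpose_pow]
  have h3 := hCQ _ (posSemidef_conj hR.posSemidef (A ^ l))
  have h4 := hCR _ (posSemidef_conj' Matrix.PosSemidef.one (A ^ l))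
  rw [Matrix.one_mul, Matrix.trace_mul_comm, ← Matrix.mul_assoc] at h3
  rw [Matrix.one_mul, Matrix.mul_one, Matrix.trace_mul_comm R] at h4
  calc (specRadius A ^ 2) ^ l = (specRadius A ^ l) ^ 2 := by rw [← pow_mul, ← pow_mul, mul_comm]
    _ ≤ (‖A ^ l‖ * u) ^ 2 := by
        exact pow_le_pow_left₀ (pow_nonneg (specRadius_nonneg A) l) h1 2
    _ = u ^ 2 * ((A ^ l)ᵀ * A ^ l).trace := by rw [mul_pow, h2]; ring
    _ ≤ u ^ 2 * (C' * (C * (Q * (A ^ l * R * (A ^ l)ᵀ)).trace)) := by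
        gcongr
        refine h4.trans ?_
        gcongr
    _ = _ := by ring

end SpectralRadius

end HalfDuplex

namespace HalfDuplex

/-! ### Average-cost optimality by vanishing discount -/

section Bellman

variable {S : Type*}

/-- Expected value of `f` at the next state when action `a` is taken in state `x`; a transmission
under action `a` fails with probability `err a`. -/
def actionValue (err : Action → ℝ) (next : Slot → S → S) (f : S → ℝ) (x : S) (a : Action) : ℝ :=
  err a * f (next (a, false) x) + (1 - err a) * f (next (a, true) x)

/-- The smaller of the two action values. -/
noncomputable def bestValue (err : Action → ℝ) (next : Slot → S → S) (f : S → ℝ) (x : S) : ℝ :=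
  min (actionValue err next f x Action.sensor) (actionValue err next f x Action.controller)

/-- Value iteration for the `α`-discounted cost. -/
noncomputable def discounted (err : Action → ℝ) (next : Slot → S → S) (c : S → ℝ) (α : ℝ) :
    ℕ → S → ℝ
  | 0, _ => 0
  | k + 1, x => c x + α * bestValue err next (discounted err next c α k) x

variable {err : Action → ℝ} {next : Slot → S → S} {c : S → ℝ}

lemma actionValue_mono (herr : ∀ a, err a ∈ Set.Ioo (0 : ℝ) 1) {f g : S → ℝ} {x y : S}
    {a : Action} (h : ∀ ok, f (next (a, ok) x) ≤ g (next (a, ok) y)) :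
    actionValue err next f x a ≤ actionValue err next g y a :=
  add_le_add (mul_le_mul_of_nonneg_left (h false) (herr a).1.le)
    (mul_le_mul_of_nonneg_left (h true) (sub_nonneg.mpr (herr a).2.le))

lemma bestValue_le (f : S → ℝ) (x : S) (a : Action) :
    bestValue err next f x ≤ actionValue err next f x a := by
  cases a
  · exact min_le_left _ _
  · exact min_le_right _ _

lemma le_bestValue {f : S → ℝ} {x : S} {b : ℝ} (h : ∀ a, b ≤ actionValue err next f x a) :
    b ≤ bestValue err next f x :=
  le_min (h _) (h _)

lemma bestValue_mono (herr : ∀ a, err a ∈ Set.Ioo (0 : ℝ) 1) {f g : S → ℝ} {x y : S}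
    (h : ∀ e, f (next e x) ≤ g (next e y)) :
    bestValue err next f x ≤ bestValue err next g y :=
  min_le_min (actionValue_mono herr fun _ => h _) (actionValue_mono herr fun _ => h _)

lemma actionValue_add_const (f : S → ℝ) (b : ℝ) (x : S) (a : Action) :
    actionValue err next (fun y => f y + b) x a = actionValue err next f x a + b := by
  simp only [actionValue]
  ring

lemma bestValue_add_const (f : S → ℝ) (b : ℝ) (x : S) :
    bestValue err next (fun y => f y + b) x = bestValue err next f x + b := by
  simp only [bestValue, actionValue_add_const, min_add_add_right]

lemma tendsto_bestValue {ι : Type*} {l : Filter ι} {f : ι → S → ℝ} {g : S → ℝ}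
    (h : ∀ x, Tendsto (fun i => f i x) l (𝓝 (g x))) (x : S) :
    Tendsto (fun i => bestValue err next (f i) x) l (𝓝 (bestValue err next g x)) :=
  (((h _).const_mul _).add ((h _).const_mul _)).min (((h _).const_mul _).add ((h _).const_mul _))

lemma discounted_nonneg (herr : ∀ a, err a ∈ Set.Ioo (0 : ℝ) 1) (hc : ∀ x, 0 ≤ c x) {α : ℝ}
    (hα : 0 ≤ α) (k : ℕ) (x : S) : 0 ≤ discounted err next c α k x := by
  induction k generalizing x with
  | zero => exact le_rfl
  | succ k ih =>
    refine add_nonneg (hc x) (mul_nonneg hα (le_bestValue fun a => ?_))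
    exact add_nonneg (mul_nonneg (herr a).1.le (ih _))
      (mul_nonneg (sub_nonneg.mpr (herr a).2.le) (ih _))

lemma monotone_discounted (herr : ∀ a, err a ∈ Set.Ioo (0 : ℝ) 1) (hc : ∀ x, 0 ≤ c x) {α : ℝ}
    (hα : 0 ≤ α) (x : S) : Monotone fun k => discounted err next c α k x := by
  refine monotone_nat_of_le_succ fun k => ?_
  induction k generalizing x with
  | zero => exact discounted_nonneg herr hc hα 1 x
  | succ k ih =>
    exact add_le_add le_rfl (mul_le_mul_of_nonneg_left (bestValue_mono herr fun e => ih _) hα)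

/-- The discounted optimal cost is a fixed point of the Bellman operator, provided that value
iteration is bounded. -/
lemma exists_discounted_fixedPoint (herr : ∀ a, err a ∈ Set.Ioo (0 : ℝ) 1) (hc : ∀ x, 0 ≤ c x)
    {α : ℝ} (hα : 0 ≤ α) {u : S → ℝ} (hu : ∀ k x, discounted err next c α k x ≤ u x) :
    ∃ V : S → ℝ, (∀ k x, discounted err next c α k x ≤ V x) ∧
      (∀ x, Tendsto (fun k => discounted err next c α k x) atTop (𝓝 (V x))) ∧
      ∀ x, V x = c x + α * bestValue err next V x := by
  have hb : ∀ x, BddAbove (Set.range fun k => discounted err next c α k x) := fun x =>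
    ⟨u x, by rintro _ ⟨k, rfl⟩; exact hu k x⟩
  have ht := fun x => tendsto_atTop_ciSup (monotone_discounted (next := next) herr hc hα x) (hb x)
  refine ⟨fun x => ⨆ k, discounted err next c α k x, fun k x => le_ciSup (hb x) k, ht,
    fun x => ?_⟩
  exact tendsto_nhds_unique ((tendsto_add_atTop_iff_nat 1).mpr (ht x))
    (((tendsto_bestValue ht x).const_mul α).const_add (c x))

/-- The vanishing-discount argument. The state `x₀` is the cheapest one, the state `x₁` can be
reached from everywhere at a finite expected cost `W` (`hhit`), and `x₁` is reached from `x₀` by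
failures alone, whatever is scheduled. Then relative discounted values stay bounded, and an
ultrafilter limit of them solves the average-cost optimality equation. -/
theorem exists_average_cost_optimality (herr : ∀ a, err a ∈ Set.Ioo (0 : ℝ) 1)
    (hc : ∀ x, 0 ≤ c x) {x₀ x₁ : S}
    (hmono : ∀ α, 0 ≤ α → ∀ k x, discounted err next c α k x₀ ≤ discounted err next c α k x)
    {U : S → ℝ} {κ : ℝ}
    (hdisc : ∀ α ∈ Set.Ico (0 : ℝ) 1, ∀ k x, discounted err next c α k x ≤ U x + κ / (1 - α))
    {W : S → ℝ}
    (hhit : ∀ α ∈ Set.Ico (0 : ℝ) 1, ∀ B, (∀ k, discounted err next c α k x₁ ≤ B) →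
      ∀ k x, discounted err next c α k x ≤ W x + B)
    {z : ℕ → S} {L : ℕ} (hz₀ : z 0 = x₀) (hz₁ : z L = x₁)
    (hz : ∀ a j, next (a, false) (z j) = z (j + 1)) :
    ∃ (J C : ℝ) (h : S → ℝ), 0 ≤ J ∧
      ∀ x, 0 ≤ h x ∧ h x ≤ W x + C ∧ J + h x = c x + bestValue err next h x := by
  set α : ℕ → ℝ := fun m => 1 - 1 / ((m : ℝ) + 2) with hαdef
  have hα1 : ∀ m, α m < 1 := fun m => by
    have : (0 : ℝ) < 1 / ((m : ℝ) + 2) := by positivity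
    simp only [hαdef]; linarith
  have hα2 : ∀ m, 1 / 2 ≤ α m := fun m => by
    have : 1 / ((m : ℝ) + 2) ≤ 1 / 2 := by gcongr; simp
    simp only [hαdef]; linarith
  have hα0 : ∀ m, 0 ≤ α m := fun m => by linarith [hα2 m]
  have hαlim : Tendsto α atTop (𝓝 1) := by
    have h1 : Tendsto (fun m : ℕ => 1 / ((m : ℝ) + 2)) atTop (𝓝 0) :=
      Tendsto.div_atTop tendsto_const_nhds
        (tendsto_atTop_add_const_right _ _ tendsto_natCast_atTop_atTop)
    simpa [hαdef] using h1.const_sub 1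
  choose V hVle hVlim hVfix using fun m =>
    exists_discounted_fixedPoint herr hc (hα0 m) (hdisc (α m) ⟨hα0 m, hα1 m⟩)
  have hVmono : ∀ m x, V m x₀ ≤ V m x := fun m x =>
    le_of_tendsto_of_tendsto' (hVlim m x₀) (hVlim m x) fun k => hmono _ (hα0 m) k x
  have hVnonneg : ∀ m x, 0 ≤ V m x := fun m x => (hVle m 0 x)
  have hVhit : ∀ m x, V m x ≤ W x + V m x₁ := fun m x =>
    le_of_tendsto' (hVlim m x) fun k => hhit _ ⟨hα0 m, hα1 m⟩ _ (fun k => hVle m k x₁) k x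
  set G := |U x₀| + |κ| with hG
  have hVG : ∀ m, (1 - α m) * V m x₀ ≤ G := fun m => by
    have h1 : 0 < 1 - α m := by linarith [hα1 m]
    have h2 : V m x₀ ≤ U x₀ + κ / (1 - α m) :=
      le_of_tendsto' (hVlim m x₀) fun k => hdisc _ ⟨hα0 m, hα1 m⟩ k x₀
    calc (1 - α m) * V m x₀ ≤ (1 - α m) * (U x₀ + κ / (1 - α m)) := by gcongr
      _ = (1 - α m) * U x₀ + κ := by field_simp
      _ ≤ (1 - α m) * |U x₀| + |κ| :=
          add_le_add (mul_le_mul_of_nonneg_left (le_abs_self _) h1.le) (le_abs_self _)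
      _ ≤ G := add_le_add (mul_le_of_le_one_left (abs_nonneg _) (by linarith [hα0 m])) le_rfl
  -- Along failures the relative value can only grow by a bounded factor.
  have hreach : ∀ j, ∃ D : ℝ, ∀ m, V m (z j) - V m x₀ ≤ D := by
    intro j
    induction j with
    | zero => exact ⟨0, fun m => by simp [hz₀]⟩
    | succ j ih =>
      obtain ⟨D, hD⟩ := ih
      obtain ⟨p, hp, hperr⟩ : ∃ p, 0 < p ∧ ∀ a, p ≤ err a :=
        ⟨min (err Action.sensor) (err Action.controller), lt_min (herr _).1 (herr _).1,
          fun a => by cases a <;> simp⟩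
      refine ⟨(D + G) / (1 / 2 * p), fun m => ?_⟩
      rw [le_div_iff₀ (by positivity)]
      have hδ := hVmono m (z (j + 1))
      have hbest : V m x₀ + p * (V m (z (j + 1)) - V m x₀) ≤ bestValue err next (V m) (z j) := by
        refine le_bestValue fun a => ?_
        have h1 := hVmono m (next (a, true) (z j))
        have h2 := mul_le_mul_of_nonneg_left h1 (sub_nonneg.mpr (herr a).2.le)
        have h3 := mul_le_mul_of_nonneg_right (hperr a) (sub_nonneg.mpr hδ)
        rw [actionValue, hz]
        linarith
      have h1 := mul_le_mul_of_nonneg_left hbest (hα0 m)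
      have h2 := hVfix m (z j)
      have h3 := hc (z j)
      have h4 := hVG m
      have h5 := hD m
      have h6 : 1 / 2 * (p * (V m (z (j + 1)) - V m x₀)) ≤
          α m * (p * (V m (z (j + 1)) - V m x₀)) :=
        mul_le_mul_of_nonneg_right (hα2 m) (mul_nonneg hp.le (sub_nonneg.mpr hδ))
      linarith
  obtain ⟨D, hD⟩ := hreach L
  rw [hz₁] at hD
  have hlim : ∀ f : ℕ → ℝ, (∃ a b, ∀ m, f m ∈ Set.Icc a b) →
      ∃ y, Tendsto f (hyperfilter ℕ) (𝓝 y) := by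
    rintro f ⟨a, b, hf⟩
    obtain ⟨y, -, hy⟩ := isCompact_Icc.ultrafilter_le_nhds ((hyperfilter ℕ).map f)
      (le_principal_iff.mpr (mem_map.mpr (univ_mem' hf)))
    exact ⟨y, hy⟩
  have hrel : ∀ m x, V m x - V m x₀ ∈ Set.Icc 0 (W x + D) := fun m x =>
    ⟨sub_nonneg.mpr (hVmono m x), by linarith [hVhit m x, hD m]⟩
  choose h hh using fun x => hlim (fun m => V m x - V m x₀) ⟨0, W x + D, fun m => hrel m x⟩
  obtain ⟨J, hJ⟩ := hlim (fun m => (1 - α m) * V m x₀)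
    ⟨0, G, fun m => ⟨mul_nonneg (by linarith [hα1 m]) (hVnonneg m x₀), hVG m⟩⟩
  refine ⟨J, D, h, ge_of_tendsto' hJ fun m =>
    mul_nonneg (by linarith [hα1 m]) (hVnonneg m x₀), fun x => ⟨ge_of_tendsto' (hh x) fun m =>
      (hrel m x).1, le_of_tendsto' (hh x) fun m => (hrel m x).2, ?_⟩⟩
  have hα' : Tendsto α (hyperfilter ℕ) (𝓝 1) :=
    hαlim.mono_left ((Nat.cofinite_eq_atTop ▸ hyperfilter_le_cofinite))
  have h1 := ((hα'.mul (tendsto_bestValue (err := err) (next := next) hh x)).const_add (c x))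
  rw [one_mul] at h1
  refine tendsto_nhds_unique (hJ.add (hh x)) (h1.congr fun m => ?_)
  have h2 := bestValue_add_const (err := err) (next := next) (V m) (-V m x₀) x
  simp only [← sub_eq_add_neg] at h2
  rw [h2, mul_sub]
  linarith [hVfix m x]

end Bellman

end HalfDuplex

namespace HalfDuplex

/-! ### Covariance states -/

/-- Covariances of the three uncorrelated parts of the plant state `x = y + d + e`: the part `y`
that the command buffer already steers to zero, the part `d` that the controller knows but the
actuator does not yet, and the estimation error `e`. -/
@[ext]
structure Cov (n : ℕ) where
  Y : Matrix (Fin n) (Fin n) ℝ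
  D : Matrix (Fin n) (Fin n) ℝ
  E : Matrix (Fin n) (Fin n) ℝ

namespace Cov

variable {n : ℕ}

instance : Zero (Cov n) := ⟨⟨0, 0, 0⟩⟩

instance : Add (Cov n) := ⟨fun X X' => ⟨X.Y + X'.Y, X.D + X'.D, X.E + X'.E⟩⟩

@[simp] lemma zero_Y : (0 : Cov n).Y = 0 := rfl
@[simp] lemma zero_D : (0 : Cov n).D = 0 := rfl
@[simp] lemma zero_E : (0 : Cov n).E = 0 := rfl
@[simp] lemma add_Y (X X' : Cov n) : (X + X').Y = X.Y + X'.Y := rfl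
@[simp] lemma add_D (X X' : Cov n) : (X + X').D = X.D + X'.D := rfl
@[simp] lemma add_E (X X' : Cov n) : (X + X').E = X.E + X'.E := rfl

/-- All three matrices are positive semidefinite. -/
structure Nonneg (X : Cov n) : Prop where
  Y : X.Y.PosSemidef
  D : X.D.PosSemidef
  E : X.E.PosSemidef

lemma nonneg_zero : (0 : Cov n).Nonneg :=
  ⟨Matrix.PosSemidef.zero, Matrix.PosSemidef.zero, Matrix.PosSemidef.zero⟩

lemma Nonneg.add {X X' : Cov n} (hX : X.Nonneg) (hX' : X'.Nonneg) : (X + X').Nonneg :=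
  ⟨hX.Y.add hX'.Y, hX.D.add hX'.D, hX.E.add hX'.E⟩

lemma zero_add' (X : Cov n) : 0 + X = X := by
  ext1 <;> simp

/-- The linear functional on covariance states given by three weight matrices. -/
def pair (P₁ P₂ P₃ : Matrix (Fin n) (Fin n) ℝ) (X : Cov n) : ℝ :=
  (P₁ * X.Y).trace + (P₂ * X.D).trace + (P₃ * X.E).trace

lemma pair_add (P₁ P₂ P₃ : Matrix (Fin n) (Fin n) ℝ) (X X' : Cov n) :
    pair P₁ P₂ P₃ (X + X') = pair P₁ P₂ P₃ X + pair P₁ P₂ P₃ X' := by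
  simp only [pair, add_Y, add_D, add_E, Matrix.mul_add, Matrix.trace_add]
  ring

lemma Nonneg.pair_nonneg {X : Cov n} (hX : X.Nonneg) {P₁ P₂ P₃ : Matrix (Fin n) (Fin n) ℝ}
    (h₁ : P₁.PosSemidef) (h₂ : P₂.PosSemidef) (h₃ : P₃.PosSemidef) : 0 ≤ pair P₁ P₂ P₃ X :=
  add_nonneg (add_nonneg (trace_mul_nonneg h₁ hX.Y) (trace_mul_nonneg h₂ hX.D))
    (trace_mul_nonneg h₃ hX.E)

/-- The expected cost `E[xᵀ Q x]` in a covariance state. -/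
def cost (Q : Matrix (Fin n) (Fin n) ℝ) (X : Cov n) : ℝ :=
  pair Q Q Q X

lemma cost_add (Q : Matrix (Fin n) (Fin n) ℝ) (X X' : Cov n) :
    cost Q (X + X') = cost Q X + cost Q X' :=
  pair_add _ _ _ _ _

lemma cost_eq_trace (Q : Matrix (Fin n) (Fin n) ℝ) (X : Cov n) :
    cost Q X = (Q * (X.Y + X.D + X.E)).trace := by
  simp only [cost, pair, Matrix.mul_add, Matrix.trace_add]

lemma Nonneg.cost_nonneg {X : Cov n} (hX : X.Nonneg) {Q : Matrix (Fin n) (Fin n) ℝ}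
    (hQ : Q.PosSemidef) : 0 ≤ cost Q X :=
  hX.pair_nonneg hQ hQ hQ

end Cov

variable {n m : ℕ}

/-- The closed-loop matrix `A + B K`. -/
def Plant.closed (P : Plant n m) : Matrix (Fin n) (Fin n) ℝ :=
  P.A + P.B * P.K

/-- One slot of the covariance recursion with disturbance covariance `R`. Every disturbance sits
in exactly one of the three parts of the state, and a received packet moves it: from the estimation
error to the part known to the controller, and from there to the part steered by the buffer. -/
def Plant.evolve (P : Plant n m) (R : Matrix (Fin n) (Fin n) ℝ) : Slot → Cov n → Cov n
  | (Action.controller, true), X =>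
    ⟨P.closed * (X.Y + X.D) * P.closedᵀ, 0, P.A * X.E * P.Aᵀ + R⟩
  | (Action.sensor, true), X =>
    ⟨P.closed * X.Y * P.closedᵀ, P.A * (X.D + X.E) * P.Aᵀ, R⟩
  | (_, false), X =>
    ⟨P.closed * X.Y * P.closedᵀ, P.A * X.D * P.Aᵀ, P.A * X.E * P.Aᵀ + R⟩

section Evolve

variable (P : Plant n m) {Q R : Matrix (Fin n) (Fin n) ℝ}

lemma evolve_fail (a : Action) (X : Cov n) : P.evolve R (a, false) X =
    ⟨P.closed * X.Y * P.closedᵀ, P.A * X.D * P.Aᵀ, P.A * X.E * P.Aᵀ + R⟩ := by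
  cases a <;> rfl

lemma evolve_add (R' : Matrix (Fin n) (Fin n) ℝ) (e : Slot) (X X' : Cov n) :
    P.evolve (R + R') e (X + X') = P.evolve R e X + P.evolve R' e X' := by
  obtain ⟨a, ok⟩ := e
  cases a <;> cases ok <;> ext1 <;>
    simp only [Plant.evolve, Cov.add_Y, Cov.add_D, Cov.add_E, Matrix.mul_add, Matrix.add_mul,
      add_zero] <;> abel

lemma Cov.Nonneg.evolve {X : Cov n} (hX : X.Nonneg) (hR : R.PosSemidef) (e : Slot) :
    (P.evolve R e X).Nonneg := by
  obtain ⟨a, ok⟩ := e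
  have hE := (posSemidef_conj hX.E P.A).add hR
  cases a <;> cases ok
  · exact ⟨posSemidef_conj hX.Y _, posSemidef_conj hX.D _, hE⟩
  · exact ⟨posSemidef_conj hX.Y _, posSemidef_conj (hX.D.add hX.E) _, hR⟩
  · exact ⟨posSemidef_conj hX.Y _, posSemidef_conj hX.D _, hE⟩
  · exact ⟨posSemidef_conj (hX.Y.add hX.D) _, Matrix.PosSemidef.zero, hE⟩

/-- The covariance `∑_{l<t} A^l R (A^l)ᵀ` accumulated in open loop over `t` slots. -/
def openCov (A R : Matrix (Fin n) (Fin n) ℝ) (t : ℕ) : Matrix (Fin n) (Fin n) ℝ :=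
  ∑ l ∈ Finset.range t, A ^ l * R * (A ^ l)ᵀ

lemma openCov_succ (A R : Matrix (Fin n) (Fin n) ℝ) (t : ℕ) :
    openCov A R (t + 1) = A * openCov A R t * Aᵀ + R := by
  rw [openCov, Finset.sum_range_succ', openCov, Finset.mul_sum, Finset.sum_mul]
  congr 1
  · refine Finset.sum_congr rfl fun l _ => ?_
    simp only [pow_succ', Matrix.transpose_mul, Matrix.mul_assoc]
  · simp

@[simp] lemma openCov_zero (A R : Matrix (Fin n) (Fin n) ℝ) : openCov A R 0 = 0 := by
  simp [openCov]

@[simp] lemma openCov_one (A R : Matrix (Fin n) (Fin n) ℝ) : openCov A R 1 = R := by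
  simp [openCov]

lemma openCov_sub_posSemidef (A : Matrix (Fin n) (Fin n) ℝ) (hR : R.PosSemidef) {t t' : ℕ}
    (h : t ≤ t') : (openCov A R t' - openCov A R t).PosSemidef := by
  rw [openCov, openCov, ← Finset.sum_range_add_sum_Ico _ h, add_sub_cancel_left]
  exact Matrix.posSemidef_sum _ fun l _ => posSemidef_conj hR _

lemma openCov_posSemidef (A : Matrix (Fin n) (Fin n) ℝ) (hR : R.PosSemidef) (t : ℕ) :
    (openCov A R t).PosSemidef := by
  simpa using openCov_sub_posSemidef A hR (Nat.zero_le t)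

/-- The cost of steering to zero with the nilpotent closed loop. -/
def steeringCost (F Q : Matrix (Fin n) (Fin n) ℝ) (v : ℕ) : Matrix (Fin n) (Fin n) ℝ :=
  ∑ j ∈ Finset.range v, (F ^ j)ᵀ * Q * F ^ j

lemma steeringCost_posSemidef (F : Matrix (Fin n) (Fin n) ℝ) (hQ : Q.PosSemidef) (v : ℕ) :
    (steeringCost F Q v).PosSemidef :=
  Matrix.posSemidef_sum _ fun _ _ => posSemidef_conj' hQ _

lemma steeringCost_eq {F : Matrix (Fin n) (Fin n) ℝ} {v : ℕ} (hF : F ^ v = 0) :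
    steeringCost F Q v = Q + Fᵀ * steeringCost F Q v * F := by
  have h : steeringCost F Q (v + 1) = steeringCost F Q v := by
    rw [steeringCost, Finset.sum_range_succ, hF]
    simp [steeringCost]
  conv_lhs => rw [← h, steeringCost, Finset.sum_range_succ']
  rw [steeringCost, Finset.mul_sum, Finset.sum_mul, add_comm]
  congr 1
  · simp
  · refine Finset.sum_congr rfl fun l _ => ?_
    simp only [pow_succ, Matrix.transpose_mul, Matrix.mul_assoc]

end Evolve

/-! ### The optimality equation of the scheduling problem -/

/-- The packet-error probability of the link that an action uses. -/
def dropout (ps pc : ℝ) : Action → ℝ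
  | Action.sensor => ps
  | Action.controller => pc

lemma dropout_mem {ps pc : ℝ} (hps : ps ∈ Set.Ioo (0 : ℝ) 1) (hpc : pc ∈ Set.Ioo (0 : ℝ) 1)
    (a : Action) : dropout ps pc a ∈ Set.Ioo (0 : ℝ) 1 := by
  cases a
  · exact hps
  · exact hpc

/-- Potential functions for alternating between the links: transmit on the sensor link until
success (weights `S` on both `d` and `e`), then on the controller link until success (weights `C`
on `d` and `H` on `e`). Up to the constant `κ` contributed by new disturbances, the expected
potential decreases by the cost of the slot. -/
lemma exists_alternating_potential (P : Plant n m) {v : ℕ} {Q R : Matrix (Fin n) (Fin n) ℝ}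
    (hQ : Q.PosSemidef) (hR : R.PosSemidef) (hF : P.closed ^ v = 0) {ps pc : ℝ}
    (hps : ps ∈ Set.Ioo (0 : ℝ) 1) (hpc : pc ∈ Set.Ioo (0 : ℝ) 1)
    (hs : ps * specRadius P.A ^ 2 < 1) (hc : pc * specRadius P.A ^ 2 < 1) :
    ∃ (S C H : Matrix (Fin n) (Fin n) ℝ) (κ : ℝ),
      S.PosSemidef ∧ C.PosSemidef ∧ H.PosSemidef ∧ 0 ≤ κ ∧ ∀ X : Cov n,
        Cov.cost Q X +
          (ps * Cov.pair (steeringCost P.closed Q v) S S (P.evolve R (Action.sensor, false) X) +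
            (1 - ps) *
              Cov.pair (steeringCost P.closed Q v) C H (P.evolve R (Action.sensor, true) X)) ≤
          Cov.pair (steeringCost P.closed Q v) S S X + κ ∧
        Cov.cost Q X +
          (pc *
              Cov.pair (steeringCost P.closed Q v) C H (P.evolve R (Action.controller, false) X) +
            (1 - pc) *
              Cov.pair (steeringCost P.closed Q v) S S (P.evolve R (Action.controller, true) X)) ≤
          Cov.pair (steeringCost P.closed Q v) C H X + κ := by
  set T := steeringCost P.closed Q v with hT
  have hTp : T.PosSemidef := steeringCost_posSemidef _ hQ _
  have hTeq : T = Q + P.closedᵀ * T * P.closed := steeringCost_eq hF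
  have hps' : 0 ≤ 1 - ps := sub_nonneg.mpr hps.2.le
  have hpc' : 0 ≤ 1 - pc := sub_nonneg.mpr hpc.2.le
  obtain ⟨C, hC, hCeq⟩ := exists_lyapunov P.A hpc.1.le hc
    (hQ.add ((posSemidef_conj' hTp P.closed).smul hpc'))
  obtain ⟨S, hS, hSeq⟩ := exists_lyapunov P.A hps.1.le hs
    (hQ.add ((posSemidef_conj' hC P.A).smul hps'))
  obtain ⟨H, hH, hHeq⟩ := exists_lyapunov P.A hpc.1.le hc
    (hQ.add ((posSemidef_conj' hS P.A).smul hpc'))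
  have hSR := trace_mul_nonneg hS hR
  have hHR := trace_mul_nonneg hH hR
  refine ⟨S, C, H, (S * R).trace + (H * R).trace, hS, hC, hH, add_nonneg hSR hHR, fun X => ?_⟩
  -- Each weight solves its own linear equation; pair the equations with the covariances.
  have pairing : ∀ {M M' : Matrix (Fin n) (Fin n) ℝ}, M = M' → ∀ Z : Matrix (Fin n) (Fin n) ℝ,
      (M * Z).trace = (M' * Z).trace := fun h Z => by rw [h]
  have e1 := pairing hTeq X.Y
  have e2 := pairing hCeq X.D
  have e3 := pairing hSeq X.D
  have e4 := pairing hSeq X.E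
  have e5 := pairing hHeq X.E
  simp only [Matrix.add_mul, Matrix.smul_mul, Matrix.trace_add, Matrix.trace_smul,
    smul_eq_mul] at e1 e2 e3 e4 e5
  have hps1 := mul_le_mul_of_nonneg_right hps.2.le hSR
  have hps2 := mul_nonneg hps.1.le hHR
  have hpc1 := mul_le_mul_of_nonneg_right hpc.2.le hHR
  have hpc2 := mul_nonneg hpc.1.le hSR
  constructor <;>
  · simp only [Cov.cost, Cov.pair, Plant.evolve, Matrix.mul_add, Matrix.add_mul, trace_mul_conj,
      Matrix.trace_add, Matrix.mul_zero, Matrix.trace_zero] at *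
    linarith

end HalfDuplex

namespace HalfDuplex

lemma discounted_succ_le {S : Type*} {err : Action → ℝ} {next : Slot → S → S} {c : S → ℝ}
    (herr : ∀ a, err a ∈ Set.Ioo (0 : ℝ) 1) {α : ℝ}
    (hα : α ∈ Set.Ico (0 : ℝ) 1) {k : ℕ} {x : S} (a : Action) {u w : ℝ}
    (hu : discounted err next c α k (next (a, false) x) ≤ u)
    (hw : discounted err next c α k (next (a, true) x) ≤ w) :
    discounted err next c α (k + 1) x ≤ c x + α * (err a * u + (1 - err a) * w) := by
  have h1 := bestValue_le (err := err) (next := next) (discounted err next c α k) x a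
  have h2 : actionValue err next (discounted err next c α k) x a ≤
      err a * u + (1 - err a) * w :=
    add_le_add (mul_le_mul_of_nonneg_left hu (herr a).1.le)
      (mul_le_mul_of_nonneg_left hw (sub_nonneg.mpr (herr a).2.le))
  exact add_le_add le_rfl (mul_le_mul_of_nonneg_left (h1.trans h2) hα.1)

lemma discounted_succ_le' {S : Type*} {err : Action → ℝ} {next : Slot → S → S} {c : S → ℝ}
    (herr : ∀ a, err a ∈ Set.Ioo (0 : ℝ) 1) (hc : ∀ x, 0 ≤ c x) {α : ℝ}
    (hα : α ∈ Set.Ico (0 : ℝ) 1) {k : ℕ} {x : S} (a : Action) {u w : ℝ}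
    (hu : discounted err next c α k (next (a, false) x) ≤ u)
    (hw : discounted err next c α k (next (a, true) x) ≤ w) :
    discounted err next c α (k + 1) x ≤ c x + (err a * u + (1 - err a) * w) := by
  refine (discounted_succ_le herr hα a hu hw).trans (add_le_add le_rfl ?_)
  exact mul_le_of_le_one_left (add_nonneg
    (mul_nonneg (herr a).1.le ((discounted_nonneg herr hc hα.1 _ _).trans hu))
    (mul_nonneg (sub_nonneg.mpr (herr a).2.le)
      ((discounted_nonneg herr hc hα.1 _ _).trans hw))) hα.2.le

variable {n m : ℕ}

/-- The state space of the scheduling problem. -/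
abbrev CovState (n : ℕ) : Type := {X : Cov n // X.Nonneg}

/-- The covariance recursion on the state space. -/
def Plant.evolveState (P : Plant n m) {R : Matrix (Fin n) (Fin n) ℝ} (hR : R.PosSemidef)
    (e : Slot) (X : CovState n) : CovState n :=
  ⟨P.evolve R e X.1, X.2.evolve P hR e⟩

section Discounted

variable (P : Plant n m) {v : ℕ} {Q R : Matrix (Fin n) (Fin n) ℝ} {err : Action → ℝ} {α : ℝ}

lemma discounted_le_of_add (herr : ∀ a, err a ∈ Set.Ioo (0 : ℝ) 1) (hQ : Q.PosSemidef)
    (hR : R.PosSemidef) (hα : 0 ≤ α) (k : ℕ) {X X' : CovState n} {Z : Cov n} (hZ : Z.Nonneg)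
    (h : X'.1 = X.1 + Z) :
    discounted err (P.evolveState hR) (fun X => Cov.cost Q X.1) α k X ≤
      discounted err (P.evolveState hR) (fun X => Cov.cost Q X.1) α k X' := by
  induction k generalizing X X' Z with
  | zero => exact le_rfl
  | succ k ih =>
    refine add_le_add ?_ (mul_le_mul_of_nonneg_left (bestValue_mono herr fun e => ?_) hα)
    · change Cov.cost Q X.1 ≤ Cov.cost Q X'.1
      rw [h, Cov.cost_add]
      linarith [hZ.cost_nonneg hQ]
    · refine ih (hZ.evolve P Matrix.PosSemidef.zero e) ?_
      have := evolve_add P (R := R) 0 e X.1 Z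
      rwa [add_zero, ← h] at this

/-- After fresh packets have passed both links in a row, `v` slots on the controller link lead to
a fixed state, whatever the outcomes. -/
lemma discounted_le_of_flushing (herr : ∀ a, err a ∈ Set.Ioo (0 : ℝ) 1) (hQ : Q.PosSemidef)
    (hR : R.PosSemidef) (hF : P.closed ^ v = 0) (hα : α ∈ Set.Ico (0 : ℝ) 1) {N : ℕ} {B : ℝ}
    {X₁ : CovState n} (hX₁ : X₁.1 = ⟨0, 0, openCov P.A R N⟩)
    (hB : ∀ k, discounted err (P.evolveState hR) (fun X => Cov.cost Q X.1) α k X₁ ≤ B)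
    (r k : ℕ) {X : CovState n} (hD : X.1.D = 0) {t : ℕ} (ht : t + r = N)
    (hE : X.1.E = openCov P.A R t) (hY : P.closed ^ r * X.1.Y = 0) :
    discounted err (P.evolveState hR) (fun X => Cov.cost Q X.1) α k X ≤
      (steeringCost P.closed Q v * X.1.Y).trace + r * (Q * openCov P.A R N).trace + B := by
  induction r generalizing k X t with
  | zero =>
    have : X = X₁ := by
      apply Subtype.ext
      rw [hX₁]
      ext1
      · simpa using hY
      · exact hD
      · rw [hE, ← ht, add_zero]
    rw [pow_zero, Matrix.one_mul] at hY
    simpa [this, hX₁] using hB k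
  | succ r ih =>
    have hτ := trace_mul_nonneg hQ (openCov_posSemidef P.A hR N)
    have hTY := trace_mul_nonneg (steeringCost_posSemidef P.closed hQ v) X.2.Y
    cases k with
    | zero =>
      have hB0 : 0 ≤ B := hB 0
      exact add_nonneg (add_nonneg hTY (mul_nonneg (Nat.cast_nonneg _) hτ)) hB0
    | succ k =>
      have hnext : ∀ ok, discounted err (P.evolveState hR) (fun X => Cov.cost Q X.1) α k
          (P.evolveState hR (Action.controller, ok) X) ≤
          (steeringCost P.closed Q v * (P.closed * X.1.Y * P.closedᵀ)).trace +
            r * (Q * openCov P.A R N).trace + B := by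
        intro ok
        have hYok : (P.evolveState hR (Action.controller, ok) X).1.Y =
            P.closed * X.1.Y * P.closedᵀ := by
          cases ok <;> simp [Plant.evolveState, Plant.evolve, hD]
        rw [← hYok]
        refine ih k ?_ (t := t + 1) (by omega) ?_ ?_
        · cases ok <;> simp [Plant.evolveState, Plant.evolve, hD]
        · cases ok <;> simp [Plant.evolveState, Plant.evolve, hE, openCov_succ]
        · rw [hYok, Matrix.mul_assoc, ← Matrix.mul_assoc, ← pow_succ, ← Matrix.mul_assoc, hY,
            Matrix.zero_mul]
      refine (discounted_succ_le' herr (fun X => X.2.cost_nonneg hQ) hα Action.controller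
        (hnext false) (hnext true)).trans ?_
      have h1 : (Q * openCov P.A R t).trace ≤ (Q * openCov P.A R N).trace :=
        trace_mul_le_of_sub_right hQ (openCov_sub_posSemidef P.A hR (by omega))
      have h2 := congrArg (fun M => (M * X.1.Y).trace) (steeringCost_eq (Q := Q) hF)
      simp only [Matrix.add_mul, Matrix.trace_add] at h2
      simp only [Cov.cost, Cov.pair, hD, hE, Matrix.mul_zero, Matrix.trace_zero, add_zero,
        trace_mul_conj, Nat.cast_succ]
      linarith

/-- The average-cost optimality equation of the scheduling problem, with a relative value function
that is nonnegative and dominated by the cost of the current slot. -/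
theorem exists_optimality_equation (hQ : Q.PosDef) (hR : R.PosSemidef)
    (hF : P.closed ^ v = 0) {ps pc : ℝ} (hps : ps ∈ Set.Ioo (0 : ℝ) 1)
    (hpc : pc ∈ Set.Ioo (0 : ℝ) 1) (hs : ps * specRadius P.A ^ 2 < 1)
    (hc : pc * specRadius P.A ^ 2 < 1) :
    ∃ (J C : ℝ) (h : Cov n → ℝ), 0 ≤ J ∧ 1 ≤ C ∧ ∀ X : Cov n, X.Nonneg →
      0 ≤ h X ∧ h X ≤ C * (1 + Cov.cost Q X) ∧
        J + h X = Cov.cost Q X + bestValue (dropout ps pc) (P.evolve R) h X := by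
  have hQs := hQ.posSemidef
  have herr := dropout_mem hps hpc
  obtain ⟨S, Cm, H, κ, hS, hCm, hH, hκ, hdrift⟩ :=
    exists_alternating_potential P hQs hR hF hps hpc hs hc
  set T := steeringCost P.closed Q v with hTdef
  have hT : T.PosSemidef := steeringCost_posSemidef _ hQs _
  have hcost : ∀ X : CovState n, 0 ≤ Cov.cost Q X.1 := fun X => X.2.cost_nonneg hQs
  set N := v + 2 with hN
  set X₁ : CovState n := ⟨⟨0, 0, openCov P.A R N⟩,
    ⟨Matrix.PosSemidef.zero, Matrix.PosSemidef.zero, openCov_posSemidef P.A hR N⟩⟩ with hX₁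
  set X₀ : CovState n := ⟨0, Cov.nonneg_zero⟩ with hX₀
  set τ := (Q * openCov P.A R N).trace with hτdef
  have hτ : 0 ≤ τ := trace_mul_nonneg hQs (openCov_posSemidef P.A hR N)
  have hps1 : 0 < 1 - ps := sub_pos.mpr hps.2
  have hpc1 : 0 < 1 - pc := sub_pos.mpr hpc.2
  set g₀ := (κ + pc * (κ / (1 - pc)) + (1 - pc) * (v * τ) + κ / (1 - ps)) / (1 - pc) with hg₀
  have hg₀' : (1 - pc) * g₀ = κ + pc * (κ / (1 - pc)) + (1 - pc) * (v * τ) + κ / (1 - ps) := by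
    rw [hg₀]; field_simp
  have hg₁' : (1 - ps) * (κ / (1 - ps)) = κ := by field_simp
  have hg₂' : (1 - pc) * (κ / (1 - pc)) = κ := by field_simp
  have hpSnn : ∀ X : CovState n, 0 ≤ Cov.pair T S S X.1 := fun X => X.2.pair_nonneg hT hS hS
  have hpCnn : ∀ X : CovState n, 0 ≤ Cov.pair T Cm H X.1 := fun X => X.2.pair_nonneg hT hCm hH
  have hκ1 : 0 ≤ κ / (1 - ps) := by positivity
  have hκ2 : 0 ≤ κ / (1 - pc) := by positivity
  have hpcκ : 0 ≤ pc * (κ / (1 - pc)) := mul_nonneg hpc.1.le hκ2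
  have hvτ : 0 ≤ (1 - pc) * (v * τ) := by positivity
  have hge : κ / (1 - ps) ≤ g₀ := by
    rw [hg₀, le_div_iff₀ hpc1]
    have : κ / (1 - ps) * (1 - pc) ≤ κ / (1 - ps) :=
      mul_le_of_le_one_right hκ1 (by linarith [hpc.1])
    linarith
  obtain ⟨J, C, h, hJ, hh⟩ := exists_average_cost_optimality (err := dropout ps pc)
    (next := P.evolveState hR) (c := fun X => Cov.cost Q X.1) herr hcost (x₀ := X₀) (x₁ := X₁)
    (fun α hα k X => discounted_le_of_add P herr hQs hR hα k X.2 (Cov.zero_add' X.1).symm)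
    (U := fun X => Cov.pair T S S X.1) (κ := κ)
    (by
      intro α hα k
      have h1 : 0 < 1 - α := sub_pos.mpr hα.2
      have hfix : κ + α * (κ / (1 - α)) = κ / (1 - α) := by field_simp; ring
      have hnn : 0 ≤ κ / (1 - α) := by positivity
      suffices h : ∀ X : CovState n,
          discounted (dropout ps pc) (P.evolveState hR) (fun X => Cov.cost Q X.1) α k X ≤
            Cov.pair T S S X.1 + κ / (1 - α) ∧
          discounted (dropout ps pc) (P.evolveState hR) (fun X => Cov.cost Q X.1) α k X ≤
            Cov.pair T Cm H X.1 + κ / (1 - α) from fun X => (h X).1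
      induction k with
      | zero => exact fun X => ⟨add_nonneg (hpSnn X) hnn, add_nonneg (hpCnn X) hnn⟩
      | succ k ih =>
        intro X
        obtain ⟨d1, d2⟩ := hdrift X.1
        constructor
        · have h2 := discounted_succ_le herr hα Action.sensor
            (ih (P.evolveState hR (Action.sensor, false) X)).1
            (ih (P.evolveState hR (Action.sensor, true) X)).2
          have h3 := hpSnn (P.evolveState hR (Action.sensor, false) X)
          have h4 := hpCnn (P.evolveState hR (Action.sensor, true) X)
          simp only [dropout, Plant.evolveState] at h2 h3 h4
          have h5 := mul_le_of_le_one_left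
            (add_nonneg (mul_nonneg hps.1.le h3) (mul_nonneg hps1.le h4)) hα.2.le
          linarith
        · have h2 := discounted_succ_le herr hα Action.controller
            (ih (P.evolveState hR (Action.controller, false) X)).2
            (ih (P.evolveState hR (Action.controller, true) X)).1
          have h3 := hpCnn (P.evolveState hR (Action.controller, false) X)
          have h4 := hpSnn (P.evolveState hR (Action.controller, true) X)
          simp only [dropout, Plant.evolveState] at h2 h3 h4
          have h5 := mul_le_of_le_one_left
            (add_nonneg (mul_nonneg hpc.1.le h3) (mul_nonneg hpc1.le h4)) hα.2.le
          linarith)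
    (W := fun X => Cov.pair T S S X.1 + g₀)
    (by
      intro α hα B hB k
      have hB0 : 0 ≤ B := hB 0
      -- that has failed, empty the controller link before starting over.
      suffices h : ∀ X : CovState n,
          discounted (dropout ps pc) (P.evolveState hR) (fun X => Cov.cost Q X.1) α k X ≤
            Cov.pair T S S X.1 + g₀ + B ∧
          (X.1.E = R →
            discounted (dropout ps pc) (P.evolveState hR) (fun X => Cov.cost Q X.1) α k X ≤
            Cov.pair T Cm H X.1 + (g₀ - κ / (1 - ps)) + B) ∧
          discounted (dropout ps pc) (P.evolveState hR) (fun X => Cov.cost Q X.1) α k X ≤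
            Cov.pair T Cm H X.1 + (g₀ + κ / (1 - pc)) + B from fun X => (h X).1
      induction k with
      | zero =>
        refine fun X => ⟨?_, fun _ => ?_, ?_⟩ <;> simp only [discounted] <;>
          linarith [hpSnn X, hpCnn X]
      | succ k ih =>
        intro X
        obtain ⟨d1, d2⟩ := hdrift X.1
        refine ⟨?_, fun hE => ?_, ?_⟩
        · have h2 := discounted_succ_le' herr hcost hα Action.sensor
            (ih (P.evolveState hR (Action.sensor, false) X)).1
            ((ih (P.evolveState hR (Action.sensor, true) X)).2.1 rfl)
          simp only [dropout, Plant.evolveState] at h2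
          linarith
        · have hfl := discounted_le_of_flushing P herr hQs hR hF hα (X₁ := X₁) rfl hB v k
            (X := P.evolveState hR (Action.controller, true) X) rfl (t := 2)
            (by omega) (by simp [Plant.evolveState, Plant.evolve, hE, openCov_succ])
            (by rw [hF, Matrix.zero_mul])
          have hfl' : (T * (P.evolveState hR (Action.controller, true) X).1.Y).trace ≤
              Cov.pair T S S (P.evolveState hR (Action.controller, true) X).1 := by
            have h3 := trace_mul_nonneg hS (P.evolveState hR (Action.controller, true) X).2.D
            have h4 := trace_mul_nonneg hS (P.evolveState hR (Action.controller, true) X).2.E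
            rw [Cov.pair]
            linarith
          have h2 := discounted_succ_le' herr hcost hα Action.controller
            (ih (P.evolveState hR (Action.controller, false) X)).2.2
            (hfl.trans (add_le_add (add_le_add hfl' le_rfl) le_rfl))
          simp only [dropout, Plant.evolveState] at h2
          linarith
        · have h2 := discounted_succ_le' herr hcost hα Action.controller
            (ih (P.evolveState hR (Action.controller, false) X)).2.2
            (ih (P.evolveState hR (Action.controller, true) X)).1
          simp only [dropout, Plant.evolveState] at h2
          linarith)
    (z := fun j => ⟨⟨0, 0, openCov P.A R j⟩,
      ⟨Matrix.PosSemidef.zero, Matrix.PosSemidef.zero, openCov_posSemidef P.A hR j⟩⟩) (L := N)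
    (by simp [hX₀]; rfl) rfl
    (by
      intro a j
      apply Subtype.ext
      simp [Plant.evolveState, evolve_fail, openCov_succ])
  -- The potential is linear in the state, hence dominated by the positive definite cost.
  obtain ⟨C₁, hC₁, hC₁T⟩ := exists_trace_mul_le hQ hT.1
  obtain ⟨C₂, hC₂, hC₂S⟩ := exists_trace_mul_le hQ hS.1
  refine ⟨J, C₁ + C₂ + |g₀ + C|, fun X => open Classical in
    if hX : X.Nonneg then h ⟨X, hX⟩ else 0, hJ, ?_, ?_⟩
  · linarith [abs_nonneg (g₀ + C)]
  · intro X hX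
    obtain ⟨hh1, hh2, hh3⟩ := hh ⟨X, hX⟩
    refine ⟨by simpa [hX] using hh1, ?_, ?_⟩
    · simp only [hX, dite_true]
      refine hh2.trans ?_
      have h1 := hC₁T _ hX.Y
      have h2 := hC₂S _ hX.D
      have h3 := hC₂S _ hX.E
      have h4 := trace_mul_nonneg hQs hX.Y
      have h5 := trace_mul_nonneg hQs hX.D
      have h6 := trace_mul_nonneg hQs hX.E
      simp only [Cov.cost, Cov.pair]
      have h7 := le_abs_self (g₀ + C)
      nlinarith [abs_nonneg (g₀ + C), mul_nonneg (abs_nonneg (g₀ + C)) h4,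
        mul_nonneg (abs_nonneg (g₀ + C)) h5, mul_nonneg (abs_nonneg (g₀ + C)) h6]
    · simpa [bestValue, actionValue, hX, hX.evolve P hR, Plant.evolveState] using hh3

end Discounted

end HalfDuplex

namespace HalfDuplex

/-! ### Expectations over transmission outcomes -/

/-- The expectation of a function of the history of the first `k` slots under the policy `σ`. -/
def expect (err : Action → ℝ) (σ : Policy) : ℕ → (List Slot → ℝ) → ℝ
  | 0, f => f []
  | k + 1, f => expect err σ k fun h =>
      err (σ h) * f ((σ h, false) :: h) + (1 - err (σ h)) * f ((σ h, true) :: h)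

section Expect

variable {err : Action → ℝ} {σ : Policy}

lemma expect_mono (herr : ∀ a, err a ∈ Set.Ioo (0 : ℝ) 1) {k : ℕ} {f g : List Slot → ℝ}
    (h : ∀ l, l.length = k → f l ≤ g l) : expect err σ k f ≤ expect err σ k g := by
  induction k generalizing f g with
  | zero => exact h [] rfl
  | succ k ih =>
    refine ih fun l hl => add_le_add ?_ ?_
    · exact mul_le_mul_of_nonneg_left (h _ (by simp [hl])) (herr _).1.le
    · exact mul_le_mul_of_nonneg_left (h _ (by simp [hl])) (sub_nonneg.mpr (herr _).2.le)

lemma expect_congr {k : ℕ} {f g : List Slot → ℝ}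
    (h : ∀ l, l.length = k → f l = g l) : expect err σ k f = expect err σ k g := by
  induction k generalizing f g with
  | zero => exact h [] rfl
  | succ k ih => exact ih fun l hl => by rw [h _ (by simp [hl]), h _ (by simp [hl])]

lemma expect_add (k : ℕ) (f g : List Slot → ℝ) :
    expect err σ k (fun l => f l + g l) = expect err σ k f + expect err σ k g := by
  induction k generalizing f g with
  | zero => rfl
  | succ k ih =>
    simp only [expect]
    rw [← ih]
    exact expect_congr fun l _ => by ring

lemma expect_const_mul (k : ℕ) (b : ℝ) (f : List Slot → ℝ) :
    expect err σ k (fun l => b * f l) = b * expect err σ k f := by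
  induction k generalizing f with
  | zero => rfl
  | succ k ih =>
    simp only [expect]
    rw [← ih]
    exact expect_congr fun l _ => by ring

lemma expect_const (k : ℕ) (b : ℝ) : expect err σ k (fun _ => b) = b := by
  induction k with
  | zero => rfl
  | succ k ih =>
    simp only [expect]
    rw [← ih]
    exact expect_congr fun l _ => by rw [ih]; ring

lemma expect_nonneg (herr : ∀ a, err a ∈ Set.Ioo (0 : ℝ) 1) {k : ℕ} {f : List Slot → ℝ}
    (h : ∀ l, l.length = k → 0 ≤ f l) : 0 ≤ expect err σ k f := by
  have := expect_mono (σ := σ) herr (f := fun _ => 0) h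
  rwa [expect_const] at this

/-- The tower property for a process driven by the slots. -/
lemma expect_succ_comp {S : Type*} {next : Slot → S → S} {Z : List Slot → S} {k : ℕ}
    (hZ : ∀ e h, h.length = k → Z (e :: h) = next e (Z h)) (f : S → ℝ) :
    expect err σ (k + 1) (fun h => f (Z h)) =
      expect err σ k fun h => actionValue err next f (Z h) (σ h) := by
  rw [expect]
  exact expect_congr fun h hh => by rw [hZ _ _ hh, hZ _ _ hh, actionValue]

end Expect

/-! ### Covariance processes -/

variable {n m : ℕ}

/-- The covariance recursion along a history, restarted from the values `Z` at time `T`. -/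
def Plant.runFrom (P : Plant n m) (R : Matrix (Fin n) (Fin n) ℝ) (T : ℕ)
    (Z : List Slot → Cov n) : List Slot → Cov n
  | [] => Z []
  | e :: h => if h.length < T then Z (e :: h) else P.evolve R e (P.runFrom R T Z h)

/-- `Z` follows the covariance recursion from time `T` on. -/
def Plant.Follows (P : Plant n m) (R : Matrix (Fin n) (Fin n) ℝ) (T : ℕ)
    (Z : List Slot → Cov n) : Prop :=
  ∀ e h, T ≤ h.length → Z (e :: h) = P.evolve R e (Z h)

section Run

variable (P : Plant n m) {Q R : Matrix (Fin n) (Fin n) ℝ} {T : ℕ}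

lemma runFrom_follows (Z : List Slot → Cov n) : P.Follows R T (P.runFrom R T Z) :=
  fun e h hT => by simp [Plant.runFrom, not_lt.mpr hT]

lemma Plant.Follows.of_le {P : Plant n m} {T' : ℕ} {Z : List Slot → Cov n}
    (h : P.Follows R T Z) (hT : T ≤ T') : P.Follows R T' Z :=
  fun e l hl => h e l (hT.trans hl)

lemma runFrom_of_length_eq (Z : List Slot → Cov n) {h : List Slot} (hh : h.length = T) :
    P.runFrom R T Z h = Z h := by
  cases h with
  | nil => rfl
  | cons e h =>
    have : h.length < T := by simp at hh; omega
    simp [Plant.runFrom, this]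

lemma runFrom_nonneg (hR : R.PosSemidef) {Z : List Slot → Cov n} (hZ : ∀ h, (Z h).Nonneg)
    (h : List Slot) : (P.runFrom R T Z h).Nonneg := by
  induction h with
  | nil => exact hZ []
  | cons e h ih =>
    rw [Plant.runFrom]
    split_ifs
    · exact hZ _
    · exact ih.evolve P hR e

lemma Plant.Follows.runFrom_eq {P : Plant n m} {Z : List Slot → Cov n} (hZ : P.Follows R T Z)
    (h : List Slot) : P.runFrom R T Z h = Z h := by
  induction h with
  | nil => rfl
  | cons e h ih =>
    rw [Plant.runFrom]
    split_ifs with hT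
    · rfl
    · rw [ih, hZ e h (not_lt.mp hT)]

lemma runFrom_add (R' : Matrix (Fin n) (Fin n) ℝ) (Z Z' : List Slot → Cov n) (h : List Slot) :
    P.runFrom (R + R') T (fun l => Z l + Z' l) h =
      P.runFrom R T Z h + P.runFrom R' T Z' h := by
  induction h with
  | nil => rfl
  | cons e h ih =>
    simp only [Plant.runFrom]
    split_ifs
    · rfl
    · rw [ih, evolve_add]

/-- Superposition: a covariance process is the sum of the effect of the disturbances since time `T`
and of the undisturbed evolution of its value at time `T`. -/
lemma Plant.Follows.eq_add {P : Plant n m} {Z : List Slot → Cov n} (hZ : P.Follows R T Z)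
    (h : List Slot) :
    Z h = P.runFrom R T (fun _ => 0) h + P.runFrom 0 T Z h := by
  have := runFrom_add P (R := R) (T := T) 0 (fun _ => 0) Z h
  simp only [Cov.zero_add', add_zero] at this
  rw [← this, hZ.runFrom_eq]

end Run

/-! ### Consequences of the optimality equation -/

/-- A solution `(J, h)` of the optimality equation with `0 ≤ h ≤ C (1 + cost)`. -/
def Plant.OptimalityEquation (P : Plant n m) (Q R : Matrix (Fin n) (Fin n) ℝ)
    (err : Action → ℝ) (J C : ℝ) (h : Cov n → ℝ) : Prop :=
  ∀ X : Cov n, X.Nonneg → 0 ≤ h X ∧ h X ≤ C * (1 + Cov.cost Q X) ∧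
    J + h X = Cov.cost Q X + bestValue err (P.evolve R) h X

section Optimality

variable {P : Plant n m} {Q R : Matrix (Fin n) (Fin n) ℝ} {err : Action → ℝ} {J C : ℝ}
  {h : Cov n → ℝ} {T : ℕ} {Z : List Slot → Cov n} {σ : Policy}

lemma expect_relValue_nonneg (herr : ∀ a, err a ∈ Set.Ioo (0 : ℝ) 1)
    (hopt : P.OptimalityEquation Q R err J C h) (hZ0 : ∀ l, (Z l).Nonneg) (k : ℕ) :
    0 ≤ expect err σ k (fun l => h (Z l)) :=
  expect_nonneg herr fun l _ => (hopt _ (hZ0 l)).1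

lemma expect_relValue_le (herr : ∀ a, err a ∈ Set.Ioo (0 : ℝ) 1)
    (hopt : P.OptimalityEquation Q R err J C h) (hZ0 : ∀ l, (Z l).Nonneg) (k : ℕ) :
    expect err σ k (fun l => h (Z l)) ≤
      C * (1 + expect err σ k fun l => Cov.cost Q (Z l)) := by
  refine (expect_mono herr fun l _ => (hopt _ (hZ0 l)).2.1).trans_eq ?_
  rw [expect_const_mul, expect_add, expect_const]

/-- No policy beats the optimality equation in a single slot. -/
lemma le_expect_cost_add (herr : ∀ a, err a ∈ Set.Ioo (0 : ℝ) 1)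
    (hopt : P.OptimalityEquation Q R err J C h) (hZ0 : ∀ l, (Z l).Nonneg)
    (hZ : P.Follows R T Z) {k : ℕ} (hk : T ≤ k) :
    J + expect err σ k (fun l => h (Z l)) ≤
      expect err σ k (fun l => Cov.cost Q (Z l)) + expect err σ (k + 1) fun l => h (Z l) := by
  rw [expect_succ_comp fun e l hl => hZ e l (hk.trans_eq hl.symm), ← expect_add,
    ← expect_const (err := err) (σ := σ) k J, ← expect_add]
  refine expect_mono herr fun l _ => ?_
  have h1 := (hopt _ (hZ0 l)).2.2
  have h2 := bestValue_le (err := err) (next := P.evolve R) h (Z l) (σ l)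
  linarith

/-- Minimizing actions turn the optimality equation into an identity. -/
lemma expect_cost_add_eq
    (hopt : P.OptimalityEquation Q R err J C h) (hZ0 : ∀ l, (Z l).Nonneg)
    (hZ : P.Follows R T Z)
    (hσ : ∀ l, actionValue err (P.evolve R) h (Z l) (σ l) = bestValue err (P.evolve R) h (Z l))
    {k : ℕ} (hk : T ≤ k) :
    expect err σ k (fun l => Cov.cost Q (Z l)) + expect err σ (k + 1) (fun l => h (Z l)) =
      J + expect err σ k fun l => h (Z l) := by
  rw [expect_succ_comp fun e l hl => hZ e l (hk.trans_eq hl.symm), ← expect_add,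
    ← expect_const (err := err) (σ := σ) k J, ← expect_add]
  exact expect_congr fun l _ => by rw [hσ l, (hopt _ (hZ0 l)).2.2]

end Optimality

/-- Accumulated costs whose relative values are controlled by the current cost cannot stay below
the optimal average forever: the relative value would grow linearly, hence the accumulated cost
quadratically. -/
lemma frequently_le_sum_of_relValue {a b : ℕ → ℝ} {J C : ℝ} (hC : 0 < C)
    (ha : ∀ k, 0 ≤ a k) (hb : ∀ k, 0 ≤ b k) (hba : ∀ k, b k ≤ C * (1 + a k))
    (hstep : ∀ k, J + b k ≤ a k + b (k + 1)) {ε : ℝ} (hε : 0 < ε) :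
    ∃ᶠ N : ℕ in atTop, (J - ε) * N ≤ ∑ k ∈ Finset.range N, a k := by
  intro hcon
  simp only [not_le] at hcon
  have htel : ∀ N : ℕ, N * J ≤ ∑ k ∈ Finset.range N, a k + b N := by
    intro N
    induction N with
    | zero => simpa using hb 0
    | succ N ih =>
      rw [Finset.sum_range_succ]
      push_cast
      linarith [hstep N]
  obtain ⟨N₀, hN₀⟩ := eventually_atTop.mp hcon
  have hlin : ∀ N ≥ N₀, ε * N ≤ C * (1 + a N) := fun N hN => by
    linarith [hN₀ N hN, htel N, hba N]
  obtain ⟨N₁, hN₁⟩ := exists_nat_ge (C * (2 + |J|) / ε)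
  set N₂ := max N₀ N₁ with hN₂
  have hbig : ∀ N ≥ N₂, J + 1 ≤ a N := fun N hN => by
    have h1 := hlin N ((le_max_left _ _).trans hN)
    have h2 : (N₁ : ℝ) ≤ N := by exact_mod_cast (le_max_right _ _).trans hN
    have h3 : C * (2 + |J|) ≤ ε * N := by
      rw [div_le_iff₀ hε] at hN₁
      nlinarith
    have h4 : 2 + |J| ≤ 1 + a N := le_of_mul_le_mul_left (h3.trans h1) hC
    linarith [le_abs_self J]
  have hsum : ∀ j : ℕ, (J + 1) * j ≤ ∑ k ∈ Finset.range (N₂ + j), a k := by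
    intro j
    induction j with
    | zero => simpa using Finset.sum_nonneg fun k _ => ha k
    | succ j ih =>
      rw [← add_assoc, Finset.sum_range_succ]
      push_cast
      linarith [hbig (N₂ + j) (by omega)]
  obtain ⟨j, hj⟩ := exists_nat_ge ((J - ε) * N₂)
  have h1 := hN₀ (N₂ + j) (by omega)
  have h2 := hsum j
  push_cast at h1
  have h3 : 0 ≤ ε * j := by positivity
  linarith

/-! ### Growth of the cost when a link is too unreliable -/

section Growth

variable (P : Plant n m) {Q R : Matrix (Fin n) (Fin n) ℝ} {ps pc : ℝ} {σ : Policy}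

/-- If a part `G` of the covariance survives every slot in open loop with probability at least
`p`, its expectation dominates the series of disturbances damped by `p`. -/
lemma sum_pow_mul_trace_le_expect (hps : ps ∈ Set.Ioo (0 : ℝ) 1) (hpc : pc ∈ Set.Ioo (0 : ℝ) 1)
    (hR : R.PosSemidef) {p : ℝ} (hp : 0 ≤ p) {G : Cov n → Matrix (Fin n) (Fin n) ℝ}
    (hG0 : ∀ X : Cov n, X.Nonneg → (G X).PosSemidef)
    (hG : ∀ X : Cov n, X.Nonneg → ∀ a, ∀ M : Matrix (Fin n) (Fin n) ℝ, M.PosSemidef →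
      p * (P.Aᵀ * M * P.A * G X).trace + (M * R).trace ≤
        actionValue (dropout ps pc) (P.evolve R) (fun X => (M * G X).trace) X a)
    (k : ℕ) {M : Matrix (Fin n) (Fin n) ℝ} (hM : M.PosSemidef) :
    ∑ l ∈ Finset.range k, p ^ l * (M * (P.A ^ l * R * (P.A ^ l)ᵀ)).trace ≤
      expect (dropout ps pc) σ k fun h => (M * G (P.runFrom R 0 (fun _ => 0) h)).trace := by
  have h0 : ∀ h, (P.runFrom R 0 (fun _ => 0) h).Nonneg :=
    runFrom_nonneg P hR fun _ => Cov.nonneg_zero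
  induction k generalizing M with
  | zero => simpa [expect] using trace_mul_nonneg hM (hG0 _ (h0 []))
  | succ k ih =>
    rw [expect_succ_comp (f := fun X => (M * G X).trace)
      fun e l _ => runFrom_follows P _ e l (Nat.zero_le _)]
    refine le_trans ?_ (expect_mono (dropout_mem hps hpc) fun l _ => hG _ (h0 l) (σ l) M hM)
    rw [expect_add, expect_const, expect_const_mul, Finset.sum_range_succ']
    refine add_le_add ?_ (by simp)
    refine le_trans (le_of_eq ?_)
      (mul_le_mul_of_nonneg_left (ih (posSemidef_conj' hM P.A)) hp)
    rw [Finset.mul_sum]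
    refine Finset.sum_congr rfl fun l _ => ?_
    rw [← trace_mul_conj]
    simp only [pow_succ', Matrix.transpose_mul, mul_assoc]

lemma sum_max_pow_mul_trace_le_expect_cost (hQ : Q.PosSemidef) (hR : R.PosSemidef)
    (hps : ps ∈ Set.Ioo (0 : ℝ) 1) (hpc : pc ∈ Set.Ioo (0 : ℝ) 1) (k : ℕ) :
    ∑ l ∈ Finset.range k, (max ps pc) ^ l * (Q * (P.A ^ l * R * (P.A ^ l)ᵀ)).trace ≤
      expect (dropout ps pc) σ k fun h => Cov.cost Q (P.runFrom R 0 (fun _ => 0) h) := by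
  have h0 : ∀ h, (P.runFrom R 0 (fun _ => 0) h).Nonneg :=
    runFrom_nonneg P hR fun _ => Cov.nonneg_zero
  have key : ∀ X : Cov n, X.Nonneg → ∀ M : Matrix (Fin n) (Fin n) ℝ, M.PosSemidef →
      0 ≤ (P.Aᵀ * M * P.A * X.D).trace ∧ 0 ≤ (P.Aᵀ * M * P.A * X.E).trace := fun X hX M hM =>
    ⟨trace_mul_nonneg (posSemidef_conj' hM _) hX.D,
      trace_mul_nonneg (posSemidef_conj' hM _) hX.E⟩
  rcases le_total ps pc with hle | hle
  · rw [max_eq_right hle]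
    -- Disturbances stay outside `y` until a packet passes the controller link.
    refine (sum_pow_mul_trace_le_expect P hps hpc hR hpc.1.le (G := fun X => X.D + X.E)
      (fun X hX => hX.D.add hX.E) ?_ k hQ).trans (expect_mono (dropout_mem hps hpc) fun l _ => ?_)
    · intro X hX a M hM
      obtain ⟨h1, h2⟩ := key X hX M hM
      have h3 := mul_le_mul_of_nonneg_right hpc.2.le h1
      have h4 := mul_le_mul_of_nonneg_right hpc.2.le h2
      have h5 := mul_nonneg (sub_nonneg.mpr hpc.2.le) h2
      cases a <;> simp only [actionValue, dropout, Plant.evolve, Matrix.mul_add, Matrix.add_mul,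
        trace_mul_conj, Matrix.trace_add, Matrix.mul_zero, Matrix.trace_zero] <;> linarith
    · rw [Cov.cost_eq_trace, add_assoc, Matrix.mul_add _ (Cov.Y _), Matrix.trace_add]
      exact le_add_of_nonneg_left (trace_mul_nonneg hQ (h0 l).Y)
  · rw [max_eq_left hle]
    -- Disturbances stay in the estimation error until a packet passes the sensor link.
    refine (sum_pow_mul_trace_le_expect P hps hpc hR hps.1.le (G := fun X => X.E)
      (fun X hX => hX.E) ?_ k hQ).trans (expect_mono (dropout_mem hps hpc) fun l _ => ?_)
    · intro X hX a M hM
      obtain ⟨h1, h2⟩ := key X hX M hM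
      have h4 := mul_le_mul_of_nonneg_right hps.2.le h2
      cases a <;> simp only [actionValue, dropout, Plant.evolve, Matrix.mul_add,
        trace_mul_conj, Matrix.trace_add] <;> linarith
    · have h1 := trace_mul_nonneg hQ (h0 l).Y
      have h2 := trace_mul_nonneg hQ (h0 l).D
      simp only [Cov.cost, Cov.pair]
      linarith

end Growth

end HalfDuplex

namespace HalfDuplex

/-! ### Reading the covariance state off the indicators -/

variable {n m v : ℕ}

namespace Indicators

/-- `τ` with natural-number indices, `0` outside the range. -/
def tau (s : Indicators v) (i : ℕ) : ℕ := if h : i < v then s.τ ⟨i, h⟩ else 0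

/-- `φ` with natural-number indices, `0` outside the range. -/
def phi (s : Indicators v) (i : ℕ) : ℕ := if h : i < v then s.φ ⟨i, h⟩ else 0

/-- The part of admissibility that the covariance recursion relies on and that is preserved by
`Indicators.next`. -/
def Ordered (s : Indicators v) : Prop := ∀ i, 1 ≤ s.τ i ∧ s.τ i ≤ s.φ i

/-- The first `i` blocks of indicators are linked as they are on every history with enough
received packets: the packet of block `j + 1` left before the disturbances of block `j` ended. -/
def Linked (s : Indicators v) (i : ℕ) : Prop := ∀ j < i, s.tau (j + 1) + 1 ≤ s.phi j

/-- The time since the disturbances of block `i` have been steered by the buffer. -/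
def lag (s : Indicators v) (i : ℕ) : ℕ := ∑ j ∈ Finset.range i, (s.phi j - s.tau (j + 1))

/-- The first link between blocks is in order. -/
def Regular (s : Indicators v) : Prop := 1 < v → s.tau 1 + 1 ≤ s.phi 0

lemma Admissible.ordered {s : Indicators v} (hs : s.Admissible) : s.Ordered :=
  fun i => ⟨(hs i).1, (hs i).2.2.1⟩

lemma Ordered.tau_le_phi {s : Indicators v} (hs : s.Ordered) (i : ℕ) : s.tau i ≤ s.phi i := by
  unfold tau phi
  split_ifs
  · exact (hs _).2
  · exact le_rfl

lemma Ordered.one_le_tau [NeZero v] {s : Indicators v} (hs : s.Ordered) : 1 ≤ s.tau 0 := by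
  rw [tau, dif_pos (NeZero.pos v)]
  exact (hs _).1

lemma Ordered.next {s : Indicators v} (hs : s.Ordered) (e : Slot) : (s.next e).Ordered := by
  intro i
  obtain ⟨a, ok⟩ := e
  have h0 := hs i
  have h1 := hs ⟨i.val - 1, by omega⟩
  cases a <;> cases ok <;>
    simp only [Indicators.next, Slot.sensorSuccess, Slot.controllerSuccess] <;>
    split_ifs <;> simp_all

lemma Ordered.indicators {s : Indicators v} (hs : s.Ordered) (h : List Slot) :
    (indicators s h).Ordered := by
  induction h with
  | nil => exact hs
  | cons e h ih => exact ih.next e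

lemma tau_next_zero [NeZero v] (s : Indicators v) (e : Slot) :
    (s.next e).tau 0 = if e.sensorSuccess then 1 else s.tau 0 + 1 := by
  simp [tau, NeZero.pos v, Indicators.next]

lemma phi_next_zero [NeZero v] (s : Indicators v) (e : Slot) :
    (s.next e).phi 0 = if e.controllerSuccess then s.tau 0 + 1 else s.phi 0 + 1 := by
  simp [tau, phi, NeZero.pos v, Indicators.next]

lemma tau_next_succ (s : Indicators v) (e : Slot) {i : ℕ} (hi : i + 1 < v) :
    (s.next e).tau (i + 1) = if e.controllerSuccess then s.tau i else s.tau (i + 1) := by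
  simp [tau, hi, (Nat.lt_succ_self i).trans hi, Indicators.next]

lemma phi_next_succ (s : Indicators v) (e : Slot) {i : ℕ} (hi : i + 1 < v) :
    (s.next e).phi (i + 1) = if e.controllerSuccess then s.phi i else s.phi (i + 1) := by
  simp [phi, hi, (Nat.lt_succ_self i).trans hi, Indicators.next]

lemma Regular.next [NeZero v] {s : Indicators v} (hs : s.Regular) (e : Slot) :
    (s.next e).Regular := by
  intro hv
  have := hs hv
  rw [phi_next_zero, tau_next_succ s e (by omega), zero_add]
  split_ifs <;> omega

lemma Linked.le_lag {s : Indicators v} {i : ℕ} (hs : s.Linked i) : i ≤ s.lag i := by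
  have : ∑ _j ∈ Finset.range i, 1 ≤ s.lag i := Finset.sum_le_sum fun j hj => by
    have := hs j (Finset.mem_range.mp hj)
    omega
  simpa using this

/-- A history that is longer than the initial `τ¹` makes the first link consistent, because `φ⁰`
grows until a controller packet is received. -/
lemma regular_indicators [NeZero v] (s : Indicators v) {h : List Slot}
    (hh : s.tau 1 < h.length) : (HalfDuplex.indicators s h).Regular := by
  suffices H : ∀ h : List Slot, (HalfDuplex.indicators s h).Regular ∨
      (h.length ≤ (HalfDuplex.indicators s h).phi 0 ∧
        (1 < v → (HalfDuplex.indicators s h).tau 1 = s.tau 1)) by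
    rcases H h with h1 | ⟨h1, h2⟩
    · exact h1
    · intro hv
      rw [h2 hv]
      omega
  intro h
  induction h with
  | nil => exact Or.inr ⟨Nat.zero_le _, fun _ => rfl⟩
  | cons e h ih =>
    rcases ih with h1 | ⟨h1, h2⟩
    · exact Or.inl (h1.next e)
    · by_cases hc : e.controllerSuccess
      · left
        intro hv
        simp only [HalfDuplex.indicators]
        rw [phi_next_zero, tau_next_succ _ e (by omega)]
        simp [hc]
      · right
        simp only [HalfDuplex.indicators]
        rw [phi_next_zero]
        refine ⟨by simpa [hc] using h1, fun hv => ?_⟩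
        rw [tau_next_succ _ e (by omega)]
        simpa [hc] using h2 hv

end Indicators

open Classical in
/-- The covariance that the disturbances of block `i` contribute to the plant state. -/
noncomputable def Plant.block (P : Plant n m) (R : Matrix (Fin n) (Fin n) ℝ) (s : Indicators v)
    (i : ℕ) : Matrix (Fin n) (Fin n) ℝ :=
  if s.Linked i then
    P.closed ^ s.lag i * (openCov P.A R (s.phi i) - openCov P.A R (s.tau i)) *
      (P.closed ^ s.lag i)ᵀ
  else 0

/-- The covariance state that the indicators stand for. Blocks behind an inconsistent link, which
can only stem from the initial indicators, are left out. -/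
noncomputable def Plant.decode (P : Plant n m) (R : Matrix (Fin n) (Fin n) ℝ)
    (s : Indicators v) : Cov n where
  Y := ∑ i ∈ Finset.range (v - 1), P.block R s (i + 1)
  D := openCov P.A R (s.phi 0) - openCov P.A R (s.tau 0)
  E := openCov P.A R (s.tau 0)

section Decode

variable (P : Plant n m) {R : Matrix (Fin n) (Fin n) ℝ}

lemma block_zero (s : Indicators v) :
    P.block R s 0 = openCov P.A R (s.phi 0) - openCov P.A R (s.tau 0) := by
  simp [Plant.block, Indicators.Linked, Indicators.lag]

lemma block_posSemidef (hR : R.PosSemidef) {s : Indicators v} (hs : s.Ordered) (i : ℕ) :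
    (P.block R s i).PosSemidef := by
  rw [Plant.block]
  split_ifs
  · exact posSemidef_conj (openCov_sub_posSemidef P.A hR (hs.tau_le_phi i)) _
  · exact Matrix.PosSemidef.zero

lemma decode_nonneg (hR : R.PosSemidef) {s : Indicators v} (hs : s.Ordered) :
    (P.decode R s).Nonneg :=
  ⟨Matrix.posSemidef_sum (Finset.range (v - 1)) fun i _ => block_posSemidef P hR hs (i + 1),
    openCov_sub_posSemidef P.A hR (hs.tau_le_phi 0), openCov_posSemidef P.A hR _⟩

lemma conj_pow_succ (F B : Matrix (Fin n) (Fin n) ℝ) (k : ℕ) :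
    F ^ (k + 1) * B * (F ^ (k + 1))ᵀ = F * (F ^ k * B * (F ^ k)ᵀ) * Fᵀ := by
  simp only [pow_succ', Matrix.transpose_mul, Matrix.mul_assoc]

lemma block_next_of_not_controllerSuccess [NeZero v] {s : Indicators v} (hs : s.Regular)
    {e : Slot} (he : e.controllerSuccess = false) {i : ℕ} (hi : i + 1 < v) :
    P.block R (s.next e) (i + 1) = P.closed * P.block R s (i + 1) * P.closedᵀ := by
  have hr := hs (by omega)
  have hphi0 : (s.next e).phi 0 = s.phi 0 + 1 := by simp [Indicators.phi_next_zero, he]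
  have hphi : ∀ j, j + 1 < v → (s.next e).phi (j + 1) = s.phi (j + 1) := fun j hj => by
    simp [Indicators.phi_next_succ s e hj, he]
  have htau : ∀ j, j + 1 < v → (s.next e).tau (j + 1) = s.tau (j + 1) := fun j hj => by
    simp [Indicators.tau_next_succ s e hj, he]
  have hlinked : (s.next e).Linked (i + 1) ↔ s.Linked (i + 1) := by
    refine forall₂_congr fun j hj => ?_
    cases j with
    | zero =>
      rw [hphi0, htau 0 (by omega)]
      constructor <;> intro <;> simp only [zero_add] <;> omega
    | succ j => rw [hphi j (by omega), htau (j + 1) (by omega)]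
  have hlag : (s.next e).lag (i + 1) = s.lag (i + 1) + 1 := by
    rw [Indicators.lag, Indicators.lag, Finset.sum_range_succ', Finset.sum_range_succ', hphi0,
      htau 0 (by omega), zero_add]
    have : ∑ j ∈ Finset.range i, ((s.next e).phi (j + 1) - (s.next e).tau (j + 1 + 1)) =
        ∑ j ∈ Finset.range i, (s.phi (j + 1) - s.tau (j + 1 + 1)) :=
      Finset.sum_congr rfl fun j hj => by
        rw [Finset.mem_range] at hj
        rw [hphi j (by omega), htau (j + 1) (by omega)]
    rw [this]
    omega
  by_cases hl : s.Linked (i + 1)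
  · rw [Plant.block, Plant.block, if_pos (hlinked.mpr hl), if_pos hl, hlag, hphi i hi, htau i hi,
      conj_pow_succ]
  · rw [Plant.block, Plant.block, if_neg (hlinked.not.mpr hl), if_neg hl, Matrix.mul_zero,
      Matrix.zero_mul]

lemma block_next_of_controllerSuccess [NeZero v] (s : Indicators v) {e : Slot}
    (he : e.controllerSuccess = true) {i : ℕ} (hi : i + 1 < v) :
    P.block R (s.next e) (i + 1) = P.closed * P.block R s i * P.closedᵀ := by
  have hphi0 : (s.next e).phi 0 = s.tau 0 + 1 := by simp [Indicators.phi_next_zero, he]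
  have hphi : ∀ j, j + 1 < v → (s.next e).phi (j + 1) = s.phi j := fun j hj => by
    simp [Indicators.phi_next_succ s e hj, he]
  have htau : ∀ j, j + 1 < v → (s.next e).tau (j + 1) = s.tau j := fun j hj => by
    simp [Indicators.tau_next_succ s e hj, he]
  have hlinked : (s.next e).Linked (i + 1) ↔ s.Linked i := by
    constructor
    · intro h j hj
      have := h (j + 1) (by omega)
      rwa [hphi j (by omega), htau (j + 1) (by omega)] at this
    · intro h j hj
      cases j with
      | zero => rw [hphi0, htau 0 (by omega)]
      | succ j =>
        rw [hphi j (by omega), htau (j + 1) (by omega)]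
        exact h j (by omega)
  have hlag : (s.next e).lag (i + 1) = s.lag i + 1 := by
    rw [Indicators.lag, Indicators.lag, Finset.sum_range_succ', hphi0, htau 0 (by omega),
      Nat.add_sub_cancel_left]
    congr 1
    refine Finset.sum_congr rfl fun j hj => ?_
    rw [Finset.mem_range] at hj
    rw [hphi j (by omega), htau (j + 1) (by omega)]
  by_cases hl : s.Linked i
  · rw [Plant.block, Plant.block, if_pos (hlinked.mpr hl), if_pos hl, hlag, hphi i hi, htau i hi,
      conj_pow_succ]
  · rw [Plant.block, Plant.block, if_neg (hlinked.not.mpr hl), if_neg hl, Matrix.mul_zero,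
      Matrix.zero_mul]

/-- A block that has been in the buffer for `v` slots has been steered to zero. -/
lemma conj_block_last [NeZero v] (hF : P.closed ^ v = 0) (s : Indicators v) :
    P.closed * P.block R s (v - 1) * P.closedᵀ = 0 := by
  rw [Plant.block]
  split_ifs with h
  · rw [← conj_pow_succ]
    have h1 := h.le_lag
    have h2 : s.lag (v - 1) + 1 = v + (s.lag (v - 1) + 1 - v) := by
      have := NeZero.pos v
      omega
    rw [h2, pow_add, hF]
    simp
  · simp

/-- On regular indicators, reading off the covariance state commutes with the two recursions. -/
lemma decode_next [NeZero v] (hF : P.closed ^ v = 0) {s : Indicators v} (hs : s.Regular)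
    (e : Slot) : P.decode R (s.next e) = P.evolve R e (P.decode R s) := by
  have hYfail : e.controllerSuccess = false →
      (P.decode R (s.next e)).Y = P.closed * (P.decode R s).Y * P.closedᵀ := by
    intro he
    simp only [Plant.decode]
    rw [Finset.mul_sum, Finset.sum_mul]
    refine Finset.sum_congr rfl fun i hi => ?_
    rw [Finset.mem_range] at hi
    exact block_next_of_not_controllerSuccess P hs he (by omega)
  have hEsub : ∀ t t', openCov P.A R (t + 1) - openCov P.A R (t' + 1) =
      P.A * (openCov P.A R t - openCov P.A R t') * P.Aᵀ := fun t t' => by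
    rw [openCov_succ, openCov_succ, add_sub_add_right_eq_sub, ← Matrix.sub_mul,
      ← Matrix.mul_sub]
  have hfail : e.sensorSuccess = false → e.controllerSuccess = false →
      P.decode R (s.next e) = ⟨P.closed * (P.decode R s).Y * P.closedᵀ,
        P.A * (P.decode R s).D * P.Aᵀ, P.A * (P.decode R s).E * P.Aᵀ + R⟩ := by
    intro h1 h2
    ext1
    · exact hYfail h2
    · simp only [Plant.decode]
      rw [Indicators.phi_next_zero, Indicators.tau_next_zero, h1, h2, if_neg (by simp),
        if_neg (by simp), hEsub]
    · simp only [Plant.decode]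
      rw [Indicators.tau_next_zero, h1, if_neg (by simp), openCov_succ]
  obtain ⟨a, ok⟩ := e
  cases ok
  · rw [evolve_fail]
    cases a <;> exact hfail rfl rfl
  cases a
  · simp only [Plant.evolve]
    ext1
    · exact hYfail rfl
    · simp only [Plant.decode]
      rw [Indicators.phi_next_zero, Indicators.tau_next_zero,
        if_neg (by simp [Slot.controllerSuccess]),
        if_pos (by simp [Slot.sensorSuccess]), sub_add_cancel, openCov_succ, openCov_one,
        add_sub_cancel_right]
    · simp only [Plant.decode]
      rw [Indicators.tau_next_zero,
        if_pos (by simp [Slot.sensorSuccess]), openCov_one]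
  · simp only [Plant.evolve]
    ext1
    · simp only [Plant.decode]
      obtain ⟨w, rfl⟩ : ∃ w, v = w + 1 := ⟨v - 1, by have := NeZero.pos v; omega⟩
      have hlast := conj_block_last P (R := R) hF s
      simp only [Nat.add_sub_cancel] at hlast ⊢
      rw [Finset.sum_congr rfl fun i hi => block_next_of_controllerSuccess P s rfl
        (by rw [Finset.mem_range] at hi; omega), ← Finset.sum_mul, ← Finset.mul_sum,
        ← block_zero, ← Finset.sum_range_succ' (P.block R s), Finset.sum_range_succ,
        Matrix.mul_add, Matrix.add_mul, hlast, add_zero]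
    · simp only [Plant.decode]
      rw [Indicators.phi_next_zero, Indicators.tau_next_zero,
        if_pos (by simp [Slot.controllerSuccess]),
        if_neg (by simp [Slot.sensorSuccess]), sub_self]
    · simp only [Plant.decode]
      rw [Indicators.tau_next_zero, if_neg (by simp [Slot.sensorSuccess]), openCov_succ]

end Decode

end HalfDuplex

namespace HalfDuplex

/-! ### The average cost of the minimizing stationary policy -/

instance : Finite Action :=
  Finite.of_injective (fun a : Action => match a with
    | Action.sensor => false
    | Action.controller => true) (by intro a b; cases a <;> cases b <;> simp)

/-- In the optimality identity the relative value contracts, so it stays bounded together with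
the cost. -/
lemma exists_bound_of_relValue {a b : ℕ → ℝ} {J C : ℝ} (hC : 1 ≤ C)
    (hb : ∀ k, 0 ≤ b k) (hba : ∀ k, b k ≤ C * (1 + a k))
    (hstep : ∀ k, a k + b (k + 1) = J + b k) : ∃ M, ∀ k, a k ≤ M := by
  have hC0 : 0 < C := by linarith
  set M := max (b 0) (C * (J + 1)) with hM
  have hbM : ∀ k, b k ≤ M := by
    intro k
    induction k with
    | zero => exact le_max_left _ _
    | succ k ih =>
      have h1 : C * (J + 1) ≤ M := le_max_right _ _
      have h2 := hba k
      have h3 := hstep k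
      have h4 : C * b (k + 1) ≤ C * M := by nlinarith
      exact le_of_mul_le_mul_left h4 hC0
  exact ⟨J + M, fun k => by linarith [hstep k, hbM k, hb (k + 1)]⟩

variable {n m v : ℕ}

/-- Up to the factor `c`, the disturbances of `X'` that are not yet steered by the buffer dominate
those of `X`, and so do the disturbances not yet known to the controller. -/
def Cov.Dominated (c : ℝ) (X X' : Cov n) : Prop :=
  (c • X'.E - X.E).PosSemidef ∧ (c • (X'.D + X'.E) - (X.D + X.E)).PosSemidef

section Domination

variable {P : Plant n m} {Q R : Matrix (Fin n) (Fin n) ℝ}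

lemma Cov.Dominated.evolve {c : ℝ} {X X' : Cov n} (h : X.Dominated c X') (e : Slot) :
    (P.evolve 0 e X).Dominated c (P.evolve 0 e X') := by
  have hsub : ∀ M M' : Matrix (Fin n) (Fin n) ℝ,
      c • (P.A * M' * P.Aᵀ) - P.A * M * P.Aᵀ = P.A * (c • M' - M) * P.Aᵀ := fun M M' => by
    simp only [Matrix.mul_sub, Matrix.sub_mul, Matrix.mul_smul, Matrix.smul_mul]
  have hE := posSemidef_conj h.1 P.A
  have hDE := posSemidef_conj h.2 P.A
  rw [← hsub] at hE hDE
  obtain ⟨a, ok⟩ := e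
  cases ok
  · rw [evolve_fail, evolve_fail]
    refine ⟨by simpa using hE, ?_⟩
    simpa [Matrix.mul_add, Matrix.add_mul] using hDE
  · cases a
    · exact ⟨by simpa [Plant.evolve] using Matrix.PosSemidef.zero, by
        simpa [Plant.evolve] using hDE⟩
    · exact ⟨by simpa [Plant.evolve] using hE, by simpa [Plant.evolve] using hE⟩

lemma Plant.Follows.dominated {c : ℝ} {T : ℕ} {Z Z' : List Slot → Cov n}
    (hZ : P.Follows 0 T Z) (hZ' : P.Follows 0 T Z')
    (hT : ∀ l, l.length = T → (Z l).Dominated c (Z' l)) {l : List Slot} (hl : T ≤ l.length) :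
    (Z l).Dominated c (Z' l) := by
  induction l with
  | nil => exact hT [] (by simp at hl; simp [hl])
  | cons e l ih =>
    rcases hl.eq_or_lt with h | h
    · exact hT _ h.symm
    · have hl' : T ≤ l.length := by simp at h; omega
      rw [hZ e l hl', hZ' e l hl']
      exact (ih hl').evolve e

end Domination

section Stationary

variable {P : Plant n m} {Q R : Matrix (Fin n) (Fin n) ℝ} {err : Action → ℝ} {J C : ℝ}
  {h : Cov n → ℝ} {σ : Policy}

lemma le_sum_expect_cost (herr : ∀ a, err a ∈ Set.Ioo (0 : ℝ) 1)
    (hopt : P.OptimalityEquation Q R err J C h) {T : ℕ} {Z : List Slot → Cov n}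
    (hZ0 : ∀ l, (Z l).Nonneg) (hZ : P.Follows R T Z) (N : ℕ) :
    N * J - C * (1 + expect err σ (T + N) fun l => Cov.cost Q (Z l)) ≤
      ∑ j ∈ Finset.range N, expect err σ (T + j) fun l => Cov.cost Q (Z l) := by
  have htel : ∀ N : ℕ, N * J ≤
      ∑ j ∈ Finset.range N, expect err σ (T + j) (fun l => Cov.cost Q (Z l)) +
        expect err σ (T + N) fun l => h (Z l) := by
    intro N
    induction N with
    | zero => simpa using expect_relValue_nonneg herr hopt hZ0 T
    | succ N ih =>
      have := le_expect_cost_add (σ := σ) herr hopt hZ0 hZ (Nat.le_add_right T N)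
      rw [Finset.sum_range_succ, ← add_assoc]
      push_cast
      linarith
  linarith [htel N, expect_relValue_le (σ := σ) herr hopt hZ0 (T + N)]

/-- Without disturbances, the total cost of a covariance process is controlled by that of a
process that dominates it. -/
lemma sum_expect_cost_le_of_dominated (herr : ∀ a, err a ∈ Set.Ioo (0 : ℝ) 1)
    (hQ : Q.PosDef) (hF : P.closed ^ v = 0) {c : ℝ} (hc : 0 ≤ c) {T : ℕ}
    {Z Z' : List Slot → Cov n}
    (hZ0 : ∀ l, (Z l).Nonneg) (hZ0' : ∀ l, (Z' l).Nonneg)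
    (hZ : P.Follows 0 T Z) (hZ' : P.Follows 0 T Z')
    (hT : ∀ l, l.length = T → (Z l).Dominated c (Z' l)) :
    ∃ K, ∀ N, ∑ j ∈ Finset.range N, expect err σ (T + j) (fun l => Cov.cost Q (Z l)) ≤
      K * (1 + ∑ j ∈ Finset.range N, expect err σ (T + j) fun l => Cov.cost Q (Z' l)) := by
  set S := steeringCost P.closed Q v with hS
  have hSp : S.PosSemidef := steeringCost_posSemidef _ hQ.posSemidef _
  have hSeq : S = Q + P.closedᵀ * S * P.closed := steeringCost_eq hF
  have hSp' : (P.closedᵀ * S * P.closed).PosSemidef := posSemidef_conj' hSp _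
  obtain ⟨C₂, hC₂, hC₂S⟩ := exists_trace_mul_le hQ hSp'.1
  set y : ℕ → ℝ := fun k => expect err σ k fun l => (S * (Z l).Y).trace with hy
  have hy0 : ∀ k, 0 ≤ y k := fun k =>
    expect_nonneg herr fun l _ => trace_mul_nonneg hSp (hZ0 l).Y
  have hnext : ∀ X : Cov n, X.Nonneg → ∀ e,
      (S * (P.evolve 0 e X).Y).trace ≤
        (S * X.Y).trace - (Q * X.Y).trace + C₂ * (Q * X.D).trace := by
    intro X hX e
    have h1 := congrArg (fun M => (M * X.Y).trace) hSeq
    have h2 := hC₂S _ hX.D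
    have h3 := trace_mul_nonneg hSp' hX.D
    simp only [Matrix.add_mul, Matrix.trace_add] at h1
    obtain ⟨a, ok⟩ := e
    cases a <;> cases ok <;> simp only [Plant.evolve, Matrix.mul_add, Matrix.add_mul,
      trace_mul_conj, Matrix.trace_add] <;> linarith
  have hstep : ∀ k, T ≤ k → expect err σ k (fun l => Cov.cost Q (Z l)) + y (k + 1) ≤
      y k + (C₂ + 1) * c * expect err σ k fun l => Cov.cost Q (Z' l) := by
    intro k hk
    simp only [hy]
    rw [expect_succ_comp (f := fun X : Cov n => (S * X.Y).trace)
      fun e l hl => hZ e l (hk.trans_eq hl.symm), ← expect_const_mul, ← expect_add, ← expect_add]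
    refine expect_mono herr fun l hl => ?_
    have h1 : actionValue err (P.evolve 0) (fun X : Cov n => (S * X.Y).trace) (Z l) (σ l) ≤
        (S * (Z l).Y).trace - (Q * (Z l).Y).trace + C₂ * (Q * (Z l).D).trace := by
      have h2 := mul_le_mul_of_nonneg_left (hnext _ (hZ0 l) (σ l, false)) (herr (σ l)).1.le
      have h3 := mul_le_mul_of_nonneg_left (hnext _ (hZ0 l) (σ l, true))
        (sub_nonneg.mpr (herr (σ l)).2.le)
      rw [actionValue]
      linarith
    have h2 := trace_mul_nonneg hQ.posSemidef
      (hZ.dominated hZ' hT (hk.trans_eq hl.symm)).2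
    simp only [Matrix.mul_sub, Matrix.mul_add, Matrix.mul_smul, smul_add, Matrix.trace_sub,
      Matrix.trace_add, Matrix.trace_smul, smul_eq_mul] at h2
    have h3 := trace_mul_nonneg hQ.posSemidef (hZ0 l).E
    have h4 := trace_mul_nonneg hQ.posSemidef (hZ0' l).Y
    have h5 := mul_nonneg (add_nonneg (zero_le_one.trans hC₂) zero_le_one) h2
    have h6 := mul_nonneg (mul_nonneg (add_nonneg (zero_le_one.trans hC₂) zero_le_one) hc) h4
    have h7 := mul_nonneg (zero_le_one.trans hC₂) h3
    simp only [Cov.cost, Cov.pair]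
    nlinarith
  have htel : ∀ N : ℕ,
      ∑ j ∈ Finset.range N, expect err σ (T + j) (fun l => Cov.cost Q (Z l)) + y (T + N) ≤
        y T + (C₂ + 1) * c *
          ∑ j ∈ Finset.range N, expect err σ (T + j) fun l => Cov.cost Q (Z' l) := by
    intro N
    induction N with
    | zero => simp
    | succ N ih =>
      have := hstep (T + N) (Nat.le_add_right T N)
      rw [Finset.sum_range_succ, Finset.sum_range_succ, ← add_assoc, mul_add]
      linarith
  refine ⟨y T + (C₂ + 1) * c, fun N => ?_⟩
  have h1 : 0 ≤ ∑ j ∈ Finset.range N, expect err σ (T + j) fun l => Cov.cost Q (Z' l) :=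
    Finset.sum_nonneg fun j _ => expect_nonneg herr fun l _ => (hZ0' l).cost_nonneg hQ.posSemidef
  have h2 : 0 ≤ (C₂ + 1) * c := mul_nonneg (by linarith) hc
  nlinarith [htel N, hy0 (T + N), hy0 T, mul_nonneg (hy0 T) h1]

/-- Under the stationary policy that minimizes the optimality equation at the covariance state
read off the indicators, accumulated costs differ from `N J` by a bounded amount only, whatever the
actual initial covariances are. The process read off the indicators follows the covariance
recursion only from some time on and need not agree with the actual one; the difference is due to
initial values, whose total cost is finite. -/
theorem exists_stationary_cost_bounds [NeZero v] (herr : ∀ a, err a ∈ Set.Ioo (0 : ℝ) 1)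
    (hQ : Q.PosDef) (hR : R.PosDef) (hF : P.closed ^ v = 0) (hC : 1 ≤ C)
    (hopt : P.OptimalityEquation Q R err J C h) {π : Indicators v → Action}
    (hπ : ∀ s : Indicators v, actionValue err (P.evolve R) h (P.decode R s) (π s) =
      bestValue err (P.evolve R) h (P.decode R s))
    {s₀ : Indicators v} (hs₀ : s₀.Ordered) {X : Cov n} (hX : X.Nonneg) :
    ∃ K, ∀ N : ℕ,
      ∑ k ∈ Finset.range N, expect err (stationary π s₀) k
        (fun l => Cov.cost Q (P.runFrom R 0 (fun _ => X) l)) ≤ N * J + K ∧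
      N * J - K ≤ ∑ k ∈ Finset.range N, expect err (stationary π s₀) k
        fun l => Cov.cost Q (P.runFrom R 0 (fun _ => 0) l) := by
  have hQs := hQ.posSemidef
  have hRs := hR.posSemidef
  set σ := stationary π s₀ with hσ
  set T := s₀.tau 1 + 1 with hTdef
  set Z : List Slot → Cov n := fun l => P.decode R (indicators s₀ l) with hZdef
  have hZ : P.Follows R T Z := fun e l hl =>
    decode_next P hF (Indicators.regular_indicators s₀ (by omega)) e
  have hZ0 : ∀ l, (Z l).Nonneg := fun l => decode_nonneg P hRs (hs₀.indicators l)
  have hσopt : ∀ l, actionValue err (P.evolve R) h (Z l) (σ l) =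
      bestValue err (P.evolve R) h (Z l) := fun l => hπ _
  set X₁ := P.runFrom R 0 fun _ => X with hX₁
  have hX₁f : P.Follows R 0 X₁ := runFrom_follows P _
  have hX₁0 : ∀ l, (X₁ l).Nonneg := runFrom_nonneg P hRs fun _ => hX
  set X₂ := P.runFrom R 0 fun _ => 0 with hX₂
  have hX₂0 : ∀ l, (X₂ l).Nonneg := runFrom_nonneg P hRs fun _ => Cov.nonneg_zero
  set W := P.runFrom R T fun _ => 0 with hW
  have hW0 : ∀ l, (W l).Nonneg := runFrom_nonneg P hRs fun _ => Cov.nonneg_zero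
  set H := P.runFrom 0 T X₁ with hH
  have hH0 : ∀ l, (H l).Nonneg := runFrom_nonneg P Matrix.PosSemidef.zero hX₁0
  set H' := P.runFrom 0 T Z with hH'
  have hH0' : ∀ l, (H' l).Nonneg := runFrom_nonneg P Matrix.PosSemidef.zero hZ0
  have hcostZ : ∀ k, expect err σ k (fun l => Cov.cost Q (Z l)) =
      expect err σ k (fun l => Cov.cost Q (W l)) + expect err σ k fun l => Cov.cost Q (H' l) := by
    intro k
    rw [← expect_add]
    exact expect_congr fun l _ => by rw [hZ.eq_add l, Cov.cost_add]
  have hcostX : ∀ k, expect err σ k (fun l => Cov.cost Q (X₁ l)) =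
      expect err σ k (fun l => Cov.cost Q (W l)) + expect err σ k fun l => Cov.cost Q (H l) := by
    intro k
    rw [← expect_add]
    refine expect_congr fun l _ => ?_
    rw [(hX₁f.of_le (Nat.zero_le T)).eq_add l, Cov.cost_add]
  have hcost21 : ∀ k, expect err σ k (fun l => Cov.cost Q (X₂ l)) ≤
      expect err σ k fun l => Cov.cost Q (X₁ l) := by
    refine fun k => expect_mono herr fun l _ => ?_
    rw [hX₁f.eq_add l, Cov.cost_add]
    exact le_add_of_nonneg_right
      ((runFrom_nonneg P Matrix.PosSemidef.zero hX₁0 l).cost_nonneg hQs)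
  have hnn : ∀ {V : List Slot → Cov n}, (∀ l, (V l).Nonneg) → ∀ k,
      0 ≤ expect err σ k fun l => Cov.cost Q (V l) := fun hV k =>
    expect_nonneg herr fun l _ => (hV l).cost_nonneg hQs
  -- The process read off the indicators attains the optimal average up to a constant.
  have hstepZ : ∀ j, expect err σ (T + j) (fun l => Cov.cost Q (Z l)) +
      expect err σ (T + (j + 1)) (fun l => h (Z l)) =
        J + expect err σ (T + j) fun l => h (Z l) := fun j =>
    expect_cost_add_eq hopt hZ0 hZ hσopt (Nat.le_add_right T j)
  obtain ⟨M, hM⟩ := exists_bound_of_relValue hC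
    (fun j => expect_relValue_nonneg (σ := σ) herr hopt hZ0 (T + j))
    (fun j => expect_relValue_le herr hopt hZ0 (T + j)) hstepZ
  set b := expect err σ T fun l => h (Z l) with hb
  have hsumZ : ∀ N : ℕ,
      ∑ j ∈ Finset.range N, expect err σ (T + j) (fun l => Cov.cost Q (Z l)) ≤ N * J + b := by
    have htel : ∀ N : ℕ,
        ∑ j ∈ Finset.range N, expect err σ (T + j) (fun l => Cov.cost Q (Z l)) +
          expect err σ (T + N) (fun l => h (Z l)) = N * J + b := by
      intro N
      induction N with
      | zero => simp [hb]
      | succ N ih =>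
        rw [Finset.sum_range_succ]
        push_cast
        linarith [hstepZ N]
    exact fun N => by linarith [htel N, expect_relValue_nonneg (σ := σ) herr hopt hZ0 (T + N)]
  have hsumW : ∀ N : ℕ, N * J - C * (1 + M) ≤
      ∑ j ∈ Finset.range N, expect err σ (T + j) fun l => Cov.cost Q (W l) := by
    intro N
    refine le_trans ?_ (le_sum_expect_cost (σ := σ) herr hopt hW0 (runFrom_follows P _) N)
    have h1 : expect err σ (T + N) (fun l => Cov.cost Q (W l)) ≤ M := by
      linarith [hM N, hcostZ (T + N), hnn hH0' (T + N)]
    have := mul_le_mul_of_nonneg_left (add_le_add_right h1 1) (zero_le_one.trans hC)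
    linarith
  have hsumH' : ∀ N : ℕ,
      ∑ j ∈ Finset.range N, expect err σ (T + j) (fun l => Cov.cost Q (H' l)) ≤
        b + C * (1 + M) := by
    intro N
    have h1 : ∑ j ∈ Finset.range N, expect err σ (T + j) (fun l => Cov.cost Q (Z l)) =
        ∑ j ∈ Finset.range N, expect err σ (T + j) (fun l => Cov.cost Q (W l)) +
          ∑ j ∈ Finset.range N, expect err σ (T + j) fun l => Cov.cost Q (H' l) := by
      rw [← Finset.sum_add_distrib]
      exact Finset.sum_congr rfl fun j _ => hcostZ (T + j)
    linarith [hsumZ N, hsumW N]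
  -- At time `T` the estimation error read off the indicators is positive definite, so a
  -- multiple of it dominates the actual covariances on each of the finitely many histories.
  have hdomT : ∃ c, 0 ≤ c ∧ ∀ l, l.length = T → (H l).Dominated c (H' l) := by
    have hl : ∀ l : List Slot, ∃ c : ℝ, ∀ c' ≥ c, (X₁ l).Dominated c' (Z l) := by
      intro l
      have hEpd : (Z l).E.PosDef := by
        have h1 := openCov_sub_posSemidef P.A hRs (hs₀.indicators l).one_le_tau
        have h2 := hR.add_posSemidef h1
        rwa [openCov_one, add_sub_cancel] at h2
      have hDEpd : ((Z l).D + (Z l).E).PosDef := hEpd.posSemidef_add (hZ0 l).D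
      obtain ⟨c₁, -, h₁⟩ := exists_smul_sub_posSemidef hEpd (hX₁0 l).E.1
      obtain ⟨c₂, -, h₂⟩ := exists_smul_sub_posSemidef hDEpd ((hX₁0 l).D.add (hX₁0 l).E).1
      refine ⟨max c₁ c₂, fun c' hc' => ⟨?_, ?_⟩⟩
      · have := h₁.add (hEpd.posSemidef.smul
          (sub_nonneg.mpr ((le_max_left c₁ c₂).trans hc')))
        convert this using 1
        rw [sub_smul]
        abel
      · have := h₂.add (hDEpd.posSemidef.smul
          (sub_nonneg.mpr ((le_max_right c₁ c₂).trans hc')))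
        convert this using 1
        rw [sub_smul]
        abel
    choose c hc using hl
    obtain ⟨c₀, hc₀⟩ := ((List.finite_length_eq Slot T).image c).bddAbove
    refine ⟨max c₀ 0, le_max_right _ _, fun l hlT => ?_⟩
    rw [hH, hH', runFrom_of_length_eq P _ hlT, runFrom_of_length_eq P _ hlT]
    exact hc l _ ((hc₀ (Set.mem_image_of_mem c hlT)).trans (le_max_left _ _))
  obtain ⟨c, hc, hdom⟩ := hdomT
  obtain ⟨K₁, hK₁⟩ := sum_expect_cost_le_of_dominated (σ := σ) herr hQ hF hc hH0 hH0'
    (runFrom_follows P _) (runFrom_follows P _) hdom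
  obtain ⟨K₂, hK₂⟩ : ∃ K₂, ∀ N : ℕ,
      ∑ j ∈ Finset.range N, expect err σ (T + j) (fun l => Cov.cost Q (H l)) ≤ K₂ := by
    refine ⟨|K₁| * (1 + (b + C * (1 + M))), fun N => (hK₁ N).trans ?_⟩
    have h1 : 0 ≤ ∑ j ∈ Finset.range N, expect err σ (T + j) fun l => Cov.cost Q (H' l) :=
      Finset.sum_nonneg fun j _ => hnn hH0' _
    refine (mul_le_mul_of_nonneg_right (le_abs_self K₁) (by linarith)).trans ?_
    exact mul_le_mul_of_nonneg_left (by linarith [hsumH' N]) (abs_nonneg _)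
  have hK₂0 : 0 ≤ K₂ := by simpa using hK₂ 0
  set A₀ := ∑ k ∈ Finset.range T, expect err σ k fun l => Cov.cost Q (X₁ l) with hA₀
  have hA₀0 : 0 ≤ A₀ := Finset.sum_nonneg fun k _ => hnn hX₁0 k
  have hb0 : 0 ≤ b := expect_relValue_nonneg herr hopt hZ0 T
  have hM0 : 0 ≤ M := (hnn hZ0 (T + 0)).trans (hM 0)
  refine ⟨A₀ + b + K₂ + C * (1 + (A₀ + M + K₂)), fun N => ⟨?_, ?_⟩⟩
  · calc ∑ k ∈ Finset.range N, expect err σ k (fun l => Cov.cost Q (X₁ l))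
        ≤ ∑ k ∈ Finset.range (T + N), expect err σ k (fun l => Cov.cost Q (X₁ l)) :=
          Finset.sum_le_sum_of_subset_of_nonneg
            (Finset.range_subset_range.mpr (Nat.le_add_left N T)) fun k _ _ => hnn hX₁0 k
      _ = A₀ + (∑ j ∈ Finset.range N, expect err σ (T + j) (fun l => Cov.cost Q (W l)) +
            ∑ j ∈ Finset.range N, expect err σ (T + j) fun l => Cov.cost Q (H l)) := by
          rw [Finset.sum_range_add, ← Finset.sum_add_distrib]
          exact congrArg (A₀ + ·) (Finset.sum_congr rfl fun j _ => hcostX (T + j))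
      _ ≤ A₀ + ((N * J + b) + K₂) := by
          refine add_le_add le_rfl (add_le_add (le_trans ?_ (hsumZ N)) (hK₂ N))
          exact Finset.sum_le_sum fun j _ => by linarith [hcostZ (T + j), hnn hH0' (T + j)]
      _ ≤ _ := by
          have : 0 ≤ C * (1 + (A₀ + M + K₂)) := mul_nonneg (zero_le_one.trans hC) (by linarith)
          linarith
  · have hlow := le_sum_expect_cost (σ := σ) herr hopt hX₂0 (runFrom_follows P (T := 0) _) N
    simp only [zero_add] at hlow
    have hbd : expect err σ N (fun l => Cov.cost Q (X₂ l)) ≤ A₀ + M + K₂ := by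
      refine (hcost21 N).trans ?_
      rcases lt_or_ge N T with hN | hN
      · have := Finset.single_le_sum (f := fun k => expect err σ k fun l => Cov.cost Q (X₁ l))
          (fun k _ => hnn hX₁0 k) (Finset.mem_range.mpr hN)
        linarith
      · obtain ⟨j, rfl⟩ := Nat.exists_eq_add_of_le hN
        have h1 := Finset.single_le_sum
          (f := fun j => expect err σ (T + j) fun l => Cov.cost Q (H l))
          (fun k _ => hnn hH0 (T + k)) (Finset.mem_range.mpr (Nat.lt_succ_self j))
        linarith [hcostX (T + j), hcostZ (T + j), hnn hH0' (T + j), hM j, hK₂ (j + 1)]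
    have := mul_le_mul_of_nonneg_left (add_le_add_right hbd 1) (zero_le_one.trans hC)
    linarith

end Stationary

end HalfDuplex

namespace HalfDuplex

/-! ### Second moments of random vectors -/

variable {Ω : Type*} [MeasurableSpace Ω] {μ : Measure Ω} {n m v : ℕ}

/-- A random vector with square-integrable coordinates, tested against fixed vectors. -/
def IsL2 (μ : Measure Ω) (a : Ω → Fin n → ℝ) : Prop :=
  ∀ u : Fin n → ℝ, MemLp (fun ω => u ⬝ᵥ a ω) 2 μ

/-- `E[a bᵀ] = M`, tested against fixed vectors. -/
def HasCov (μ : Measure Ω) (a b : Ω → Fin n → ℝ) (M : Matrix (Fin n) (Fin n) ℝ) : Prop :=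
  ∀ u v : Fin n → ℝ, ∫ ω, (u ⬝ᵥ a ω) * (v ⬝ᵥ b ω) ∂μ = u ⬝ᵥ (M *ᵥ v)

section Cov

variable {a b c : Ω → Fin n → ℝ} {M N : Matrix (Fin n) (Fin n) ℝ}

lemma isL2_zero : IsL2 μ (fun _ => (0 : Fin n → ℝ)) := fun u => by
  simp only [dotProduct_zero]
  exact MemLp.zero

lemma IsL2.add (ha : IsL2 μ a) (hb : IsL2 μ b) : IsL2 μ (fun ω => a ω + b ω) := fun u => by
  simp only [dotProduct_add]
  exact (ha u).add (hb u)

lemma IsL2.sub (ha : IsL2 μ a) (hb : IsL2 μ b) : IsL2 μ (fun ω => a ω - b ω) := fun u => by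
  simp only [dotProduct_sub]
  exact (ha u).sub (hb u)

lemma IsL2.mulVec (ha : IsL2 μ a) (A : Matrix (Fin n) (Fin n) ℝ) :
    IsL2 μ (fun ω => A *ᵥ a ω) := fun u => by
  simp only [Matrix.dotProduct_mulVec]
  exact ha _

lemma IsL2.integrable (ha : IsL2 μ a) (hb : IsL2 μ b) (u v : Fin n → ℝ) :
    Integrable (fun ω => (u ⬝ᵥ a ω) * (v ⬝ᵥ b ω)) μ :=
  (ha u).integrable_mul (hb v)

lemma isL2_of_memLp (ha : MemLp a 2 μ) : IsL2 μ a := fun u => by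
  simp only [dotProduct]
  exact memLp_finsetSum _ fun i _ => ((memLp_pi_iff.mp ha) i).const_mul (u i)

lemma hasCov_zero_left : HasCov μ (fun _ => 0) b 0 := fun u v => by simp

lemma HasCov.symm (h : HasCov μ a b M) : HasCov μ b a Mᵀ := fun u v => by
  simp only [mul_comm (u ⬝ᵥ _)]
  rw [h v u, Matrix.mulVec_transpose, dotProduct_comm u, Matrix.dotProduct_mulVec]

lemma HasCov.add_left (hab : HasCov μ a c M) (hbc : HasCov μ b c N) (ha : IsL2 μ a)
    (hb : IsL2 μ b) (hc : IsL2 μ c) : HasCov μ (fun ω => a ω + b ω) c (M + N) := fun u v => by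
  simp only [dotProduct_add, add_mul, Matrix.add_mulVec]
  rw [integral_add (ha.integrable hc u v) (hb.integrable hc u v), hab, hbc]

lemma HasCov.add_right (hab : HasCov μ c a M) (hbc : HasCov μ c b N) (ha : IsL2 μ a)
    (hb : IsL2 μ b) (hc : IsL2 μ c) : HasCov μ c (fun ω => a ω + b ω) (M + N) := by
  simpa using (hab.symm.add_left hbc.symm ha hb hc).symm

lemma HasCov.mulVec_left (h : HasCov μ a b M) (A : Matrix (Fin n) (Fin n) ℝ) :
    HasCov μ (fun ω => A *ᵥ a ω) b (A * M) := fun u v => by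
  simp only [Matrix.dotProduct_mulVec]
  rw [h, ← Matrix.vecMul_vecMul, Matrix.dotProduct_mulVec]

lemma HasCov.mulVec_right (h : HasCov μ a b M) (A : Matrix (Fin n) (Fin n) ℝ) :
    HasCov μ a (fun ω => A *ᵥ b ω) (M * Aᵀ) := by
  simpa using (h.symm.mulVec_left A).symm

lemma HasCov.add_add {M₁ M₂ M₃ M₄ : Matrix (Fin n) (Fin n) ℝ} (h₁ : HasCov μ a a M₁)
    (h₂ : HasCov μ b a M₂) (h₃ : HasCov μ a b M₃) (h₄ : HasCov μ b b M₄)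
    (ha : IsL2 μ a) (hb : IsL2 μ b) :
    HasCov μ (fun ω => a ω + b ω) (fun ω => a ω + b ω) (M₁ + M₂ + (M₃ + M₄)) :=
  (h₁.add_left h₂ ha hb ha).add_right (h₃.add_left h₄ ha hb hb) ha hb (ha.add hb)

/-- Second moments of a sum of uncorrelated vectors add up. -/
lemma HasCov.add_of_uncorrelated (ha : HasCov μ a a M) (hb : HasCov μ b b N)
    (hab : HasCov μ a b 0) (ha2 : IsL2 μ a) (hb2 : IsL2 μ b) :
    HasCov μ (fun ω => a ω + b ω) (fun ω => a ω + b ω) (M + N) := by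
  simpa using ha.add_add hab.symm hab hb ha2 hb2

lemma HasCov.conj (h : HasCov μ a a M) (A : Matrix (Fin n) (Fin n) ℝ) :
    HasCov μ (fun ω => A *ᵥ a ω) (fun ω => A *ᵥ a ω) (A * M * Aᵀ) :=
  (h.mulVec_left A).mulVec_right A

lemma HasCov.mulVec_zero (h : HasCov μ a b 0) (A B : Matrix (Fin n) (Fin n) ℝ) :
    HasCov μ (fun ω => A *ᵥ a ω) (fun ω => B *ᵥ b ω) 0 := by
  simpa using (h.mulVec_left A).mulVec_right B

lemma hasCov_of_entries (ha : IsL2 μ a) (hb : IsL2 μ b)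
    (h : ∀ i j, ∫ ω, a ω i * b ω j ∂μ = M i j) : HasCov μ a b M := fun u v => by
  have hint : ∀ i j, Integrable (fun ω => u i * a ω i * (v j * b ω j)) μ := fun i j => by
    have := ((ha.integrable hb (Pi.single i 1) (Pi.single j 1)).const_mul (u i * v j))
    refine this.congr (Eventually.of_forall fun ω => ?_)
    simp only [single_one_dotProduct]
    ring
  have hexp : ∀ ω, (u ⬝ᵥ a ω) * (v ⬝ᵥ b ω) = ∑ i, ∑ j, u i * a ω i * (v j * b ω j) := fun ω => by
    rw [dotProduct, dotProduct, Finset.sum_mul_sum]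
  simp only [hexp]
  simp only [dotProduct, Matrix.mulVec, Finset.mul_sum]
  rw [integral_finsetSum _ fun i _ => integrable_finsetSum _ fun j _ => hint i j]
  refine Finset.sum_congr rfl fun i _ => ?_
  rw [integral_finsetSum _ fun j _ => hint i j]
  refine Finset.sum_congr rfl fun j _ => ?_
  rw [← h i j, ← mul_assoc, mul_right_comm, ← integral_const_mul]
  exact integral_congr_ae (Eventually.of_forall fun ω => by ring)

lemma exists_hasCov (ha : IsL2 μ a) :
    ∃ M : Matrix (Fin n) (Fin n) ℝ, M.PosSemidef ∧ HasCov μ a a M := by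
  have h := hasCov_of_entries (M := Matrix.of fun i j => ∫ ω, a ω i * a ω j ∂μ) ha ha
    fun i j => rfl
  refine ⟨_, ?_, h⟩
  rw [Matrix.posSemidef_iff_dotProduct_mulVec]
  refine ⟨?_, fun u => ?_⟩
  · ext i j
    simp [mul_comm]
  · rw [star_trivial, ← h u u]
    exact integral_nonneg fun ω => mul_self_nonneg _

/-- The expectation of a quadratic form. -/
lemma HasCov.integral_quadForm (h : HasCov μ a a M) (ha : IsL2 μ a)
    (Q : Matrix (Fin n) (Fin n) ℝ) :
    Integrable (fun ω => a ω ⬝ᵥ (Q *ᵥ a ω)) μ ∧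
      ∫ ω, a ω ⬝ᵥ (Q *ᵥ a ω) ∂μ = (Q * M).trace := by
  have hexp : ∀ ω, a ω ⬝ᵥ (Q *ᵥ a ω) = ∑ i, (Pi.single i 1 ⬝ᵥ a ω) * (Q i ⬝ᵥ a ω) := fun ω => by
    simp only [single_one_dotProduct]
    rfl
  simp only [hexp]
  have hint : ∀ i, Integrable (fun ω => (Pi.single i 1 ⬝ᵥ a ω) * (Q i ⬝ᵥ a ω)) μ := fun i =>
    ha.integrable ha _ _
  refine ⟨integrable_finsetSum _ fun i _ => hint i, ?_⟩
  rw [integral_finsetSum _ fun i _ => hint i, Matrix.trace_mul_comm]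
  have hM : Mᵀ = M := by
    ext i j
    have h1 := h (Pi.single i 1) (Pi.single j 1)
    have h2 := h (Pi.single j 1) (Pi.single i 1)
    simp only [single_one_dotProduct, Matrix.mulVec_single_one, Matrix.col_apply] at h1 h2
    rw [Matrix.transpose_apply, ← h1, ← h2]
    exact integral_congr_ae (Eventually.of_forall fun ω => mul_comm _ _)
  have hi : ∀ i, ∫ ω, (Pi.single i 1 ⬝ᵥ a ω) * (Q i ⬝ᵥ a ω) ∂μ = M i ⬝ᵥ Q i := fun i => by
    rw [h, single_one_dotProduct]
    rfl
  simp only [hi]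
  rw [← hM, Matrix.trace_mul_comm]
  simp only [Matrix.trace, Matrix.diag, Matrix.mul_apply, dotProduct, Matrix.transpose_apply]
  exact Finset.sum_congr rfl fun i _ => Finset.sum_congr rfl fun j _ => by
    rw [← Matrix.transpose_apply M, hM, mul_comm]

end Cov

/-! ### The three parts of the plant state -/

/-- The parts of the plant state `x = y + d + e`: `y` is steered to zero by the commands in the
buffer, `d` is known to the controller only, and `e` is the estimation error. -/
structure Parts (n : ℕ) where
  y : Fin n → ℝ
  d : Fin n → ℝ
  e : Fin n → ℝ

/-- The plant state made up of its parts. -/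
def Parts.state (p : Parts n) : Fin n → ℝ := p.y + p.d + p.e

/-- One slot of the parts, with disturbance `w`. -/
def Plant.move (P : Plant n m) : Slot → Parts n → (Fin n → ℝ) → Parts n
  | (Action.controller, true), p, w => ⟨P.closed *ᵥ (p.y + p.d), 0, P.A *ᵥ p.e + w⟩
  | (Action.sensor, true), p, w => ⟨P.closed *ᵥ p.y, P.A *ᵥ (p.d + p.e), w⟩
  | (_, false), p, w => ⟨P.closed *ᵥ p.y, P.A *ᵥ p.d, P.A *ᵥ p.e + w⟩

lemma move_fail (P : Plant n m) (a : Action) (p : Parts n) (w : Fin n → ℝ) :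
    P.move (a, false) p w = ⟨P.closed *ᵥ p.y, P.A *ᵥ p.d, P.A *ᵥ p.e + w⟩ := by
  cases a <;> rfl

/-- The parts along a history, from `(0, d₀, e₀)`. -/
def Plant.parts (P : Plant n m) (d₀ e₀ : Fin n → ℝ) (w : ℕ → Fin n → ℝ) : List Slot → Parts n
  | [] => ⟨0, d₀, e₀⟩
  | s :: h => P.move s (P.parts d₀ e₀ w h) (w h.length)

section Parts

variable (P : Plant n m)

lemma parts_add (d₀ e₀ d₁ e₁ : Fin n → ℝ) (w w' : ℕ → Fin n → ℝ) (h : List Slot) :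
    (P.parts (d₀ + d₁) (e₀ + e₁) (w + w') h).y =
        (P.parts d₀ e₀ w h).y + (P.parts d₁ e₁ w' h).y ∧
      (P.parts (d₀ + d₁) (e₀ + e₁) (w + w') h).d =
        (P.parts d₀ e₀ w h).d + (P.parts d₁ e₁ w' h).d ∧
      (P.parts (d₀ + d₁) (e₀ + e₁) (w + w') h).e =
        (P.parts d₀ e₀ w h).e + (P.parts d₁ e₁ w' h).e := by
  induction h with
  | nil => simp [Plant.parts]
  | cons s h ih =>
    obtain ⟨h1, h2, h3⟩ := ih
    obtain ⟨a, ok⟩ := s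
    cases a <;> cases ok <;>
      simp only [Plant.parts, Plant.move, h1, h2, h3, Pi.add_apply, Matrix.mulVec_add,
        add_zero] <;> refine ⟨?_, ?_, ?_⟩ <;> first | trivial | abel

lemma state_add (d₀ e₀ d₁ e₁ : Fin n → ℝ) (w w' : ℕ → Fin n → ℝ) (h : List Slot) :
    (P.parts (d₀ + d₁) (e₀ + e₁) (w + w') h).state =
      (P.parts d₀ e₀ w h).state + (P.parts d₁ e₁ w' h).state := by
  obtain ⟨h1, h2, h3⟩ := parts_add P d₀ e₀ d₁ e₁ w w' h
  simp only [Parts.state, h1, h2, h3]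
  abel

variable {d₀ e₀ : Ω → Fin n → ℝ} {w : ℕ → Ω → Fin n → ℝ}

lemma isL2_parts (hd : IsL2 μ d₀) (he : IsL2 μ e₀) (hw : ∀ k, IsL2 μ (w k)) (h : List Slot) :
    IsL2 μ (fun ω => (P.parts (d₀ ω) (e₀ ω) (w · ω) h).y) ∧
      IsL2 μ (fun ω => (P.parts (d₀ ω) (e₀ ω) (w · ω) h).d) ∧
      IsL2 μ (fun ω => (P.parts (d₀ ω) (e₀ ω) (w · ω) h).e) := by
  induction h with
  | nil => exact ⟨isL2_zero, hd, he⟩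
  | cons s h ih =>
    obtain ⟨h1, h2, h3⟩ := ih
    obtain ⟨a, ok⟩ := s
    cases ok
    · simp only [Plant.parts, move_fail]
      exact ⟨h1.mulVec _, h2.mulVec _, (h3.mulVec _).add (hw _)⟩
    · cases a
      · exact ⟨h1.mulVec _, (h2.add h3).mulVec _, hw _⟩
      · exact ⟨(h1.add h2).mulVec _, isL2_zero, (h3.mulVec _).add (hw _)⟩

lemma isL2_state (hd : IsL2 μ d₀) (he : IsL2 μ e₀) (hw : ∀ k, IsL2 μ (w k)) (h : List Slot) :
    IsL2 μ (fun ω => (P.parts (d₀ ω) (e₀ ω) (w · ω) h).state) := by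
  obtain ⟨h1, h2, h3⟩ := isL2_parts P hd he hw h
  exact (h1.add h2).add h3

/-- A vector that is uncorrelated with the initial parts and the disturbances so far is
uncorrelated with the current parts. -/
lemma hasCov_parts_zero {g : Ω → Fin n → ℝ} (hg : IsL2 μ g) (hd : IsL2 μ d₀) (he : IsL2 μ e₀)
    (hw : ∀ k, IsL2 μ (w k)) (hgd : HasCov μ g d₀ 0) (hge : HasCov μ g e₀ 0) (h : List Slot)
    (hgw : ∀ k < h.length, HasCov μ g (w k) 0) :
    HasCov μ g (fun ω => (P.parts (d₀ ω) (e₀ ω) (w · ω) h).y) 0 ∧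
      HasCov μ g (fun ω => (P.parts (d₀ ω) (e₀ ω) (w · ω) h).d) 0 ∧
      HasCov μ g (fun ω => (P.parts (d₀ ω) (e₀ ω) (w · ω) h).e) 0 := by
  have hzero : HasCov μ g (fun _ => 0) 0 := by simpa using hasCov_zero_left.symm
  have hmul : ∀ {b : Ω → Fin n → ℝ}, HasCov μ g b 0 → ∀ A : Matrix (Fin n) (Fin n) ℝ,
      HasCov μ g (fun ω => A *ᵥ b ω) 0 := fun hb A => by simpa using hb.mulVec_right A
  have hadd : ∀ {b c : Ω → Fin n → ℝ}, HasCov μ g b 0 → HasCov μ g c 0 → IsL2 μ b → IsL2 μ c →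
      HasCov μ g (fun ω => b ω + c ω) 0 := fun hb hc hb2 hc2 => by
    simpa using hb.add_right hc hb2 hc2 hg
  induction h with
  | nil => exact ⟨hzero, hgd, hge⟩
  | cons s h ih =>
    obtain ⟨h1, h2, h3⟩ := ih fun k hk => hgw k (hk.trans (by simp))
    obtain ⟨l1, l2, l3⟩ := isL2_parts P hd he hw h
    have h4 := hgw h.length (by simp)
    obtain ⟨a, ok⟩ := s
    cases ok
    · simp only [Plant.parts, move_fail]
      exact ⟨hmul h1 _, hmul h2 _, hadd (hmul h3 _) h4 (l3.mulVec _) (hw _)⟩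
    · cases a
      · exact ⟨hmul h1 _, hmul (hadd h2 h3 l2 l3) _, h4⟩
      · exact ⟨hmul (hadd h1 h2 l1 l2) _, hzero, hadd (hmul h3 _) h4 (l3.mulVec _) (hw _)⟩

lemma hasCov_state_zero {g : Ω → Fin n → ℝ} (hg : IsL2 μ g) (hd : IsL2 μ d₀) (he : IsL2 μ e₀)
    (hw : ∀ k, IsL2 μ (w k)) (hgd : HasCov μ g d₀ 0) (hge : HasCov μ g e₀ 0)
    (hgw : ∀ k, HasCov μ g (w k) 0) (h : List Slot) :
    HasCov μ g (fun ω => (P.parts (d₀ ω) (e₀ ω) (w · ω) h).state) 0 := by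
  obtain ⟨h1, h2, h3⟩ := hasCov_parts_zero P hg hd he hw hgd hge h fun k _ => hgw k
  obtain ⟨l1, l2, l3⟩ := isL2_parts P hd he hw h
  have h4 := (h1.add_right h2 l1 l2 hg).add_right h3 (l1.add l2) l3 hg
  rw [add_zero, add_zero] at h4
  exact h4

/-- Second moments of the parts: uncorrelated initial parts and disturbances stay in separate
parts, so the covariances obey the recursion `Plant.evolve`. -/
lemma hasCov_parts (hd : IsL2 μ d₀) (he : IsL2 μ e₀) (hw : ∀ k, IsL2 μ (w k))
    {D E R : Matrix (Fin n) (Fin n) ℝ} (hdd : HasCov μ d₀ d₀ D) (hee : HasCov μ e₀ e₀ E)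
    (hde : HasCov μ d₀ e₀ 0) (hww : ∀ k, HasCov μ (w k) (w k) R)
    (hwne : ∀ j k, j ≠ k → HasCov μ (w j) (w k) 0) (hwd : ∀ k, HasCov μ (w k) d₀ 0)
    (hwe : ∀ k, HasCov μ (w k) e₀ 0) (h : List Slot) :
    let p := fun ω => P.parts (d₀ ω) (e₀ ω) (w · ω) h
    let X := P.runFrom R 0 (fun _ => ⟨0, D, E⟩) h
    HasCov μ (fun ω => (p ω).y) (fun ω => (p ω).y) X.Y ∧
      HasCov μ (fun ω => (p ω).d) (fun ω => (p ω).d) X.D ∧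
      HasCov μ (fun ω => (p ω).e) (fun ω => (p ω).e) X.E ∧
      HasCov μ (fun ω => (p ω).y) (fun ω => (p ω).d) 0 ∧
      HasCov μ (fun ω => (p ω).y) (fun ω => (p ω).e) 0 ∧
      HasCov μ (fun ω => (p ω).d) (fun ω => (p ω).e) 0 := by
  induction h with
  | nil => exact ⟨hasCov_zero_left, hdd, hee, hasCov_zero_left, hasCov_zero_left, hde⟩
  | cons s h ih =>
    intro p X
    obtain ⟨hyy, hdd', hee', hyd, hye, hde'⟩ := ih
    obtain ⟨l1, l2, l3⟩ := isL2_parts P hd he hw h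
    obtain ⟨w1, w2, w3⟩ := hasCov_parts_zero P (hw h.length) hd he hw (hwd _) (hwe _) h
      fun k hk => hwne _ _ hk.ne'
    have w1' := w1.symm
    have w2' := w2.symm
    have w3' := w3.symm
    rw [Matrix.transpose_zero] at w1' w2' w3'
    have hX : X = P.evolve R s (P.runFrom R 0 (fun _ => ⟨0, D, E⟩) h) :=
      runFrom_follows P _ s h (Nat.zero_le _)
    have hnew := ((hee'.conj P.A).add_of_uncorrelated (hww h.length)
      (by simpa using w3'.mulVec_left P.A) (l3.mulVec _) (hw _))
    rw [hX]
    have hright : ∀ {b : Ω → Fin n → ℝ}, HasCov μ b (fun _ => 0) 0 := fun {b} => by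
      simpa using (hasCov_zero_left (μ := μ) (b := b)).symm
    have hmul : ∀ {b c : Ω → Fin n → ℝ}, HasCov μ b c 0 → ∀ A : Matrix (Fin n) (Fin n) ℝ,
      HasCov μ (fun ω => A *ᵥ b ω) c 0 := fun hb A => by simpa using hb.mulVec_left A
    have hadd : ∀ {b c g : Ω → Fin n → ℝ}, HasCov μ g b 0 → HasCov μ g c 0 → IsL2 μ b →
        IsL2 μ c → IsL2 μ g → HasCov μ g (fun ω => b ω + c ω) 0 := fun hb hc hb2 hc2 hg => by
      simpa using hb.add_right hc hb2 hc2 hg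
    have hadd' : ∀ {b c g : Ω → Fin n → ℝ}, HasCov μ b g 0 → HasCov μ c g 0 → IsL2 μ b →
        IsL2 μ c → IsL2 μ g → HasCov μ (fun ω => b ω + c ω) g 0 := fun hb hc hb2 hc2 hg => by
      simpa using hb.add_left hc hb2 hc2 hg
    obtain ⟨a, ok⟩ := s
    cases ok
    · rw [evolve_fail]
      simp only [p, Plant.parts, move_fail]
      exact ⟨hyy.conj _, hdd'.conj _, hnew, hyd.mulVec_zero _ _,
        hadd (hye.mulVec_zero _ _) (hmul w1' _) (l3.mulVec _) (hw _) (l1.mulVec _),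
        hadd (hde'.mulVec_zero _ _) (hmul w2' _) (l3.mulVec _) (hw _) (l2.mulVec _)⟩
    · cases a
      · exact ⟨hyy.conj _, (hdd'.add_of_uncorrelated hee' hde' l2 l3).conj _, hww _,
          (hadd hyd hye l2 l3 l1).mulVec_zero _ _, hmul w1' _,
          hmul (hadd' w2' w3' l2 l3 (hw _)) _⟩
      · exact ⟨(hyy.add_of_uncorrelated hdd' hyd l1 l2).conj _, hasCov_zero_left, hnew, hright,
          hadd ((hadd' hye hde' l1 l2 l3).mulVec_zero _ _) (hmul (hadd' w1' w2' l1 l2 (hw _)) _)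
            (l3.mulVec _) (hw _) ((l1.add l2).mulVec _), hasCov_zero_left⟩

lemma hasCov_state (hd : IsL2 μ d₀) (he : IsL2 μ e₀) (hw : ∀ k, IsL2 μ (w k))
    {D E R : Matrix (Fin n) (Fin n) ℝ} (hdd : HasCov μ d₀ d₀ D) (hee : HasCov μ e₀ e₀ E)
    (hde : HasCov μ d₀ e₀ 0) (hww : ∀ k, HasCov μ (w k) (w k) R)
    (hwne : ∀ j k, j ≠ k → HasCov μ (w j) (w k) 0) (hwd : ∀ k, HasCov μ (w k) d₀ 0)
    (hwe : ∀ k, HasCov μ (w k) e₀ 0) (h : List Slot) :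
    HasCov μ (fun ω => (P.parts (d₀ ω) (e₀ ω) (w · ω) h).state)
      (fun ω => (P.parts (d₀ ω) (e₀ ω) (w · ω) h).state)
      ((P.runFrom R 0 (fun _ => ⟨0, D, E⟩) h).Y + (P.runFrom R 0 (fun _ => ⟨0, D, E⟩) h).D +
        (P.runFrom R 0 (fun _ => ⟨0, D, E⟩) h).E) := by
  obtain ⟨hyy, hdd', hee', hyd, hye, hde'⟩ := hasCov_parts P hd he hw hdd hee hde hww hwne hwd
    hwe h
  obtain ⟨l1, l2, l3⟩ := isL2_parts P hd he hw h
  refine (hyy.add_of_uncorrelated hdd' hyd l1 l2).add_of_uncorrelated hee' ?_ (l1.add l2) l3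
  simpa using hye.add_left hde' l1 l2 l3

end Parts

end HalfDuplex

namespace HalfDuplex

/-! ### The control loop along a fixed history -/

variable {Ω : Type*} {n m v : ℕ}

/-- The closed loop after a given history. -/
def Plant.loopAlong (P : Plant n m) (v : ℕ) [NeZero v] (I : Inputs Ω n) (ω : Ω) :
    List Slot → Loop n m v
  | [] => { x := I.x₀ ω, est := I.est₀ ω, buf := fun _ => 0 }
  | e :: h => P.step (P.loopAlong v I ω h) e (I.w h.length ω)

lemma length_history (I : Inputs Ω n) (σ : Policy) (ω : Ω) (k : ℕ) :
    (history I σ ω k).length = k := by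
  induction k with
  | zero => rfl
  | succ k ih => simp [history, ih]

lemma loop_eq_loopAlong (P : Plant n m) [NeZero v] (I : Inputs Ω n) (σ : Policy) (ω : Ω)
    (k : ℕ) : P.loop v I σ ω k = P.loopAlong v I ω (history I σ ω k) := by
  induction k with
  | zero => rfl
  | succ k ih => simp only [Plant.loop, history, Plant.loopAlong, length_history, ih]

/-- The commands that a shifted buffer still holds steer the part `y` of the plant state. -/
lemma loopAlong_eq_parts (P : Plant n m) [NeZero v] (hF : P.closed ^ v = 0) (I : Inputs Ω n)
    (ω : Ω) (h : List Slot) :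
    let L := P.loopAlong v I ω h
    let p := P.parts (I.est₀ ω) (I.x₀ ω - I.est₀ ω) (I.w · ω) h
    L.x = p.state ∧ L.est = p.y + p.d ∧ shift L.buf = P.commands v p.y := by
  induction h with
  | nil =>
    refine ⟨by simp [Plant.loopAlong, Plant.parts, Parts.state],
      by simp [Plant.loopAlong, Plant.parts], ?_⟩
    funext i
    simp [Plant.loopAlong, Plant.parts, shift, Plant.commands]
  | cons s h ih =>
    intro L p
    obtain ⟨hx, hest, hbuf⟩ := ih
    set L' := P.loopAlong v I ω h with hL'
    set p' := P.parts (I.est₀ ω) (I.x₀ ω - I.est₀ ω) (I.w · ω) h with hp'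
    have hL : L = P.step L' s (I.w h.length ω) := rfl
    have hp : p = P.move s p' (I.w h.length ω) := rfl
    have hshift : ∀ y : Fin n → ℝ, shift (P.commands v y) = P.commands v (P.closed *ᵥ y) := by
      intro y
      funext i
      rw [shift]
      split_ifs with hi
      · simp only [Plant.commands, Matrix.mulVec_mulVec, Matrix.mul_assoc]
        rw [← Plant.closed, ← pow_succ]
      · have hi' : i.val + 1 = v := by omega
        simp only [Plant.commands, Matrix.mulVec_mulVec, Matrix.mul_assoc]
        rw [← Plant.closed, ← pow_succ, hi', hF]
        simp
    have hcmd : ∀ y : Fin n → ℝ, P.A *ᵥ y + P.B *ᵥ (P.commands v y 0) = P.closed *ᵥ y := by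
      intro y
      simp [Plant.commands, Plant.closed, Matrix.add_mulVec]
    have hzero : P.closed *ᵥ p'.y = P.A *ᵥ p'.y + P.B *ᵥ (P.commands v p'.y 0) :=
      (hcmd _).symm
    have hone : P.closed *ᵥ (p'.y + p'.d) =
        P.A *ᵥ (p'.y + p'.d) + P.B *ᵥ (P.commands v (p'.y + p'.d) 0) := (hcmd _).symm
    have hfail : s.controllerSuccess = false → P.buffer L' s = P.commands v p'.y := fun hs => by
      rw [Plant.buffer, hs, if_neg (by simp), hbuf]
    obtain ⟨a, ok⟩ := s
    cases ok
    · have hb := hfail (by cases a <;> rfl)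
      have hs : Slot.sensorSuccess (a, false) = false := by cases a <;> rfl
      rw [hL, hp, move_fail]
      refine ⟨?_, ?_, ?_⟩
      · simp only [Plant.step, Parts.state, hb, hx, hzero, Matrix.mulVec_add]
        abel
      · simp only [Plant.step, hb, hest, hs, hzero, Matrix.mulVec_add]
        simp only [Bool.false_eq_true, if_false]
        abel
      · simp only [Plant.step, hb, hshift]
    · cases a
      · have hb := hfail rfl
        rw [hL, hp]
        refine ⟨?_, ?_, ?_⟩
        · simp only [Plant.step, Plant.move, Parts.state, hb, hx, hzero, Matrix.mulVec_add]
          abel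
        · simp only [Plant.step, Plant.move, hb, Slot.sensorSuccess, if_true, hx, Parts.state,
            hzero, Matrix.mulVec_add]
          abel
        · simp only [Plant.step, Plant.move, hb, hshift]
      · have hb : P.buffer L' (Action.controller, true) = P.commands v (p'.y + p'.d) := by
          simp [Plant.buffer, Slot.controllerSuccess, hest]
        rw [hL, hp]
        refine ⟨?_, ?_, ?_⟩
        · simp only [Plant.step, Plant.move, Parts.state, hb, hx, hone, Matrix.mulVec_add]
          abel
        · simp only [Plant.step, Plant.move, hb, Slot.sensorSuccess, hest, hone]
          simp
        · simp only [Plant.step, Plant.move, hb, hshift]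

/-! ### Expected costs as expectations over histories -/

/-- The sources that are not revealed by the transmission outcomes before slot `k`. -/
def laterSources (k : ℕ) : Set Source :=
  {Source.init} ∪ Set.range Source.noise ∪
    (Source.uplink '' Set.Ici k ∪ Source.downlink '' Set.Ici k)

/-- The information carried by the sources that are not revealed before slot `k`. -/
abbrev Inputs.later (I : Inputs Ω n) (k : ℕ) : MeasurableSpace Ω :=
  ⨆ i ∈ laterSources k, I.sigma i

/-- The label of the channel that an action uses in slot `k`. -/
def Action.source (a : Action) (k : ℕ) : Source :=
  match a with
  | Action.sensor => Source.uplink k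
  | Action.controller => Source.downlink k

/-- Whether the channel that an action uses is open in slot `k`. -/
def Inputs.channel (I : Inputs Ω n) (a : Action) (k : ℕ) : Ω → Bool :=
  match a with
  | Action.sensor => I.up k
  | Action.controller => I.down k

lemma slot_eq (I : Inputs Ω n) (k : ℕ) (ω : Ω) (a : Action) :
    I.slot k ω a = (a, I.channel a k ω) := by
  cases a <;> rfl

lemma sigma_source (I : Inputs Ω n) (a : Action) (k : ℕ) :
    I.sigma (a.source k) = MeasurableSpace.comap (I.channel a k) inferInstance := by
  cases a <;> rfl

section Law

variable [mΩ : MeasurableSpace Ω] {μ : Measure Ω}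
  {R : Matrix (Fin n) (Fin n) ℝ} {ps pc : ℝ} {I : Inputs Ω n}

lemma Inputs.IsModel.sigma_le (hI : I.IsModel μ R ps pc) (i : Source) : I.sigma i ≤ mΩ := by
  cases i
  · exact (hI.measurable_x₀.prodMk hI.measurable_est₀).comap_le
  · exact (hI.measurable_w _).comap_le
  · exact (hI.measurable_up _).comap_le
  · exact (hI.measurable_down _).comap_le

lemma Inputs.IsModel.later_le (hI : I.IsModel μ R ps pc) (k : ℕ) : I.later k ≤ mΩ :=
  iSup₂_le fun i _ => hI.sigma_le i

lemma sigma_le_later {Ω : Type*} {I : Inputs Ω n} {i : Source} {k : ℕ} (hi : i ∈ laterSources k) :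
    I.sigma i ≤ I.later k :=
  le_iSup₂ (f := fun i _ => I.sigma i) i hi

lemma later_succ_le {Ω : Type*} {I : Inputs Ω n} (k : ℕ) : I.later (k + 1) ≤ I.later k := by
  refine iSup₂_le fun i hi => sigma_le_later ?_
  rcases hi with hi | ⟨j, hj, rfl⟩ | ⟨j, hj, rfl⟩
  · exact Or.inl hi
  · exact Or.inr (Or.inl ⟨j, (Nat.le_succ k).trans hj, rfl⟩)
  · exact Or.inr (Or.inr ⟨j, (Nat.le_succ k).trans hj, rfl⟩)

lemma source_mem_later (a : Action) (k : ℕ) : a.source k ∈ laterSources k := by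
  cases a
  · exact Or.inr (Or.inl ⟨k, Set.mem_Ici.mpr le_rfl, rfl⟩)
  · exact Or.inr (Or.inr ⟨k, Set.mem_Ici.mpr le_rfl, rfl⟩)

lemma Inputs.IsModel.indep_channel (hI : I.IsModel μ R ps pc) (a : Action) (k : ℕ) :
    Indep (I.sigma (a.source k)) (I.later (k + 1)) μ := by
  have hdisj : Disjoint ({a.source k} : Set Source) (laterSources (k + 1)) := by
    rw [Set.disjoint_singleton_left]
    cases a <;> simp [laterSources, Action.source]
  have h := indep_iSup_of_disjoint hI.sigma_le hI.indep hdisj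
  simpa using h

lemma Inputs.IsModel.measure_channel [IsProbabilityMeasure μ] (hI : I.IsModel μ R ps pc)
    (hps : ps ∈ Set.Ioo (0 : ℝ) 1) (hpc : pc ∈ Set.Ioo (0 : ℝ) 1) (a : Action) (k : ℕ) :
    μ {ω | I.channel a k ω = false} = ENNReal.ofReal (dropout ps pc a) ∧
      μ {ω | I.channel a k ω = true} = ENNReal.ofReal (1 - dropout ps pc a) := by
  have hm : Measurable (I.channel a k) := by
    cases a
    · exact hI.measurable_up k
    · exact hI.measurable_down k
  have h1 : μ {ω | I.channel a k ω = false} = ENNReal.ofReal (dropout ps pc a) := by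
    cases a
    · exact hI.uplink_error k
    · exact hI.downlink_error k
  refine ⟨h1, ?_⟩
  have h2 : {ω | I.channel a k ω = true} = {ω | I.channel a k ω = false}ᶜ := by
    ext ω
    simp
  have h3 : MeasurableSet {ω | I.channel a k ω = false} := hm (measurableSet_singleton false)
  rw [h2, prob_compl_eq_one_sub h3, h1,
    ENNReal.ofReal_sub _ (dropout_mem hps hpc a).1.le, ENNReal.ofReal_one]

/-- The history is independent of the initial data and the disturbances: integrals of functions of
both are expectations over histories of integrals with the history fixed. -/
lemma lintegral_history [IsProbabilityMeasure μ] (hI : I.IsModel μ R ps pc)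
    (hps : ps ∈ Set.Ioo (0 : ℝ) 1) (hpc : pc ∈ Set.Ioo (0 : ℝ) 1) (σ : Policy) (k : ℕ)
    {g : List Slot → Ω → ℝ≥0∞}
    (hg : ∀ h, Measurable[I.later k] (g h)) {u : List Slot → ℝ} (hu0 : ∀ h, 0 ≤ u h)
    (hu : ∀ h, ∫⁻ ω, g h ω ∂μ = ENNReal.ofReal (u h)) :
    ∫⁻ ω, g (history I σ ω k) ω ∂μ = ENNReal.ofReal (expect (dropout ps pc) σ k u) := by
  induction k generalizing g u with
  | zero => exact hu []
  | succ k ih =>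
    have hind : ∀ a ok, Measurable[I.sigma (a.source k)]
        ({ω | I.channel a k ω = ok}.indicator (fun _ => (1 : ℝ≥0∞))) := by
      intro a ok
      rw [sigma_source]
      have h1 : {ω | I.channel a k ω = ok}.indicator (fun _ => (1 : ℝ≥0∞)) =
          (fun b : Bool => if b = ok then 1 else 0) ∘ I.channel a k := by
        ext ω
        simp [Set.indicator]
      rw [h1]
      exact (measurable_of_countable _).comp (comap_measurable _)
    have hsplit : ∀ h ω, g (I.slot k ω (σ h) :: h) ω =
        {ω | I.channel (σ h) k ω = false}.indicator (fun _ => 1) ω * g ((σ h, false) :: h) ω +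
          {ω | I.channel (σ h) k ω = true}.indicator (fun _ => 1) ω *
            g ((σ h, true) :: h) ω := by
      intro h ω
      rw [slot_eq]
      cases hc : I.channel (σ h) k ω <;> simp [hc]
    have hmeas : ∀ h, Measurable[I.later k] fun ω => g (I.slot k ω (σ h) :: h) ω := by
      intro h
      simp only [hsplit]
      have ha : ∀ ok, Measurable[I.later k]
          ({ω | I.channel (σ h) k ω = ok}.indicator (fun _ => (1 : ℝ≥0∞))) := fun ok =>
        (hind (σ h) ok).mono (sigma_le_later (source_mem_later _ k)) le_rfl
      have hb : ∀ ok, Measurable[I.later k] (g ((σ h, ok) :: h)) := fun ok =>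
        (hg _).mono (later_succ_le k) le_rfl
      exact ((ha false).mul (hb false)).add ((ha true).mul (hb true))
    have hprod : ∀ a ok h, ∫⁻ ω, {ω | I.channel a k ω = ok}.indicator (fun _ => 1) ω * g h ω ∂μ =
        μ {ω | I.channel a k ω = ok} * ENNReal.ofReal (u h) := by
      intro a ok h
      have hset : MeasurableSet {ω | I.channel a k ω = ok} := by
        refine hI.sigma_le (a.source k) _ ?_
        rw [sigma_source]
        exact ⟨{ok}, measurableSet_singleton ok, rfl⟩
      rw [lintegral_mul_eq_lintegral_mul_lintegral_of_independent_measurableSpace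
        (hI.sigma_le (a.source k)) (hI.later_le (k + 1)) (hI.indep_channel a k) (hind a ok) (hg h),
        hu, lintegral_indicator hset, setLIntegral_const, one_mul]
    refine ih hmeas (fun h => ?_) fun h => ?_
    · exact add_nonneg (mul_nonneg (dropout_mem hps hpc _).1.le (hu0 _))
        (mul_nonneg (sub_nonneg.mpr (dropout_mem hps hpc _).2.le) (hu0 _))
    · have hm : ∀ ok, Measurable fun ω =>
          {ω | I.channel (σ h) k ω = ok}.indicator (fun _ => (1 : ℝ≥0∞)) ω *
            g ((σ h, ok) :: h) ω := fun ok =>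
        ((hind (σ h) ok).mono (hI.sigma_le _) le_rfl).mul ((hg _).mono (hI.later_le _) le_rfl)
      obtain ⟨h1, h2⟩ := hI.measure_channel hps hpc (σ h) k
      simp only [hsplit]
      rw [lintegral_add_left (hm false), hprod, hprod, h1, h2,
        ← ENNReal.ofReal_mul (dropout_mem hps hpc _).1.le,
        ← ENNReal.ofReal_mul (sub_nonneg.mpr (dropout_mem hps hpc _).2.le),
        ← ENNReal.ofReal_add (mul_nonneg (dropout_mem hps hpc _).1.le (hu0 _))
          (mul_nonneg (sub_nonneg.mpr (dropout_mem hps hpc _).2.le) (hu0 _))]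

end Law

end HalfDuplex

namespace HalfDuplex

/-! ### Bounds on the expected cost -/

section Bounds

variable {Ω : Type*} {n m v : ℕ}

lemma measurable_state {_ : MeasurableSpace Ω} (P : Plant n m) {d₀ e₀ : Ω → Fin n → ℝ}
    {w : ℕ → Ω → Fin n → ℝ} (hd : Measurable d₀) (he : Measurable e₀)
    (hw : ∀ k, Measurable (w k)) (h : List Slot) :
    Measurable fun ω => (P.parts (d₀ ω) (e₀ ω) (w · ω) h).state := by
  have hmul : ∀ (A : Matrix (Fin n) (Fin n) ℝ) {a : Ω → Fin n → ℝ}, Measurable a →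
      Measurable fun ω => A *ᵥ a ω := fun A a ha =>
    (Continuous.matrix_mulVec continuous_const continuous_id).measurable.comp ha
  suffices hp : Measurable (fun ω => (P.parts (d₀ ω) (e₀ ω) (w · ω) h).y) ∧
      Measurable (fun ω => (P.parts (d₀ ω) (e₀ ω) (w · ω) h).d) ∧
      Measurable (fun ω => (P.parts (d₀ ω) (e₀ ω) (w · ω) h).e) from (hp.1.add hp.2.1).add hp.2.2
  induction h with
  | nil => exact ⟨measurable_const, hd, he⟩
  | cons s h ih =>
    obtain ⟨h1, h2, h3⟩ := ih
    obtain ⟨a, ok⟩ := s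
    cases ok
    · simp only [Plant.parts, move_fail]
      exact ⟨hmul _ h1, hmul _ h2, (hmul _ h3).add (hw _)⟩
    · cases a
      · exact ⟨hmul _ h1, hmul _ (h2.add h3), hw _⟩
      · exact ⟨hmul _ (h1.add h2), measurable_const, (hmul _ h3).add (hw _)⟩

variable [mΩ : MeasurableSpace Ω] {μ : Measure Ω} {Q R : Matrix (Fin n) (Fin n) ℝ}

/-- Half of the parallelogram law. -/
lemma quadForm_add_le (hQ : Q.PosSemidef) (a b : Fin n → ℝ) :
    (a + b) ⬝ᵥ (Q *ᵥ (a + b)) ≤ 2 * (a ⬝ᵥ (Q *ᵥ a)) + 2 * (b ⬝ᵥ (Q *ᵥ b)) := by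
  have h := hQ.dotProduct_mulVec_nonneg (a - b)
  simp only [star_trivial, Matrix.mulVec_sub, Matrix.mulVec_add, sub_dotProduct, dotProduct_sub,
    add_dotProduct, dotProduct_add] at h ⊢
  linarith

lemma hasCov_zero_of_indepFun {a b : Ω → Fin n → ℝ} (ha : IsL2 μ a) (hb : IsL2 μ b)
    (hab : IndepFun a b μ) (hmean : ∀ u : Fin n → ℝ, ∫ ω, u ⬝ᵥ a ω ∂μ = 0) :
    HasCov μ a b 0 := fun u v => by
  have hm : ∀ u : Fin n → ℝ, Measurable fun z : Fin n → ℝ => u ⬝ᵥ z := fun u =>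
    (Continuous.dotProduct continuous_const continuous_id).measurable
  have h := (hab.comp (hm u) (hm v)).integral_mul_eq_mul_integral
    (ha u).aestronglyMeasurable (hb v).aestronglyMeasurable
  simp only [Matrix.zero_mulVec, dotProduct_zero]
  refine h.trans ?_
  simp [hmean]

section Model

variable {ps pc : ℝ} {I : Inputs Ω n}

lemma Inputs.IsModel.isL2_noise (hI : I.IsModel μ R ps pc) (k : ℕ) : IsL2 μ (I.w k) :=
  isL2_of_memLp (hI.gaussian k).memLp_two

lemma Inputs.IsModel.integral_noise [IsProbabilityMeasure μ] (hI : I.IsModel μ R ps pc)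
    (k : ℕ) (u : Fin n → ℝ) :
    ∫ ω, u ⬝ᵥ I.w k ω ∂μ = 0 := by
  have hint : ∀ i, Integrable (fun ω => u i * I.w k ω i) μ := fun i =>
    ((memLp_pi_iff.mp (hI.gaussian k).memLp_two i).integrable (by norm_num)).const_mul _
  simp only [dotProduct]
  rw [integral_finsetSum _ fun i _ => hint i]
  simp [integral_const_mul, hI.mean]

lemma Inputs.IsModel.hasCov_noise (hI : I.IsModel μ R ps pc) (k : ℕ) :
    HasCov μ (I.w k) (I.w k) R :=
  hasCov_of_entries (hI.isL2_noise k) (hI.isL2_noise k) (hI.covariance k)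

lemma Inputs.IsModel.hasCov_noise_ne [IsProbabilityMeasure μ] (hI : I.IsModel μ R ps pc)
    {j k : ℕ} (hjk : j ≠ k) :
    HasCov μ (I.w j) (I.w k) 0 :=
  hasCov_zero_of_indepFun (hI.isL2_noise j) (hI.isL2_noise k)
    (hI.indep.indep (i := Source.noise j) (j := Source.noise k) (by simpa using hjk))
    (hI.integral_noise j)

lemma Inputs.IsModel.hasCov_noise_init [IsProbabilityMeasure μ] (hI : I.IsModel μ R ps pc)
    (k : ℕ) :
    HasCov μ (I.w k) I.est₀ 0 ∧ HasCov μ (I.w k) (fun ω => I.x₀ ω - I.est₀ ω) 0 := by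
  have h : IndepFun (I.w k) (fun ω => (I.x₀ ω, I.est₀ ω)) μ :=
    hI.indep.indep (i := Source.noise k) (j := Source.init) (by simp)
  have h₀ := isL2_of_memLp hI.memLp_x₀
  have h₁ := isL2_of_memLp hI.memLp_est₀
  exact ⟨hasCov_zero_of_indepFun (hI.isL2_noise k) h₁
      (h.comp measurable_id measurable_snd) (hI.integral_noise k),
    hasCov_zero_of_indepFun (hI.isL2_noise k) (h₀.sub h₁)
      (h.comp measurable_id (measurable_fst.sub measurable_snd)) (hI.integral_noise k)⟩

/-- Along a fixed history, the expected cost lies between the costs of two covariance processes: one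
without initial uncertainty, and one whose initial covariance absorbs a possible correlation of the
initial estimate with the initial estimation error. -/
lemma exists_integral_cost_bounds [IsProbabilityMeasure μ] (P : Plant n m) (hQ : Q.PosSemidef)
    (hI : I.IsModel μ R ps pc) :
    ∃ X : Cov n, X.Nonneg ∧ ∀ h, ∃ u : ℝ,
      Cov.cost Q (P.runFrom R 0 (fun _ => 0) h) ≤ u ∧
      u ≤ Cov.cost Q (P.runFrom R 0 (fun _ => X) h) ∧
      ∫⁻ ω, ENNReal.ofReal
        ((P.parts (I.est₀ ω) (I.x₀ ω - I.est₀ ω) (I.w · ω) h).state ⬝ᵥ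
          (Q *ᵥ (P.parts (I.est₀ ω) (I.x₀ ω - I.est₀ ω) (I.w · ω) h).state)) ∂μ =
        ENNReal.ofReal u := by
  have hw := hI.isL2_noise
  have hd := isL2_of_memLp hI.memLp_est₀
  have he := (isL2_of_memLp hI.memLp_x₀).sub hd
  have h0 : IsL2 μ (fun _ => (0 : Fin n → ℝ)) := isL2_zero
  have hz : ∀ {b : Ω → Fin n → ℝ}, HasCov μ b (fun _ => 0) 0 := fun {b} => by
    simpa using (hasCov_zero_left (μ := μ) (b := b)).symm
  obtain ⟨D, hD, hdd⟩ := exists_hasCov hd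
  obtain ⟨E, hE, hee⟩ := exists_hasCov he
  have hXD : (⟨0, D, 0⟩ : Cov n).Nonneg := ⟨Matrix.PosSemidef.zero, hD, Matrix.PosSemidef.zero⟩
  have hXE : (⟨0, 0, E⟩ : Cov n).Nonneg := ⟨Matrix.PosSemidef.zero, Matrix.PosSemidef.zero, hE⟩
  refine ⟨(⟨0, D, 0⟩ + ⟨0, D, 0⟩) + (⟨0, 0, E⟩ + ⟨0, 0, E⟩),
    (hXD.add hXD).add (hXE.add hXE), fun h => ?_⟩
  -- The state is the sum of the responses to the disturbances, to `est₀` and to `x₀ - est₀`.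
  set xw := fun ω => (P.parts 0 0 (I.w · ω) h).state with hxw
  set xi := fun ω => (P.parts (I.est₀ ω) (I.x₀ ω - I.est₀ ω) (fun _ => 0) h).state with hxi
  set xd := fun ω => (P.parts (I.est₀ ω) 0 (fun _ => 0) h).state with hxd
  set xe := fun ω => (P.parts 0 (I.x₀ ω - I.est₀ ω) (fun _ => 0) h).state with hxe
  have hx : ∀ ω, (P.parts (I.est₀ ω) (I.x₀ ω - I.est₀ ω) (I.w · ω) h).state =
      xw ω + xi ω := fun ω => by
    rw [← state_add, zero_add, zero_add]
    congr 2
    funext k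
    simp
  have hxi' : ∀ ω, xi ω = xd ω + xe ω := fun ω => by
    simp only [hxi, hxd, hxe]
    rw [← state_add, zero_add, add_zero]
    congr 2
    funext k
    simp
  have lw : IsL2 μ xw := isL2_state P h0 h0 hw h
  have li : IsL2 μ xi := isL2_state P hd he (fun _ => h0) h
  have ld : IsL2 μ xd := isL2_state P hd h0 (fun _ => h0) h
  have le : IsL2 μ xe := isL2_state P h0 he (fun _ => h0) h
  have cw := hasCov_state P h0 h0 hw hz hz hz hI.hasCov_noise
    (fun j k hjk => hI.hasCov_noise_ne hjk) (fun _ => hz) (fun _ => hz) h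
  have cd := hasCov_state P (w := fun _ _ => 0) hd h0 (fun _ => h0) hdd hz hz (fun _ => hz)
    (fun _ _ _ => hz) (fun _ => hasCov_zero_left) (fun _ => hz) h
  have ce := hasCov_state P (w := fun _ _ => 0) h0 he (fun _ => h0) hz hee hasCov_zero_left
    (fun _ => hz) (fun _ _ _ => hz) (fun _ => hz) (fun _ => hasCov_zero_left) h
  have cwi : HasCov μ xi xw 0 := by
    refine hasCov_state_zero P li h0 h0 hw hz hz (fun k => ?_) h
    have := hasCov_state_zero P (w := fun _ _ => 0) (hw k) hd he (fun _ => h0)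
      (hI.hasCov_noise_init k).1 (hI.hasCov_noise_init k).2 (fun _ => hz) h
    simpa using this.symm
  obtain ⟨S, hS, ci⟩ := exists_hasCov li
  have ctot := cw.add_of_uncorrelated ci (by simpa using cwi.symm) lw li
  obtain ⟨hint, hval⟩ := ctot.integral_quadForm (lw.add li) Q
  obtain ⟨iint, hqi⟩ := ci.integral_quadForm li Q
  obtain ⟨dint, hqd⟩ := cd.integral_quadForm ld Q
  obtain ⟨eint, hqe⟩ := ce.integral_quadForm le Q
  rw [← Cov.cost_eq_trace] at hqd hqe
  rw [Matrix.mul_add, Matrix.trace_add, ← Cov.cost_eq_trace] at hval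
  have hle : (Q * S).trace ≤ 2 * Cov.cost Q (P.runFrom 0 0 (fun _ => ⟨0, D, 0⟩) h) +
      2 * Cov.cost Q (P.runFrom 0 0 (fun _ => ⟨0, 0, E⟩) h) := by
    rw [← hqi, ← hqd, ← hqe, ← integral_const_mul, ← integral_const_mul,
      ← integral_add (dint.const_mul 2) (eint.const_mul 2)]
    refine integral_mono iint ((dint.const_mul 2).add (eint.const_mul 2)) fun ω => ?_
    simp only [hxi']
    exact quadForm_add_le hQ _ _
  refine ⟨_, le_add_of_nonneg_right (trace_mul_nonneg hQ hS), ?_, ?_⟩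
  · have h1 := runFrom_add P (R := R) (T := 0) 0 (fun _ => 0)
      (fun _ => (⟨0, D, 0⟩ + ⟨0, D, 0⟩) + (⟨0, 0, E⟩ + ⟨0, 0, E⟩)) h
    have h2 := runFrom_add P (R := 0) (T := 0) 0 (fun _ => ⟨0, D, 0⟩ + ⟨0, D, 0⟩)
      (fun _ => (⟨0, 0, E⟩ + ⟨0, 0, E⟩ : Cov n)) h
    have h3 := runFrom_add P (R := 0) (T := 0) 0 (fun _ => (⟨0, D, 0⟩ : Cov n))
      (fun _ => ⟨0, D, 0⟩) h
    have h4 := runFrom_add P (R := 0) (T := 0) 0 (fun _ => (⟨0, 0, E⟩ : Cov n))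
      (fun _ => ⟨0, 0, E⟩) h
    rw [add_zero] at h1 h2 h3 h4
    simp only [Cov.zero_add'] at h1
    rw [h1, h2, h3, h4]
    simp only [Cov.cost_add]
    linarith
  · change _ = Cov.cost Q (P.runFrom R 0 (fun _ => 0) h) + (Q * S).trace at hval
    rw [← hval]
    simp only [hx]
    refine (ofReal_integral_eq_lintegral_ofReal hint (Eventually.of_forall fun ω => ?_)).symm
    simpa using hQ.dotProduct_mulVec_nonneg (xw ω + xi ω)

/-- The expected cost of every policy lies between expectations over the histories of the costs of
two covariance processes. -/
lemma exists_expectedCost_bounds [IsProbabilityMeasure μ] [NeZero v] (P : Plant n m)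
    (hF : P.closed ^ v = 0) (hQ : Q.PosSemidef) (hR : R.PosSemidef)
    (hps : ps ∈ Set.Ioo (0 : ℝ) 1) (hpc : pc ∈ Set.Ioo (0 : ℝ) 1) (hI : I.IsModel μ R ps pc) :
    ∃ X : Cov n, X.Nonneg ∧ ∀ σ, ∃ r : ℕ → ℝ, ∀ k,
      P.expectedCost v Q I μ σ k = ENNReal.ofReal (r k) ∧
      (expect (dropout ps pc) σ k fun h => Cov.cost Q (P.runFrom R 0 (fun _ => 0) h)) ≤ r k ∧
      r k ≤ expect (dropout ps pc) σ k fun h => Cov.cost Q (P.runFrom R 0 (fun _ => X) h) := by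
  obtain ⟨X, hX, hu⟩ := exists_integral_cost_bounds P hQ hI
  choose u hu1 hu2 hu3 using hu
  refine ⟨X, hX, fun σ => ⟨fun k => expect (dropout ps pc) σ k u, fun k => ⟨?_,
    expect_mono (dropout_mem hps hpc) fun l _ => hu1 l,
    expect_mono (dropout_mem hps hpc) fun l _ => hu2 l⟩⟩⟩
  have hinit : Measurable[I.later k] fun ω => (I.x₀ ω, I.est₀ ω) :=
    (comap_measurable _).mono (sigma_le_later (i := Source.init) (Or.inl (Or.inl rfl))) le_rfl
  have hnoise : ∀ j, Measurable[I.later k] (I.w j) := fun j =>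
    (comap_measurable _).mono
      (sigma_le_later (i := Source.noise j) (Or.inl (Or.inr ⟨j, rfl⟩))) le_rfl
  have hquad : Measurable fun z : Fin n → ℝ => ENNReal.ofReal (z ⬝ᵥ (Q *ᵥ z)) :=
    (Continuous.dotProduct continuous_id
      (Continuous.matrix_mulVec continuous_const continuous_id)).measurable.ennreal_ofReal
  rw [← lintegral_history hI hps hpc σ k (fun h => hquad.comp (measurable_state P
    (measurable_snd.comp hinit) ((measurable_fst.comp hinit).sub (measurable_snd.comp hinit))
    hnoise h)) (fun h => ?_) hu3]
  · refine lintegral_congr fun ω => ?_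
    rw [loop_eq_loopAlong, (loopAlong_eq_parts P hF I ω _).1]
    rfl
  · refine le_trans ?_ (hu1 h)
    exact (runFrom_nonneg P hR (fun _ => Cov.nonneg_zero) h).cost_nonneg hQ

end Model

end Bounds

end HalfDuplex

namespace HalfDuplex

/-! ### Long-term average costs -/

section LongTerm

variable {Ω : Type*} [MeasurableSpace Ω] {μ : Measure Ω} {n m v : ℕ} [NeZero v]
  {P : Plant n m} {Q R : Matrix (Fin n) (Fin n) ℝ} {I : Inputs Ω n} {ps pc : ℝ}

lemma averageCost_eq {σ : Policy} {r : ℕ → ℝ} (hr0 : ∀ k, 0 ≤ r k)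
    (hr : ∀ k, P.expectedCost v Q I μ σ k = ENNReal.ofReal (r k)) (N : ℕ) :
    P.averageCost v Q I μ σ N = ENNReal.ofReal ((∑ k ∈ Finset.range N, r k) / N) := by
  simp only [Plant.averageCost, hr]
  rw [← ENNReal.ofReal_sum_of_nonneg fun k _ => hr0 k]
  rcases N.eq_zero_or_pos with rfl | hN
  · simp
  · rw [ENNReal.ofReal_div_of_pos (by exact_mod_cast hN), ENNReal.ofReal_natCast]

lemma tendsto_sum_div {r : ℕ → ℝ} {J K : ℝ}
    (hle : ∀ N : ℕ, ∑ k ∈ Finset.range N, r k ≤ N * J + K)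
    (hge : ∀ N : ℕ, N * J - K ≤ ∑ k ∈ Finset.range N, r k) :
    Tendsto (fun N : ℕ => (∑ k ∈ Finset.range N, r k) / N) atTop (𝓝 J) := by
  have hK : Tendsto (fun N : ℕ => K / (N : ℝ)) atTop (𝓝 0) :=
    tendsto_const_div_atTop_nhds_zero_nat K
  have h1 : Tendsto (fun N : ℕ => J - K / (N : ℝ)) atTop (𝓝 J) := by
    simpa using tendsto_const_nhds.sub hK
  have h2 : Tendsto (fun N : ℕ => J + K / (N : ℝ)) atTop (𝓝 J) := by
    simpa using tendsto_const_nhds.add hK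
  refine tendsto_of_tendsto_of_tendsto_of_le_of_le' h1 h2 ?_ ?_ <;>
    filter_upwards [eventually_gt_atTop 0] with N hN
  · have hN' : (0 : ℝ) < N := by exact_mod_cast hN
    rw [le_div_iff₀ hN', sub_mul, div_mul_cancel₀ _ hN'.ne']
    linarith [hge N]
  · have hN' : (0 : ℝ) < N := by exact_mod_cast hN
    rw [div_le_iff₀ hN', add_mul, div_mul_cancel₀ _ hN'.ne']
    linarith [hle N]

/-- No policy has an average cost below the constant of the optimality equation. -/
lemma le_limsup_averageCost (hps : ps ∈ Set.Ioo (0 : ℝ) 1) (hpc : pc ∈ Set.Ioo (0 : ℝ) 1)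
    (hQ : Q.PosSemidef) (hR : R.PosSemidef) {J C : ℝ} {g : Cov n → ℝ} (hC : 1 ≤ C)
    (hopt : P.OptimalityEquation Q R (dropout ps pc) J C g) {σ : Policy} {r : ℕ → ℝ}
    (hr : ∀ k, P.expectedCost v Q I μ σ k = ENNReal.ofReal (r k))
    (hle : ∀ k, expect (dropout ps pc) σ k
      (fun h => Cov.cost Q (P.runFrom R 0 (fun _ => 0) h)) ≤ r k) :
    ENNReal.ofReal J ≤ limsup (P.averageCost v Q I μ σ) atTop := by
  have herr := dropout_mem hps hpc
  have hZ : ∀ h, (P.runFrom R 0 (fun _ => 0) h).Nonneg :=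
    runFrom_nonneg P hR fun _ => Cov.nonneg_zero
  have ha : ∀ k, 0 ≤ expect (dropout ps pc) σ k
      fun h => Cov.cost Q (P.runFrom R 0 (fun _ => 0) h) := fun k =>
    expect_nonneg herr fun l _ => (hZ l).cost_nonneg hQ
  have hfreq : ∀ ε : ℝ, 0 < ε →
      ENNReal.ofReal (J - ε) ≤ limsup (P.averageCost v Q I μ σ) atTop := by
    intro ε hε
    have h := frequently_le_sum_of_relValue (zero_lt_one.trans_le hC) ha
      (expect_relValue_nonneg (σ := σ) herr hopt hZ) (expect_relValue_le herr hopt hZ)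
      (fun k => le_expect_cost_add herr hopt hZ (runFrom_follows P _) (Nat.zero_le k)) hε
    refine le_limsup_of_frequently_le ((h.and_eventually (eventually_gt_atTop 0)).mono ?_)
    rintro N ⟨hN, hpos⟩
    rw [averageCost_eq (fun k => (ha k).trans (hle k)) hr]
    refine ENNReal.ofReal_le_ofReal ?_
    rw [le_div_iff₀ (by exact_mod_cast hpos)]
    exact hN.trans (Finset.sum_le_sum fun k _ => hle k)
  have hlim : Tendsto (fun ε : ℝ => ENNReal.ofReal (J - ε)) (𝓝[>] 0) (𝓝 (ENNReal.ofReal J)) := by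
    refine (ENNReal.continuous_ofReal.tendsto J).comp ?_
    have h : Tendsto (fun ε : ℝ => J - ε) (𝓝 0) (𝓝 (J - 0)) := tendsto_const_nhds.sub tendsto_id
    rw [sub_zero] at h
    exact h.mono_left nhdsWithin_le_nhds
  exact le_of_tendsto hlim (eventually_mem_nhdsWithin.mono fun ε hε => hfreq ε hε)

/-- Linearly growing expected costs have no finite average. -/
lemma not_tendsto_averageCost {σ : Policy} {r : ℕ → ℝ} {c : ℝ} (hc : 0 < c)
    (hr : ∀ k, P.expectedCost v Q I μ σ k = ENNReal.ofReal (r k)) (hle : ∀ k : ℕ, c * k ≤ r k)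
    {J : ℝ≥0∞} (hJ : J < ∞) : ¬ Tendsto (P.averageCost v Q I μ σ) atTop (𝓝 J) := by
  intro h
  have hr0 : ∀ k, 0 ≤ r k := fun k => (by positivity : (0 : ℝ) ≤ c * k).trans (hle k)
  have hsum : ∀ N : ℕ, c / 2 * (N * (N - 1)) ≤ ∑ k ∈ Finset.range N, r k := by
    intro N
    induction N with
    | zero => simp
    | succ N ih =>
      rw [Finset.sum_range_succ]
      push_cast
      linarith [hle N]
  have htop : Tendsto (P.averageCost v Q I μ σ) atTop (𝓝 ∞) := by
    have hlow : Tendsto (fun N : ℕ => c / 2 * ((N : ℝ) - 1)) atTop atTop :=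
      (tendsto_atTop_add_const_right _ (-1) tendsto_natCast_atTop_atTop).const_mul_atTop
        (half_pos hc)
    refine tendsto_nhds_top_mono (ENNReal.tendsto_ofReal_nhds_top.mpr hlow) ?_
    filter_upwards [eventually_gt_atTop 0] with N hN
    rw [averageCost_eq hr0 hr]
    refine ENNReal.ofReal_le_ofReal ?_
    rw [le_div_iff₀ (by exact_mod_cast hN)]
    linarith [hsum N]
  exact hJ.ne (tendsto_nhds_unique h htop)

/-- Reliable links: the minimizing actions of the optimality equation, evaluated at the covariances
that the indicators encode, give an optimal policy. -/
lemma exists_isOptimalStabilizing [IsProbabilityMeasure μ] (hQ : Q.PosDef) (hR : R.PosDef)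
    (hF : P.closed ^ v = 0) (hps : ps ∈ Set.Ioo (0 : ℝ) 1) (hpc : pc ∈ Set.Ioo (0 : ℝ) 1)
    (hI : I.IsModel μ R ps pc) (hs : ps * specRadius P.A ^ 2 < 1)
    (hc : pc * specRadius P.A ^ 2 < 1) :
    ∃ π : Indicators v → Action, P.IsOptimalStabilizing v Q I μ π := by
  obtain ⟨J, C, g, hJ, hC, hopt⟩ :=
    exists_optimality_equation P hQ hR.posSemidef hF hps hpc hs hc
  obtain ⟨X, hX, hcost⟩ :=
    exists_expectedCost_bounds P hF hQ.posSemidef hR.posSemidef hps hpc hI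
  have hmin : ∀ s : Indicators v, ∃ a,
      actionValue (dropout ps pc) (P.evolve R) g (P.decode R s) a =
        bestValue (dropout ps pc) (P.evolve R) g (P.decode R s) := fun s => by
    rcases min_choice (actionValue (dropout ps pc) (P.evolve R) g (P.decode R s) Action.sensor)
      (actionValue (dropout ps pc) (P.evolve R) g (P.decode R s) Action.controller) with h | h
    · exact ⟨Action.sensor, h.symm⟩
    · exact ⟨Action.controller, h.symm⟩
  choose π hπ using hmin
  refine ⟨π, fun s₀ hs₀ => ⟨ENNReal.ofReal J, ?_, ENNReal.ofReal_lt_top, fun σ => ?_⟩⟩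
  · obtain ⟨r, hr⟩ := hcost (stationary π s₀)
    obtain ⟨K, hK⟩ := exists_stationary_cost_bounds (dropout_mem hps hpc) hQ hR hF hC hopt hπ
      hs₀.ordered hX
    have hr0 : ∀ k, 0 ≤ r k := fun k =>
      (expect_nonneg (dropout_mem hps hpc) fun l _ => (runFrom_nonneg P hR.posSemidef
        (fun _ => Cov.nonneg_zero) l).cost_nonneg hQ.posSemidef).trans (hr k).2.1
    have hlim : Tendsto (fun N : ℕ => (∑ k ∈ Finset.range N, r k) / N) atTop (𝓝 J) :=
      tendsto_sum_div (fun N => (Finset.sum_le_sum fun k _ => (hr k).2.2).trans (hK N).1)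
        fun N => (hK N).2.trans (Finset.sum_le_sum fun k _ => (hr k).2.1)
    refine ((ENNReal.continuous_ofReal.tendsto J).comp hlim).congr fun N => ?_
    exact (averageCost_eq hr0 (fun k => (hr k).1) N).symm
  · obtain ⟨r, hr⟩ := hcost σ
    exact le_limsup_averageCost hps hpc hQ.posSemidef hR.posSemidef hC hopt
      (fun k => (hr k).1) fun k => (hr k).2.1

/-- An unreliable link: no policy stabilizes the plant. -/
lemma not_hasLongTermCost_of_one_le [IsProbabilityMeasure μ] [NeZero n] (hQ : Q.PosDef)
    (hR : R.PosDef) (hF : P.closed ^ v = 0) (hps : ps ∈ Set.Ioo (0 : ℝ) 1)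
    (hpc : pc ∈ Set.Ioo (0 : ℝ) 1) (hI : I.IsModel μ R ps pc)
    (hp : 1 ≤ max ps pc * specRadius P.A ^ 2) (σ : Policy) {J : ℝ≥0∞} (hJ : J < ∞) :
    ¬ P.HasLongTermCost v Q I μ σ J := by
  obtain ⟨X, -, hcost⟩ :=
    exists_expectedCost_bounds P hF hQ.posSemidef hR.posSemidef hps hpc hI
  obtain ⟨r, hr⟩ := hcost σ
  obtain ⟨c, hc, hgrow⟩ := exists_specRadius_pow_le_trace P.A hQ hR
  refine not_tendsto_averageCost hc (fun k => (hr k).1) (fun k => ?_) hJ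
  refine le_trans ?_ ((sum_max_pow_mul_trace_le_expect_cost P hQ.posSemidef hR.posSemidef hps hpc
    k).trans (hr k).2.1)
  have hp0 : 0 ≤ max ps pc := hps.1.le.trans (le_max_left _ _)
  have hterm : ∀ l ∈ Finset.range k,
      c ≤ max ps pc ^ l * (Q * (P.A ^ l * R * (P.A ^ l)ᵀ)).trace := fun l _ => by
    refine le_trans ?_ (mul_le_mul_of_nonneg_left (hgrow l) (pow_nonneg hp0 l))
    rw [mul_left_comm, ← mul_pow]
    exact le_mul_of_one_le_right hc.le (one_le_pow₀ hp)
  simpa [mul_comm] using Finset.card_nsmul_le_sum _ _ _ hterm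

end LongTerm

end HalfDuplex

theorem theorem3 {n m v : ℕ} [NeZero v] (P : HalfDuplex.Plant n m)
    (Q R : Matrix (Fin n) (Fin n) ℝ) (hQ : Q.PosDef) (hR : R.PosDef)
    (hA : 1 < HalfDuplex.specRadius P.A)
    (hK : (P.A + P.B * P.K) ^ v = 0)
    (ps pc : ℝ) (hps : ps ∈ Set.Ioo (0 : ℝ) 1) (hpc : pc ∈ Set.Ioo (0 : ℝ) 1)
    {Ω : Type*} [MeasurableSpace Ω] (μ : MeasureTheory.Measure Ω)
    [MeasureTheory.IsProbabilityMeasure μ]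
    (I : HalfDuplex.Inputs Ω n) (hI : I.IsModel μ R ps pc) :
    (∃ π : HalfDuplex.Indicators v → HalfDuplex.Action, P.IsOptimalStabilizing v Q I μ π) ↔
      max ps pc < 1 / HalfDuplex.specRadius P.A ^ 2 := by
  have hρ : 0 < HalfDuplex.specRadius P.A ^ 2 := by positivity
  rw [lt_div_iff₀ hρ]
  constructor
  · rintro ⟨π, hπ⟩
    by_contra! hp
    have : NeZero n := by
      refine ⟨?_⟩
      rintro rfl
      -- An empty matrix has spectral radius zero.
      simp [HalfDuplex.specRadius, spectralRadius] at hA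
      linarith
    obtain ⟨J, hJ, hfin, -⟩ := hπ ⟨fun _ => 2, fun _ => 2⟩ fun i => by simp
    exact HalfDuplex.not_hasLongTermCost_of_one_le hQ hR hK hps hpc hI hp _ hfin hJ
  · intro hp
    exact HalfDuplex.exists_isOptimalStabilizing hQ hR hK hps hpc hI
      ((mul_le_mul_of_nonneg_right (le_max_left _ _) hρ.le).trans_lt hp)
      ((mul_le_mul_of_nonneg_right (le_max_right _ _) hρ.le).trans_lt hp)
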